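/- Let $\mathbb S^2\subset\mathbb R^3$ be the unit sphere with spherical coordinates $(\theta,\varphi)$, where $0\le\theta\le 2\pi$ and $0\le\varphi\le\pi$ is the angle from the North Pole, and let $C_{S,\alpha}=\{\alpha\le\varphi\le\pi\}$. Let $E\subset\mathbb S^2$ be compact and let $Q:E\to[0,\infty]$ be an external field, that is, $Q$ is lower semicontinuous and finite on a set of positive surface measure; assume that $Q$ is rotationally symmetric about the polar axis, $Q=Q(\varphi)$. For a Borel probability measure $\mu$ supported on $E$ put $$I_Q(\mu)=\iint\frac{d\mu(x)\,d\mu(y)}{|x-y|}+2\int Q\,d\mu,\qquad V_Q=\inf_\mu I_Q(\mu).$$ Let $\mu_Q$ be a probability measure supported on $E$ with $I_Q(\mu_Q)=V_Q$ (the equilibrium measure), let $S_Q=\operatorname{supp}\mu_Q$ and $F_Q=V_Q-\int Q\,d\mu_Q$. Suppose that $S_Q=C_{S,\alpha}$ with $0<\alpha\le\pi$, and that $Q$ is (defined and) of class $C^2$, with values in $[0,\infty)$, on an open neighbourhood $N$ of $S_Q$ in $\mathbb S^2$. Let $$g(t)=\frac1{4\pi}\frac{d}{dt}\int_t^\pi\frac{Q(\xi)\sin\xi\,d\xi}{\sqrt{\cos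 t-\cos\xi}},\qquad F(\varphi)=\frac2\pi\,\frac1{\sin\varphi}\,\frac{d}{d\varphi}\int_\alpha^\varphi\frac{g(t)\sin t\,dt}{\sqrt{\cos t-\cos\varphi}}.$$ Then these integrals and derivatives exist for $t,\varphi\in(\alpha,\pi)$, $F(\varphi)\sin\varphi$ is integrable on $(\alpha,\pi)$, $V_Q$ is finite, and $d\mu_Q=f(\varphi)\sin\varphi\,d\theta\,d\varphi$ on $C_{S,\alpha}$, with the density $f\ge0$ on $(\alpha,\pi)$ given by $$f(\varphi)=\frac{F_Q}{4\pi}\left\{1+\frac2\pi\left[\sqrt{\frac{1-\cos\alpha}{\cos\alpha-\cos\varphi}}-\arctan\sqrt{\frac{1-\cos\alpha}{\cos\alpha-\cos\varphi}}\,\right]\right\}+F(\varphi),$$ and the constant $F_Q$ is given by $$F_Q=\frac{\pi}{\sin\alpha+\pi-\alpha}\left\{1-2\pi\int_\alpha^\pi F(\varphi)\sin\varphi\,d\varphi\right\}.$$ -/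

import Mathlib

open MeasureTheory Set
open scoped ENNReal Manifold ContDiff

noncomputable section

namespace SphereEnergy

instance finrankFact : Fact (Module.finrank ℝ (EuclideanSpace ℝ (Fin 3)) = 2 + 1) :=
  ⟨by simp⟩

/-- The unit sphere in three-dimensional Euclidean space. Distances between its points are the
Euclidean (chordal) ones. -/
abbrev S2 : Type := Metric.sphere (0 : EuclideanSpace ℝ (Fin 3)) 1

/-- The point of the sphere with azimuth `θ` and polar angle `φ`. -/
def sph (θ φ : ℝ) : S2 :=
  ⟨!₂[Real.sin φ * Real.cos θ, Real.sin φ * Real.sin θ, Real.cos φ], by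
    rw [mem_sphere_zero_iff_norm, EuclideanSpace.norm_eq]
    simp only [Fin.sum_univ_three, Real.norm_eq_abs, sq_abs]
    simp only [Matrix.cons_val_zero, Matrix.cons_val_one, Matrix.cons_val]
    rw [Real.sqrt_eq_one]
    linear_combination (Real.sin φ) ^ 2 * Real.sin_sq_add_cos_sq θ + Real.sin_sq_add_cos_sq φ⟩

/-- The polar angle of a point, measured from the North Pole, in `[0, π]`. -/
def polarAngle (x : S2) : ℝ := Real.arccos (x.1 2)

/-- The closed spherical cap centred at the South Pole: the points with `α ≤ φ ≤ π`. -/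
def capS (α : ℝ) : Set S2 := {x | α ≤ polarAngle x ∧ polarAngle x ≤ Real.pi}

/-- Lebesgue surface measure on the sphere, `dS = sin φ dθ dφ`. -/
def surfaceMeasure : Measure S2 :=
  (((volume : Measure (ℝ × ℝ)).restrict (Icc 0 (2 * Real.pi) ×ˢ Icc 0 Real.pi)).withDensity
    (fun p => ENNReal.ofReal (Real.sin p.2))).map (fun p => sph p.1 p.2)

/-- Unit positive Borel measures on the sphere supported on `E`. -/
def unitMeasures (E : Set S2) : Set (Measure S2) :=
  {μ | IsProbabilityMeasure μ ∧ μ Eᶜ = 0}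

/-- The Newtonian energy, with kernel `1 / |x - y|` (equal to `∞` on the diagonal). -/
def energy (μ : Measure S2) : ℝ≥0∞ := ∫⁻ x, ∫⁻ y, (edist x y)⁻¹ ∂μ ∂μ

/-- The weighted energy `I_Q(μ) = I(μ) + 2 ∫ Q dμ`. -/
def weightedEnergy (Q : S2 → ℝ≥0∞) (μ : Measure S2) : ℝ≥0∞ :=
  energy μ + 2 * ∫⁻ x, Q x ∂μ

/-- The minimal weighted energy `V_Q` over unit measures on `E`. -/
def minEnergy (E : Set S2) (Q : S2 → ℝ≥0∞) : ℝ≥0∞ :=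
  ⨅ μ ∈ unitMeasures E, weightedEnergy Q μ

/-- External fields on `E`: lower semicontinuous functions `E → [0, ∞]` that are finite on a set of
positive surface measure. Values of `Q` off `E` do not matter here. -/
def IsExternalField (E : Set S2) (Q : S2 → ℝ≥0∞) : Prop :=
  LowerSemicontinuousOn Q E ∧ 0 < surfaceMeasure {x ∈ E | Q x < ⊤}

/-- Extremal measures: unit measures on `E` with `I_Q(μ) = V_Q`. -/
def IsExtremal (E : Set S2) (Q : S2 → ℝ≥0∞) (μ : Measure S2) : Prop :=
  μ ∈ unitMeasures E ∧ weightedEnergy Q μ = minEnergy E Q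

/-- The constant `F_Q = V_Q - ∫ Q dμ_Q`. -/
def robinConst (E : Set S2) (Q : S2 → ℝ≥0∞) (μ : Measure S2) : ℝ :=
  (minEnergy E Q).toReal - (∫⁻ x, Q x ∂μ).toReal

/-- A rotationally symmetric field as a function of the polar angle. -/
def profile (Q : S2 → ℝ≥0∞) (φ : ℝ) : ℝ := (Q (sph 0 φ)).toReal

/-- The integrand `q(ξ) sin ξ / √(cos t - cos ξ)`. -/
def innerIntegrand (q : ℝ → ℝ) (t ξ : ℝ) : ℝ :=
  q ξ * Real.sin ξ / √(Real.cos t - Real.cos ξ)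

/-- The inner Abel-type integral, over `[t, π]`. -/
def innerAbel (q : ℝ → ℝ) (t : ℝ) : ℝ := ∫ ξ in t..Real.pi, innerIntegrand q t ξ

/-- The function `g`. -/
def auxG (q : ℝ → ℝ) (t : ℝ) : ℝ := 1 / (4 * Real.pi) * deriv (innerAbel q) t

/-- The integrand `g(t) sin t / √(cos t - cos φ)`. -/
def outerIntegrand (q : ℝ → ℝ) (φ t : ℝ) : ℝ :=
  auxG q t * Real.sin t / √(Real.cos t - Real.cos φ)

/-- The outer Abel-type integral, over `[α, φ]`. -/
def outerAbel (q : ℝ → ℝ) (α φ : ℝ) : ℝ := ∫ t in α..φ, outerIntegrand q φ t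

/-- The function `F`. -/
def auxF (q : ℝ → ℝ) (α φ : ℝ) : ℝ :=
  2 / Real.pi * (1 / Real.sin φ) * deriv (outerAbel q α) φ

/-- The density formula, with constant `c` in the role of `F_Q`. -/
def densityFormula (q : ℝ → ℝ) (α c φ : ℝ) : ℝ :=
  c / (4 * Real.pi) *
    (1 + 2 / Real.pi *
      (√((1 - Real.cos α) / (Real.cos α - Real.cos φ)) -
        Real.arctan √((1 - Real.cos α) / (Real.cos α - Real.cos φ)))) +
    auxF q α φ

end SphereEnergy

end

/-!
The argument has two halves: the variational conditions for the equilibrium measure, and an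
explicit solution of the integral equation which they give on the cap.

*Variational half.* Comparing `μ` with `(1 - t) μ + t ν` (`first_variation`) shows that
`U^μ + Q ≥ F_Q` almost everywhere with respect to every measure on `E` of finite energy for which
`Q` is integrable, with equality `μ`-almost everywhere. As the potential is lower semicontinuous and `Q` is continuous near
the support, `U^μ + Q = F_Q` almost everywhere on the support, both for `μ` and for surface measure
(`potential_add_field_eq`). Finite energy forbids atoms, so the cap is not just the South Pole. A
measure of finite energy is determined by its potential (`measure_eq_of_potential_eq`): the kernel
`1/r` is a superposition of Gaussians, and a Gaussian on the sphere expands into powers of the inner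
product, so that the energy of a signed measure is a sum of squares of its moments.

*Explicit half.* In the height `x = 1 - cos φ` the kernel averaged over circles of latitude factors
as `2 ∫ ds / (√s √(2 - s) √(s - x) √(s - y))` over `s > max (x, y)` (`lintegral_circle`); this is
Landen's transformation. The potential of the density `p(y)` is therefore a composition of two Abel
transforms (`potential_withDensity_height`), each of which is inverted by a half-order derivative
(`halfDeriv`), because two half-order integrations make one integration
(`abelTransform_abelTransform`). On the cap the field is a `C²` function `h` of `√(2 - x)`
(`exists_profile_extension`); inverting the outer transform yields `capSource`, inverting the inner
one the density `(1/π) halfDeriv a capSource`, where `a = 1 - cos α`.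

This density is not known to be nonnegative beforehand. It is written as a difference of two
positive densities (`posDensity`), and uniqueness is applied to the identity "`μ` plus the negative
part has the same potential as the positive part" (`add_posMeasure_eq`). That `μ` is a positive
measure then makes the density nonnegative (`eq_withDensity_capDensity`). The closed form of the
half-order derivative of `√s` produces the arctangent term (`densityFormula_eq`), and total mass one
determines `F_Q` (`integral_halfDeriv_capSource`).
-/

namespace SphereEnergy

/-! ### Substitutions in one variable -/

section Substitution

variable {f f' : ℝ → ℝ} {a b : ℝ}

lemma image_Ioo_of_deriv_pos (hab : a ≤ b) (hc : ContinuousOn f (Icc a b))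
    (hd : ∀ x ∈ Ioo a b, HasDerivAt f (f' x) x) (hpos : ∀ x ∈ Ioo a b, 0 < f' x) :
    f '' Ioo a b = Ioo (f a) (f b) ∧ InjOn f (Ioo a b) := by
  have hm : StrictMonoOn f (Icc a b) := by
    refine strictMonoOn_of_deriv_pos (convex_Icc a b) hc fun x hx => ?_
    rw [interior_Icc] at hx
    rw [(hd x hx).deriv]
    exact hpos x hx
  exact ⟨hc.image_Ioo_of_strictMonoOn hab hm, hm.injOn.mono Ioo_subset_Icc_self⟩

lemma lintegral_Ioo_subst (hab : a ≤ b) (hc : ContinuousOn f (Icc a b))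
    (hd : ∀ x ∈ Ioo a b, HasDerivAt f (f' x) x) (hpos : ∀ x ∈ Ioo a b, 0 < f' x)
    (g : ℝ → ℝ≥0∞) :
    ∫⁻ y in Ioo (f a) (f b), g y = ∫⁻ x in Ioo a b, ENNReal.ofReal (f' x) * g (f x) := by
  obtain ⟨him, hinj⟩ := image_Ioo_of_deriv_pos hab hc hd hpos
  rw [← him, lintegral_image_eq_lintegral_abs_deriv_mul measurableSet_Ioo
    (fun x hx => (hd x hx).hasDerivWithinAt) hinj]
  exact setLIntegral_congr_fun measurableSet_Ioo fun x hx => by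
    simp only [abs_of_pos (hpos x hx)]

lemma integrableOn_Ioo_subst (hab : a ≤ b) (hc : ContinuousOn f (Icc a b))
    (hd : ∀ x ∈ Ioo a b, HasDerivAt f (f' x) x) (hpos : ∀ x ∈ Ioo a b, 0 < f' x)
    (g : ℝ → ℝ) :
    IntegrableOn g (Ioo (f a) (f b)) ↔ IntegrableOn (fun x => f' x * g (f x)) (Ioo a b) := by
  obtain ⟨him, hinj⟩ := image_Ioo_of_deriv_pos hab hc hd hpos
  rw [← him, integrableOn_image_iff_integrableOn_abs_deriv_smul measurableSet_Ioo
    (fun x hx => (hd x hx).hasDerivWithinAt) hinj]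
  exact integrableOn_congr_fun (fun x hx => by
    simp only [abs_of_pos (hpos x hx), smul_eq_mul]) measurableSet_Ioo

lemma intervalIntegrable_subst (hab : a ≤ b) (hc : ContinuousOn f (Icc a b))
    (hd : ∀ x ∈ Ioo a b, HasDerivAt f (f' x) x) (hpos : ∀ x ∈ Ioo a b, 0 < f' x)
    (hfab : f a ≤ f b) (g : ℝ → ℝ) :
    IntervalIntegrable g volume (f a) (f b) ↔
      IntervalIntegrable (fun x => f' x * g (f x)) volume a b := by
  rw [intervalIntegrable_iff_integrableOn_Ioo_of_le hfab,
    intervalIntegrable_iff_integrableOn_Ioo_of_le hab, integrableOn_Ioo_subst hab hc hd hpos]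

lemma intervalIntegral_subst (hab : a ≤ b) (hc : ContinuousOn f (Icc a b))
    (hd : ∀ x ∈ Ioo a b, HasDerivAt f (f' x) x) (hpos : ∀ x ∈ Ioo a b, 0 < f' x)
    (hfab : f a ≤ f b) (g : ℝ → ℝ) :
    ∫ y in (f a)..(f b), g y = ∫ x in a..b, f' x * g (f x) := by
  obtain ⟨him, hinj⟩ := image_Ioo_of_deriv_pos hab hc hd hpos
  rw [intervalIntegral.integral_of_le hfab, intervalIntegral.integral_of_le hab,
    integral_Ioc_eq_integral_Ioo, integral_Ioc_eq_integral_Ioo, ← him,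
    integral_image_eq_integral_abs_deriv_smul measurableSet_Ioo
    (fun x hx => (hd x hx).hasDerivWithinAt) hinj]
  exact setIntegral_congr_fun measurableSet_Ioo fun x hx => by
    simp only [abs_of_pos (hpos x hx), smul_eq_mul]

end Substitution

lemma hasDerivAt_one_sub_cos (x : ℝ) :
    HasDerivAt (fun φ => 1 - Real.cos φ) (Real.sin x) x := by
  simpa using (Real.hasDerivAt_cos x).const_sub 1

lemma hasDerivAt_add_mul_sin_sq (a c x : ℝ) :
    HasDerivAt (fun τ => a + c * Real.sin τ ^ 2) (2 * c * Real.sin x * Real.cos x) x := by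
  have := (((Real.hasDerivAt_sin x).pow 2).const_mul c).const_add a
  exact this.congr_deriv (by push_cast; ring)

lemma sin_pos_cos_pos {x : ℝ} (hx : x ∈ Ioo 0 (Real.pi / 2)) : 0 < Real.sin x ∧ 0 < Real.cos x :=
  ⟨Real.sin_pos_of_pos_of_lt_pi hx.1 (by linarith [hx.2, Real.pi_pos]),
    Real.cos_pos_of_mem_Ioo ⟨by linarith [hx.1, Real.pi_pos], hx.2⟩⟩

/-- The substitution `s = a + c sin² τ` in `∫ k(s) ds / √(a + c - s)`. -/
lemma integrand_sin_sq {a c x : ℝ} (hc : 0 < c) (hx : x ∈ Ioo 0 (Real.pi / 2)) (k : ℝ → ℝ) :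
    2 * c * Real.sin x * Real.cos x *
      (k (a + c * Real.sin x ^ 2) / √(a + c - (a + c * Real.sin x ^ 2))) =
    2 * √c * (k (a + c * Real.sin x ^ 2) * Real.sin x) := by
  have h1 := (sin_pos_cos_pos hx).2
  have h2 : a + c - (a + c * Real.sin x ^ 2) = c * Real.cos x ^ 2 := by
    rw [Real.cos_sq']; ring
  have h3 : √c ≠ 0 := (Real.sqrt_pos.2 hc).ne'
  rw [h2, Real.sqrt_mul hc.le, Real.sqrt_sq h1.le]
  have h4 : c = √c * √c := (Real.mul_self_sqrt hc.le).symm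
  field_simp
  linear_combination k (a + c * Real.sin x ^ 2) * (Real.sin x) * h4

section SinSq

variable {a c : ℝ}

lemma sin_sq_end : a + c * Real.sin (Real.pi / 2) ^ 2 = a + c := by simp

lemma sin_sq_start : a + c * Real.sin 0 ^ 2 = a := by simp

lemma continuous_add_mul_sin_sq : Continuous (fun τ => a + c * Real.sin τ ^ 2) := by fun_prop

lemma add_mul_sin_sq_deriv_pos (hc : 0 < c) :
    ∀ x ∈ Ioo 0 (Real.pi / 2), 0 < 2 * c * Real.sin x * Real.cos x := fun x hx => by
  have := sin_pos_cos_pos hx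
  have h1 := this.1
  have h2 := this.2
  positivity

lemma abel_sin_sq (hc : 0 < c) (k : ℝ → ℝ) :
    ∫ s in a..(a + c), k s / √(a + c - s) =
      2 * √c * ∫ τ in (0 : ℝ)..(Real.pi / 2), k (a + c * Real.sin τ ^ 2) * Real.sin τ := by
  have hp := Real.pi_pos
  have := intervalIntegral_subst (f := fun τ => a + c * Real.sin τ ^ 2)
    (f' := fun x => 2 * c * Real.sin x * Real.cos x)
    (by positivity : (0 : ℝ) ≤ Real.pi / 2) continuous_add_mul_sin_sq.continuousOn
    (fun x _ => hasDerivAt_add_mul_sin_sq a c x) (add_mul_sin_sq_deriv_pos hc)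
    (by simp only [sin_sq_end, sin_sq_start]; linarith) (fun s => k s / √(a + c - s))
  simp only [sin_sq_end, sin_sq_start] at this
  rw [this, ← intervalIntegral.integral_const_mul, intervalIntegral.integral_of_le (by positivity),
    intervalIntegral.integral_of_le (by positivity), integral_Ioc_eq_integral_Ioo,
    integral_Ioc_eq_integral_Ioo]
  exact setIntegral_congr_fun measurableSet_Ioo fun x hx => integrand_sin_sq hc hx k

lemma intervalIntegrable_abel_sin_sq (hc : 0 < c) (k : ℝ → ℝ)
    (h : IntervalIntegrable (fun τ => k (a + c * Real.sin τ ^ 2) * Real.sin τ)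
      volume 0 (Real.pi / 2)) :
    IntervalIntegrable (fun s => k s / √(a + c - s)) volume a (a + c) := by
  have hp := Real.pi_pos
  have := intervalIntegrable_subst (f := fun τ => a + c * Real.sin τ ^ 2)
    (f' := fun x => 2 * c * Real.sin x * Real.cos x)
    (by positivity : (0 : ℝ) ≤ Real.pi / 2) continuous_add_mul_sin_sq.continuousOn
    (fun x _ => hasDerivAt_add_mul_sin_sq a c x) (add_mul_sin_sq_deriv_pos hc)
    (by simp only [sin_sq_end, sin_sq_start]; linarith) (fun s => k s / √(a + c - s))
  simp only [sin_sq_end, sin_sq_start] at this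
  rw [this, intervalIntegrable_iff_integrableOn_Ioo_of_le (by positivity)]
  have h' := (h.const_mul (2 * √c))
  rw [intervalIntegrable_iff_integrableOn_Ioo_of_le (by positivity)] at h'
  exact h'.congr_fun (fun x hx => (integrand_sin_sq hc hx k).symm) measurableSet_Ioo

end SinSq

/-! ### Half-order integration -/

/-- The kernel `1 / √u`, extended by `0` to `u ≤ 0`, so that Abel integrals may be taken over
half-lines. -/
noncomputable def invSqrt (u : ℝ) : ℝ≥0∞ := ENNReal.ofReal (1 / √u)

lemma invSqrt_of_nonpos {u : ℝ} (hu : u ≤ 0) : invSqrt u = 0 := by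
  simp [invSqrt, Real.sqrt_eq_zero_of_nonpos hu]

lemma invSqrt_ne_top (u : ℝ) : invSqrt u ≠ ⊤ := ENNReal.ofReal_ne_top

@[fun_prop]
lemma measurable_invSqrt : Measurable invSqrt := by
  unfold invSqrt; fun_prop

/-- The Abel transform `∫_a^x k(s) ds / √(x - s)` of an extended nonnegative function. -/
noncomputable def abelTransform (a : ℝ) (k : ℝ → ℝ≥0∞) (x : ℝ) : ℝ≥0∞ :=
  ∫⁻ s in Ioi a, invSqrt (x - s) * k s

lemma measurable_abelTransform (a : ℝ) {k : ℝ → ℝ≥0∞} (hk : Measurable k) :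
    Measurable (abelTransform a k) := by
  unfold abelTransform
  exact Measurable.lintegral_prod_right' (f := fun p : ℝ × ℝ => invSqrt (p.1 - p.2) * k p.2)
    (by fun_prop)

lemma lintegral_eq_Ioo_of_zero {F : ℝ → ℝ≥0∞} {A : Set ℝ} (hA : MeasurableSet A) {b c : ℝ}
    (hsub : Ioo b c ⊆ A) (h : ∀ s ∈ A, s ∉ Ioo b c → F s = 0) :
    ∫⁻ s in A, F s = ∫⁻ s in Ioo b c, F s := by
  rw [← lintegral_indicator hA, ← lintegral_indicator measurableSet_Ioo]
  congr 1
  ext s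
  by_cases hs : s ∈ Ioo b c
  · rw [indicator_of_mem hs, indicator_of_mem (hsub hs)]
  · rw [indicator_of_notMem hs]
    by_cases hsA : s ∈ A
    · rw [indicator_of_mem hsA, h s hsA hs]
    · rw [indicator_of_notMem hsA]

lemma abelTransform_eq_Ioo (a : ℝ) (k : ℝ → ℝ≥0∞) (x : ℝ) :
    abelTransform a k x = ∫⁻ s in Ioo a x, invSqrt (x - s) * k s := by
  refine lintegral_eq_Ioo_of_zero measurableSet_Ioi Ioo_subset_Ioi_self fun s hs hs' => ?_
  have : x ≤ s := by
    by_contra hlt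
    exact hs' ⟨hs, not_le.1 hlt⟩
  rw [invSqrt_of_nonpos (by linarith), zero_mul]

/-- `B(1/2, 1/2) = π`. -/
lemma lintegral_beta {s x : ℝ} (hsx : s < x) :
    ∫⁻ y in Ioo s x, invSqrt (x - y) * invSqrt (y - s) = ENNReal.ofReal Real.pi := by
  have hp := Real.pi_pos
  have hc : 0 < x - s := sub_pos.2 hsx
  have := lintegral_Ioo_subst (f := fun τ => s + (x - s) * Real.sin τ ^ 2)
    (f' := fun τ => 2 * (x - s) * Real.sin τ * Real.cos τ)
    (by positivity : (0 : ℝ) ≤ Real.pi / 2) continuous_add_mul_sin_sq.continuousOn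
    (fun τ _ => hasDerivAt_add_mul_sin_sq s (x - s) τ) (add_mul_sin_sq_deriv_pos hc)
    (fun y => invSqrt (x - y) * invSqrt (y - s))
  simp only [sin_sq_end, sin_sq_start, add_sub_cancel] at this
  rw [this]
  have h2 : ∀ τ ∈ Ioo 0 (Real.pi / 2), ENNReal.ofReal (2 * (x - s) * Real.sin τ * Real.cos τ) *
      (invSqrt (x - (s + (x - s) * Real.sin τ ^ 2)) *
        invSqrt (s + (x - s) * Real.sin τ ^ 2 - s)) = ENNReal.ofReal 2 := fun τ hτ => by
    obtain ⟨h1, h2⟩ := sin_pos_cos_pos hτ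
    have e1 : x - (s + (x - s) * Real.sin τ ^ 2) = (x - s) * Real.cos τ ^ 2 := by
      rw [Real.cos_sq']; ring
    have e2 : s + (x - s) * Real.sin τ ^ 2 - s = (x - s) * Real.sin τ ^ 2 := by ring
    rw [e1, e2, invSqrt, invSqrt, ← ENNReal.ofReal_mul (by positivity),
      ← ENNReal.ofReal_mul (by positivity), Real.sqrt_mul hc.le, Real.sqrt_sq h2.le,
      Real.sqrt_mul hc.le, Real.sqrt_sq h1.le]
    congr 1
    have h3 : √(x - s) ≠ 0 := (Real.sqrt_pos.2 hc).ne'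
    have h4 : (x - s) = √(x - s) * √(x - s) := (Real.mul_self_sqrt hc.le).symm
    field_simp
    linear_combination h4
  rw [setLIntegral_congr_fun measurableSet_Ioo h2, setLIntegral_const, Real.volume_Ioo,
    ← ENNReal.ofReal_mul (by norm_num)]
  congr 1; ring

lemma lintegral_beta' {a s x : ℝ} (has : a < s) :
    ∫⁻ y in Ioi a, invSqrt (x - y) * invSqrt (y - s) =
      (Iio x).indicator (fun _ => ENNReal.ofReal Real.pi) s := by
  rw [lintegral_eq_Ioo_of_zero (b := s) (c := x) measurableSet_Ioi
    (fun y hy => has.trans hy.1) (fun y _ hy => ?_)]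
  · by_cases h : s < x
    · rw [lintegral_beta h, indicator_of_mem (mem_Iio.2 h)]
    · rw [indicator_of_notMem (by simpa using h), Ioo_eq_empty h]; simp
  · by_cases h : s < y
    · have : x ≤ y := by
        by_contra hlt
        exact hy ⟨h, not_le.1 hlt⟩
      rw [invSqrt_of_nonpos (by linarith : x - y ≤ 0), zero_mul]
    · rw [invSqrt_of_nonpos (by linarith : y - s ≤ 0), mul_zero]

/-- The Abel transform is, up to the factor `√π`, integration of order one half. -/
lemma abelTransform_abelTransform (a : ℝ) {k : ℝ → ℝ≥0∞} (hk : Measurable k) (x : ℝ) :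
    abelTransform a (abelTransform a k) x = ENNReal.ofReal Real.pi * ∫⁻ s in Ioo a x, k s := by
  have h1 : ∀ y, invSqrt (x - y) * abelTransform a k y =
      ∫⁻ s in Ioi a, invSqrt (x - y) * (invSqrt (y - s) * k s) := fun y => by
    rw [abelTransform, lintegral_const_mul _ (by fun_prop)]
  rw [abelTransform]
  simp_rw [h1]
  rw [lintegral_lintegral_swap (by fun_prop)]
  have h2 : ∀ s ∈ Ioi a, ∫⁻ y in Ioi a, invSqrt (x - y) * (invSqrt (y - s) * k s) =
      (Iio x).indicator (fun s => ENNReal.ofReal Real.pi * k s) s := fun s hs => by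
    simp_rw [← mul_assoc]
    rw [lintegral_mul_const _ (by fun_prop), lintegral_beta' hs]
    by_cases h : s ∈ Iio x
    · rw [indicator_of_mem h, indicator_of_mem h]
    · rw [indicator_of_notMem h, indicator_of_notMem h, zero_mul]
  rw [setLIntegral_congr_fun measurableSet_Ioi h2, setLIntegral_indicator measurableSet_Iio,
    lintegral_const_mul _ hk, Iio_inter_Ioi]

lemma abelTransform_invSqrt {a x : ℝ} (hx : a < x) :
    abelTransform a (fun y => invSqrt (y - a)) x = ENNReal.ofReal Real.pi := by
  rw [abelTransform_eq_Ioo, lintegral_beta hx]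

lemma integral_beta {a s x : ℝ} (has : a ≤ s) (hsx : s < x) :
    Integrable (fun y => 1 / √(x - y) * (1 / √(y - s))) (volume.restrict (Ioo a x)) ∧
    ∫ y in Ioo a x, 1 / √(x - y) * (1 / √(y - s)) = Real.pi := by
  have hnn : ∀ y, 0 ≤ 1 / √(x - y) * (1 / √(y - s)) := fun y => by positivity
  have h1 : ∫⁻ y in Ioo a x, ENNReal.ofReal (1 / √(x - y) * (1 / √(y - s))) =
      ENNReal.ofReal Real.pi := by
    have h2 : ∀ y, ENNReal.ofReal (1 / √(x - y) * (1 / √(y - s))) =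
        invSqrt (x - y) * invSqrt (y - s) := fun y => by
      rw [ENNReal.ofReal_mul (by positivity)]; rfl
    simp_rw [h2]
    rw [lintegral_eq_Ioo_of_zero (b := s) (c := x) measurableSet_Ioo
      (Ioo_subset_Ioo_left has), lintegral_beta hsx]
    intro y hy hy'
    have : y ≤ s := by
      by_contra hlt
      exact hy' ⟨not_le.1 hlt, hy.2⟩
    rw [invSqrt_of_nonpos (by linarith : y - s ≤ 0), mul_zero]
  have hm : Measurable (fun y => 1 / √(x - y) * (1 / √(y - s))) := by fun_prop
  constructor
  · refine ⟨hm.aestronglyMeasurable, ?_⟩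
    rw [hasFiniteIntegral_iff_ofReal (ae_of_all _ hnn), h1]
    exact ENNReal.ofReal_lt_top
  · rw [integral_eq_lintegral_of_nonneg_ae (ae_of_all _ hnn) hm.aestronglyMeasurable, h1,
      ENNReal.toReal_ofReal Real.pi_pos.le]

/-- `abelTransform_abelTransform` for real functions. -/
lemma abel_abel {a x : ℝ} {k : ℝ → ℝ} (hax : a ≤ x) (hk : IntervalIntegrable k volume a x) :
    ∫ y in a..x, (∫ s in a..y, k s / √(y - s)) / √(x - y) = Real.pi * ∫ s in a..x, k s := by
  have hk' : Integrable k (volume.restrict (Ioo a x)) := by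
    rwa [intervalIntegrable_iff_integrableOn_Ioo_of_le hax] at hk
  simp only [intervalIntegral.integral_of_le hax, integral_Ioc_eq_integral_Ioo]
  have h1 : ∀ y ∈ Ioo a x, (∫ s in a..y, k s / √(y - s)) / √(x - y) =
      ∫ s in Ioo a x, k s * (1 / √(x - y) * (1 / √(y - s))) := fun y hy => by
    rw [intervalIntegral.integral_of_le hy.1.le, integral_Ioc_eq_integral_Ioo,
      ← integral_div]
    have : ∀ s ∈ Ioo a x \ Ioo a y, k s * (1 / √(x - y) * (1 / √(y - s))) = 0 := by
      rintro s ⟨hs, hs'⟩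
      have : y ≤ s := by
        by_contra hlt
        exact hs' ⟨hs.1, not_le.1 hlt⟩
      simp [Real.sqrt_eq_zero_of_nonpos (by linarith : y - s ≤ 0)]
    rw [setIntegral_eq_of_subset_of_forall_sdiff_eq_zero measurableSet_Ioo
      (Ioo_subset_Ioo_right hy.2.le) this]
    congr 1; ext s; ring
  rw [setIntegral_congr_fun measurableSet_Ioo h1]
  have hint : Integrable (Function.uncurry fun y s => k s * (1 / √(x - y) * (1 / √(y - s))))
      ((volume.restrict (Ioo a x)).prod (volume.restrict (Ioo a x))) := by
    have hms : AEStronglyMeasurable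
        (Function.uncurry fun y s => k s * (1 / √(x - y) * (1 / √(y - s))))
        ((volume.restrict (Ioo a x)).prod (volume.restrict (Ioo a x))) := by
      refine AEStronglyMeasurable.mul hk'.aestronglyMeasurable.comp_snd ?_
      exact Measurable.aestronglyMeasurable (by fun_prop)
    rw [integrable_prod_iff' hms]
    constructor
    · filter_upwards [ae_restrict_mem measurableSet_Ioo] with s hs
      exact (integral_beta hs.1.le hs.2).1.const_mul (k s)
    · refine (hk'.norm.mul_const Real.pi).congr ?_
      filter_upwards [ae_restrict_mem measurableSet_Ioo] with s hs
      rw [← (integral_beta hs.1.le hs.2).2, ← integral_const_mul]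
      refine integral_congr_ae (ae_of_all _ fun y => ?_)
      simp only [Function.uncurry]
      rw [norm_mul, Real.norm_of_nonneg (by positivity : 0 ≤ 1 / √(x - y) * (1 / √(y - s)))]
  rw [integral_integral_swap hint, ← integral_const_mul]
  refine setIntegral_congr_fun measurableSet_Ioo fun s hs => ?_
  rw [integral_const_mul, (integral_beta hs.1.le hs.2).2]
  ring

/-! ### The kernel averaged over circles of latitude -/

/-- The integrand of the complete elliptic integral with half-axes `A` and `B`. -/
noncomputable def ellipticIntegrand (A B u : ℝ) : ℝ≥0∞ :=
  ENNReal.ofReal (1 / √((A ^ 2 + u ^ 2) * (B ^ 2 + u ^ 2)))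

lemma lintegral_trig_eq_elliptic {A B : ℝ} (hA : 0 < A) (hB : 0 < B) :
    ∫⁻ θ in Ioo 0 Real.pi,
      ENNReal.ofReal (1 / √(A ^ 2 * Real.cos (θ / 2) ^ 2 + B ^ 2 * Real.sin (θ / 2) ^ 2)) =
    2 * ∫⁻ u in Ioi 0, ellipticIntegrand A B u := by
  have him : (fun u => 2 * Real.arctan (u / B)) '' Ioi 0 = Ioo 0 Real.pi := by
    ext θ
    constructor
    · rintro ⟨u, hu, rfl⟩
      have h1 : 0 < u / B := div_pos hu hB
      have h2 := Real.arctan_lt_pi_div_two (u / B)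
      have h3 := Real.arctan_pos.2 h1
      constructor
      · simp only; linarith
      · simp only; linarith
    · rintro ⟨h0, h1⟩
      refine ⟨B * Real.tan (θ / 2), ?_, ?_⟩
      · exact mul_pos hB (Real.tan_pos_of_pos_of_lt_pi_div_two (by linarith) (by linarith))
      · simp only
        rw [mul_div_cancel_left₀ _ hB.ne', Real.arctan_tan (by linarith) (by linarith)]
        ring
  have hd : ∀ u ∈ Ioi (0 : ℝ), HasDerivWithinAt (fun u => 2 * Real.arctan (u / B))
      (2 * (1 / (1 + (u / B) ^ 2) * (1 / B))) (Ioi 0) u := fun u _ =>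
    (((Real.hasDerivAt_arctan _).comp u ((hasDerivAt_id u).div_const B)).const_mul
      2).hasDerivWithinAt
  have hinj : InjOn (fun u => 2 * Real.arctan (u / B)) (Ioi 0) := by
    intro u _ v _ h
    have := Real.arctan_injective (mul_left_cancel₀ two_ne_zero h)
    field_simp at this
    exact this
  rw [← him, lintegral_image_eq_lintegral_abs_deriv_mul measurableSet_Ioi hd hinj,
    ← lintegral_const_mul' _ _ (by simp)]
  refine setLIntegral_congr_fun measurableSet_Ioi fun u hu => ?_
  have hu0 : 0 < u := hu
  rw [mul_div_cancel_left₀ _ (two_ne_zero' ℝ), Real.cos_sq_arctan, Real.sin_sq,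
    Real.cos_sq_arctan, abs_of_pos (by positivity), ellipticIntegrand,
    ← ENNReal.ofReal_mul (by positivity), show (2 : ℝ≥0∞) = ENNReal.ofReal 2 by simp,
    ← ENNReal.ofReal_mul (by positivity)]
  congr 1
  have e : A ^ 2 * (1 / (1 + (u / B) ^ 2)) + B ^ 2 * (1 - 1 / (1 + (u / B) ^ 2)) =
      (A ^ 2 + u ^ 2) * (B ^ 2 + u ^ 2) * (B / (B ^ 2 + u ^ 2)) ^ 2 := by
    field_simp
    ring
  have hpos : 0 < (A ^ 2 + u ^ 2) * (B ^ 2 + u ^ 2) := by positivity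
  rw [e, Real.sqrt_mul hpos.le, Real.sqrt_sq (by positivity)]
  have h3 : √((A ^ 2 + u ^ 2) * (B ^ 2 + u ^ 2)) ≠ 0 := (Real.sqrt_pos.2 hpos).ne'
  field_simp

/-- Landen's substitution `v = (u - AB/u) / 2`. -/
lemma landen_integrand {A B u v c : ℝ} (hA : 0 < A) (hB : 0 < B) (hu : 0 < u)
    (hv : v ^ 2 = ((u - A * B / u) / 2) ^ 2) (hc : c = (1 + A * B / u ^ 2) / 2) :
    ENNReal.ofReal c * ellipticIntegrand √(A * B) ((A + B) / 2) v =
      2 * ellipticIntegrand A B u := by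
  have hc0 : 0 < c := by rw [hc]; positivity
  rw [ellipticIntegrand, ellipticIntegrand, ← ENNReal.ofReal_mul hc0.le,
    show (2 : ℝ≥0∞) = ENNReal.ofReal 2 by simp, ← ENNReal.ofReal_mul (by positivity)]
  congr 1
  have e : (√(A * B) ^ 2 + v ^ 2) * (((A + B) / 2) ^ 2 + v ^ 2) =
      (A ^ 2 + u ^ 2) * (B ^ 2 + u ^ 2) * (c / 2) ^ 2 := by
    rw [Real.sq_sqrt (by positivity), hv, hc]
    field_simp
    ring
  have hpos : 0 < (A ^ 2 + u ^ 2) * (B ^ 2 + u ^ 2) := by positivity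
  have h3 : √((A ^ 2 + u ^ 2) * (B ^ 2 + u ^ 2)) ≠ 0 := (Real.sqrt_pos.2 hpos).ne'
  rw [e, Real.sqrt_mul hpos.le, Real.sqrt_sq (by positivity)]
  field_simp

lemma hasDerivAt_landen {c u : ℝ} (hu : 0 < u) :
    HasDerivAt (fun u => (u - c / u) / 2) ((1 + c / u ^ 2) / 2) u := by
  have := (((hasDerivAt_id u).sub (((hasDerivAt_inv hu.ne').const_mul c))).div_const 2)
  refine (this.congr_deriv ?_)
  field_simp
  ring

lemma injOn_landen {c : ℝ} (hc : 0 < c) : InjOn (fun u => (u - c / u) / 2) (Ioi 0) := by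
  intro u hu v hv h
  have hu : 0 < u := hu
  have hv : 0 < v := hv
  simp only at h
  field_simp at h
  have : (u - v) * (u * v + c) = 0 := by linear_combination h
  rcases mul_eq_zero.1 this with h | h
  · linarith
  · nlinarith [mul_pos hu hv]

/-- One step of the arithmetic-geometric mean leaves the complete elliptic integral unchanged. -/
lemma lintegral_elliptic_agm {A B : ℝ} (hA : 0 < A) (hB : 0 < B) :
    ∫⁻ u in Ioi 0, ellipticIntegrand A B u =
      ∫⁻ v in Ioi 0, ellipticIntegrand √(A * B) ((A + B) / 2) v := by
  set m := √(A * B) with hm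
  have hAB : 0 < A * B := mul_pos hA hB
  have hm0 : 0 < m := Real.sqrt_pos.2 hAB
  have hmm : m ^ 2 = A * B := Real.sq_sqrt hAB.le
  have root : ∀ v : ℝ, |v| < √(v ^ 2 + A * B) := fun v => by
    rw [← Real.sqrt_sq_eq_abs]
    exact Real.sqrt_lt_sqrt (sq_nonneg v) (by linarith)
  have hsol : ∀ v : ℝ, 0 < v + √(v ^ 2 + A * B) ∧
      (v + √(v ^ 2 + A * B) - A * B / (v + √(v ^ 2 + A * B))) / 2 = v := fun v => by
    have h1 := root v
    have h2 := neg_abs_le v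
    have hp : 0 < v + √(v ^ 2 + A * B) := by linarith
    refine ⟨hp, ?_⟩
    have hs : √(v ^ 2 + A * B) ^ 2 = v ^ 2 + A * B := Real.sq_sqrt (by positivity)
    field_simp
    linear_combination hs
  -- the substitution maps `(√(AB), ∞)` and, with a sign, `(0, √(AB))` onto `(0, ∞)`
  have hpos : ∀ u, 0 < u → (0 < (u - A * B / u) / 2 ↔ m < u) := fun u hu => by
    have : (u - A * B / u) / 2 = (u - m) * ((u + m) / (2 * u)) := by
      rw [← hmm]; field_simp; ring
    rw [this, mul_pos_iff_of_pos_right (by positivity), sub_pos]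
  have hneg : ∀ u, 0 < u → (0 < -((u - A * B / u) / 2) ↔ u < m) := fun u hu => by
    have : -((u - A * B / u) / 2) = (m - u) * ((u + m) / (2 * u)) := by
      rw [← hmm]; field_simp; ring
    rw [this, mul_pos_iff_of_pos_right (by positivity), sub_pos]
  have h1 : ∫⁻ v in Ioi 0, ellipticIntegrand m ((A + B) / 2) v =
      2 * ∫⁻ u in Ioi m, ellipticIntegrand A B u := by
    have him : (fun u => (u - A * B / u) / 2) '' Ioi m = Ioi 0 := by
      ext v
      constructor
      · rintro ⟨u, hu, rfl⟩
        exact (hpos u (hm0.trans hu)).2 hu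
      · intro hv
        refine ⟨v + √(v ^ 2 + A * B), ?_, (hsol v).2⟩
        rw [mem_Ioi, ← hpos _ (hsol v).1, (hsol v).2]
        exact hv
    rw [← him, lintegral_image_eq_lintegral_abs_deriv_mul measurableSet_Ioi
      (fun u hu => (hasDerivAt_landen (hm0.trans hu)).hasDerivWithinAt)
      ((injOn_landen hAB).mono (Ioi_subset_Ioi hm0.le)), ← lintegral_const_mul' _ _ (by simp)]
    refine setLIntegral_congr_fun measurableSet_Ioi fun u hu => ?_
    have hu0 : 0 < u := hm0.trans hu
    rw [abs_of_pos (by positivity), landen_integrand hA hB hu0 rfl rfl]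
  have h2 : ∫⁻ v in Ioi 0, ellipticIntegrand m ((A + B) / 2) v =
      2 * ∫⁻ u in Ioo 0 m, ellipticIntegrand A B u := by
    have him : (fun u => -((u - A * B / u) / 2)) '' Ioo 0 m = Ioi 0 := by
      ext v
      constructor
      · rintro ⟨u, hu, rfl⟩
        exact (hneg u hu.1).2 hu.2
      · intro hv
        refine ⟨-v + √((-v) ^ 2 + A * B), ⟨(hsol (-v)).1, ?_⟩, ?_⟩
        · rw [← hneg _ (hsol (-v)).1, (hsol (-v)).2, neg_neg]
          exact hv
        · simp only
          rw [(hsol (-v)).2, neg_neg]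
    rw [← him, lintegral_image_eq_lintegral_abs_deriv_mul measurableSet_Ioo
      (fun u hu => (hasDerivAt_landen hu.1).fun_neg.hasDerivWithinAt)
      (fun u hu v hv h => injOn_landen hAB hu.1 hv.1 (neg_injective h)),
      ← lintegral_const_mul' _ _ (by simp)]
    refine setLIntegral_congr_fun measurableSet_Ioo fun u hu => ?_
    have hu0 : 0 < u := hu.1
    rw [abs_neg, abs_of_pos (by positivity), landen_integrand hA hB hu0 (by ring) rfl]
  have h3 : ∫⁻ u in Ioi 0, ellipticIntegrand A B u =
      (∫⁻ u in Ioo 0 m, ellipticIntegrand A B u) + ∫⁻ u in Ioi m, ellipticIntegrand A B u := by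
    rw [← Ioc_union_Ioi_eq_Ioi hm0.le, lintegral_union measurableSet_Ioi
      (Ioc_disjoint_Ioi le_rfl), restrict_Ioo_eq_restrict_Ioc]
  have h4 : 2 * ∫⁻ u in Ioi 0, ellipticIntegrand A B u =
      2 * ∫⁻ v in Ioi 0, ellipticIntegrand m ((A + B) / 2) v := by
    rw [h3, mul_add, ← h1, ← h2, two_mul]
  exact (ENNReal.mul_right_inj (by simp) (by simp)).1 h4

/-- The weight `1 / (√s √(2 - s) √(s - x))`, which for `x ≥ 0` vanishes outside `(x, 2)`; with
`s = 1 - cos t` and `x = 1 - cos φ` it is `1 / (sin t √(cos φ - cos t))`. -/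
noncomputable def latWeight (x s : ℝ) : ℝ≥0∞ := invSqrt s * invSqrt (2 - s) * invSqrt (s - x)

/-- The substitution `s = 2 - q (2 - y) / (q + v²)` with `q = 2 (2 - x)` brings the integral into
the form of a complete elliptic integral. -/
lemma lintegral_latWeight {x y : ℝ} (hx : 0 < x) (hxy : x < y) (hy : y < 2) :
    ∫⁻ s in Ioo y 2, latWeight x s * invSqrt (s - y) =
      2 * ∫⁻ v in Ioi 0, ellipticIntegrand √(2 * (y - x)) √(y * (2 - x)) v := by
  set q := 2 * (2 - x) with hq
  have hq0 : 0 < q := by rw [hq]; linarith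
  have hy2 : 0 < 2 - y := by linarith
  have hx2 : 0 < 2 - x := by linarith
  have hxy' : 0 < y - x := by linarith
  have hy0 : 0 < y := hx.trans hxy
  have hd : ∀ v ∈ Ioi (0 : ℝ), HasDerivWithinAt (fun v => 2 - q * (2 - y) / (q + v ^ 2))
      (2 * v * (q * (2 - y)) / (q + v ^ 2) ^ 2) (Ioi 0) v := fun v _ => by
    have hne : q + v ^ 2 ≠ 0 := by positivity
    have := ((((hasDerivAt_pow 2 v).const_add q).inv hne).const_mul (q * (2 - y))).const_sub 2
    refine HasDerivAt.hasDerivWithinAt (this.congr_deriv ?_)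
    field_simp
    push_cast
    ring
  have hinj : InjOn (fun v => 2 - q * (2 - y) / (q + v ^ 2)) (Ioi 0) := by
    intro u hu v hv h
    have hu : 0 < u := hu
    have hv : 0 < v := hv
    have h1 : q * (2 - y) / (q + u ^ 2) = q * (2 - y) / (q + v ^ 2) := by
      simp only at h; linarith
    rw [div_eq_div_iff (by positivity) (by positivity)] at h1
    have h2 := mul_left_cancel₀ (by positivity : q * (2 - y) ≠ 0) h1
    exact (pow_left_inj₀ hu.le hv.le two_ne_zero).1 (by linarith)
  have him : (fun v => 2 - q * (2 - y) / (q + v ^ 2)) '' Ioi 0 = Ioo y 2 := by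
    ext s
    constructor
    · rintro ⟨v, hv, rfl⟩
      have hv : 0 < v := hv
      constructor
      · have : 2 - q * (2 - y) / (q + v ^ 2) - y = (2 - y) * v ^ 2 / (q + v ^ 2) := by
          field_simp; ring
        have h2 : 0 < (2 - y) * v ^ 2 / (q + v ^ 2) := by positivity
        simp only; linarith
      · have h2 : 0 < q * (2 - y) / (q + v ^ 2) := by positivity
        simp only; linarith
    · rintro ⟨h0, h1⟩
      have hs2 : 0 < 2 - s := by linarith
      have hsy : 0 < s - y := by linarith
      refine ⟨√(q * (s - y) / (2 - s)), Real.sqrt_pos.2 (by positivity), ?_⟩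
      simp only
      rw [Real.sq_sqrt (by positivity)]
      field_simp
      ring
  rw [← him, lintegral_image_eq_lintegral_abs_deriv_mul measurableSet_Ioi hd hinj,
    ← lintegral_const_mul' _ _ (by simp)]
  refine setLIntegral_congr_fun measurableSet_Ioi fun v hv => ?_
  have hv : 0 < v := hv
  have hC : 0 < 2 * (y - x) + v ^ 2 := by positivity
  have hD : 0 < y * (2 - x) + v ^ 2 := by positivity
  simp only [latWeight, invSqrt, ellipticIntegrand]
  have e1 : 2 - q * (2 - y) / (q + v ^ 2) = 2 * (y * (2 - x) + v ^ 2) / (q + v ^ 2) := by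
    rw [hq]; field_simp; ring
  have e2 : 2 - (2 - q * (2 - y) / (q + v ^ 2)) = q * (2 - y) / (q + v ^ 2) := by ring
  have e3 : 2 - q * (2 - y) / (q + v ^ 2) - x =
      (2 - x) * (2 * (y - x) + v ^ 2) / (q + v ^ 2) := by
    rw [hq]; field_simp; ring
  have e4 : 2 - q * (2 - y) / (q + v ^ 2) - y = (2 - y) * v ^ 2 / (q + v ^ 2) := by
    field_simp; ring
  rw [e2, e3, e4, e1, abs_of_pos (by positivity), Real.sq_sqrt (by positivity),
    Real.sq_sqrt (by positivity), ← ENNReal.ofReal_mul (by positivity),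
    ← ENNReal.ofReal_mul (by positivity), ← ENNReal.ofReal_mul (by positivity),
    ← ENNReal.ofReal_mul (by positivity), show (2 : ℝ≥0∞) = ENNReal.ofReal 2 by simp,
    ← ENNReal.ofReal_mul (by positivity), ← Real.sqrt_one, ← Real.sqrt_div zero_le_one,
    ← Real.sqrt_div zero_le_one, ← Real.sqrt_div zero_le_one, ← Real.sqrt_div zero_le_one,
    ← Real.sqrt_div zero_le_one, ← Real.sqrt_mul (by positivity), ← Real.sqrt_mul (by positivity),
    ← Real.sqrt_mul (by positivity)]
  congr 1
  have e5 : 1 / (2 * (y * (2 - x) + v ^ 2) / (q + v ^ 2)) * (1 / (q * (2 - y) / (q + v ^ 2))) *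
      (1 / ((2 - x) * (2 * (y - x) + v ^ 2) / (q + v ^ 2))) *
      (1 / ((2 - y) * v ^ 2 / (q + v ^ 2))) =
      (1 / ((2 * (y - x) + v ^ 2) * (y * (2 - x) + v ^ 2))) *
        ((q + v ^ 2) ^ 2 / (v * (q * (2 - y)))) ^ 2 := by
    rw [hq]; field_simp
  rw [e5, Real.sqrt_mul (by positivity), Real.sqrt_sq (by positivity)]
  field_simp

/-- The average of the Newtonian kernel over a circle of latitude, as an integral over the
latitudes below. Both sides are complete elliptic integrals, whose pairs of half-axes are related by
one step of the arithmetic-geometric mean. -/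
lemma lintegral_circle_of_lt {x y M : ℝ} (hx : 0 < x) (hxy : x < y) (hy : y < 2) (hM : 0 ≤ M)
    (hMM : M ^ 2 = x * (2 - x) * (y * (2 - y))) :
    ∫⁻ θ in Ioo 0 Real.pi,
      ENNReal.ofReal (1 / √(2 * (x + y - x * y - M * Real.cos θ))) =
    ∫⁻ s in Ioo y 2, latWeight x s * invSqrt (s - y) := by
  set P := x + y - x * y with hP
  have hPM : P ^ 2 - M ^ 2 = (y - x) ^ 2 := by rw [hMM, hP]; ring
  have hP0 : 0 < P := by
    have h2 : P = x * (2 - y) / 2 + y * (2 - x) / 2 := by rw [hP]; ring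
    rw [h2]
    have : 0 < x * (2 - y) := mul_pos hx (by linarith)
    have : 0 < y * (2 - x) := mul_pos (by linarith) (by linarith)
    linarith
  have hlt : M < P := by
    have : 0 < (y - x) ^ 2 := by have : 0 < y - x := by linarith
                                 positivity
    nlinarith
  have hA2 : 0 < 2 * (P - M) := by linarith
  have hB2 : 0 < 2 * (P + M) := by linarith
  have hA := Real.sqrt_pos.2 hA2
  have hB := Real.sqrt_pos.2 hB2
  rw [lintegral_latWeight hx hxy hy]
  -- the half-axes `√(2 (P ∓ M))` have geometric mean `√(2 (y - x))` and arithmetic mean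
  -- `√(y (2 - x))`
  have hAB : √(2 * (P - M)) * √(2 * (P + M)) = 2 * (y - x) := by
    rw [← Real.sqrt_mul hA2.le, show 2 * (P - M) * (2 * (P + M)) = (2 * (y - x)) ^ 2 by
      linear_combination 4 * hPM, Real.sqrt_sq (by linarith)]
  have hmean : (√(2 * (P - M)) + √(2 * (P + M))) / 2 = √(y * (2 - x)) := by
    symm
    rw [Real.sqrt_eq_iff_mul_self_eq_of_pos (by positivity)]
    have h1 := Real.mul_self_sqrt hA2.le
    have h2 := Real.mul_self_sqrt hB2.le
    rw [hP] at *
    linear_combination h1 / 4 + h2 / 4 + hAB / 2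
  rw [← hmean, ← hAB, ← lintegral_elliptic_agm hA hB, ← lintegral_trig_eq_elliptic hA hB]
  refine setLIntegral_congr_fun measurableSet_Ioo fun θ _ => ?_
  congr 4
  rw [Real.sq_sqrt hA2.le, Real.sq_sqrt hB2.le, Real.sin_sq, Real.cos_sq,
    mul_div_cancel₀ θ two_ne_zero]
  ring

lemma latWeight_mul_comm (x y s : ℝ) :
    latWeight x s * invSqrt (s - y) = latWeight y s * invSqrt (s - x) := by
  unfold latWeight; ring

/-- The average of the Newtonian kernel over a circle of latitude, symmetric in the two heights. -/
lemma lintegral_circle {x y M : ℝ} (hx : x ∈ Ioo 0 2) (hy : y ∈ Ioo 0 2) (hxy : x ≠ y)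
    (hM : 0 ≤ M) (hMM : M ^ 2 = x * (2 - x) * (y * (2 - y))) :
    ∫⁻ θ in Ioo 0 Real.pi,
      ENNReal.ofReal (1 / √(2 * (x + y - x * y - M * Real.cos θ))) =
    ∫⁻ s, latWeight x s * invSqrt (s - y) := by
  have key : ∀ {x y : ℝ}, x < y → ∫⁻ s, latWeight x s * invSqrt (s - y) =
      ∫⁻ s in Ioo y 2, latWeight x s * invSqrt (s - y) := fun {x y} _ => by
    rw [← setLIntegral_univ]
    refine lintegral_eq_Ioo_of_zero MeasurableSet.univ (subset_univ _) fun s _ hs => ?_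
    by_cases h : y < s
    · have : 2 ≤ s := by
        by_contra hlt
        exact hs ⟨h, not_le.1 hlt⟩
      rw [latWeight, invSqrt_of_nonpos (by linarith : 2 - s ≤ 0)]
      simp
    · rw [invSqrt_of_nonpos (by linarith : s - y ≤ 0), mul_zero]
  rcases hxy.lt_or_gt with h | h
  · rw [lintegral_circle_of_lt hx.1 h hy.2 hM hMM, key h]
  · simp_rw [latWeight_mul_comm x y]
    rw [key h, ← lintegral_circle_of_lt hy.1 h hx.2 hM (by rw [hMM]; ring)]
    simp_rw [show x + y - x * y = y + x - y * x by ring]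

/-! ### Surface integrals and potentials of rotationally symmetric densities -/

/-- The Newtonian potential of a measure on the sphere. -/
noncomputable def potential (μ : Measure S2) (x : S2) : ℝ≥0∞ := ∫⁻ y, (edist x y)⁻¹ ∂μ

/-- The height coordinate `1 - cos φ`: the distance from the point to the tangent plane at the North
Pole, running from `0` there to `2` at the South Pole. -/
def height (x : S2) : ℝ := 1 - x.1 2

lemma continuous_height : Continuous height := by
  unfold height
  fun_prop

@[fun_prop]
lemma measurable_height : Measurable height := continuous_height.measurable

lemma coord_sq_sum (x : S2) : x.1 0 ^ 2 + x.1 1 ^ 2 + x.1 2 ^ 2 = 1 := by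
  have h : ‖x.1‖ = 1 := by simp
  have h2 : ‖x.1‖ ^ 2 = 1 := by rw [h]; norm_num
  rw [EuclideanSpace.norm_sq_eq] at h2
  simpa [Fin.sum_univ_three] using h2

lemma height_mem (x : S2) : height x ∈ Icc (0 : ℝ) 2 := by
  have := coord_sq_sum x
  unfold height
  constructor <;> nlinarith [sq_nonneg (x.1 0), sq_nonneg (x.1 1)]

lemma cos_polarAngle (x : S2) : Real.cos (polarAngle x) = x.1 2 := by
  have := height_mem x
  unfold height at this
  exact Real.cos_arccos (by linarith [this.2]) (by linarith [this.1])

lemma height_eq (x : S2) : height x = 1 - Real.cos (polarAngle x) := by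
  rw [cos_polarAngle, height]

lemma polarAngle_mem (x : S2) : polarAngle x ∈ Icc 0 Real.pi :=
  ⟨Real.arccos_nonneg _, Real.arccos_le_pi _⟩

@[simp]
lemma height_sph (θ φ : ℝ) : height (sph θ φ) = 1 - Real.cos φ := by
  simp [height, sph]

lemma polarAngle_sph {θ φ : ℝ} (hφ : φ ∈ Icc 0 Real.pi) : polarAngle (sph θ φ) = φ := by
  simp [polarAngle, sph, Real.arccos_cos hφ.1 hφ.2]

lemma exists_eq_sph (x : S2) : ∃ θ, x = sph θ (polarAngle x) := by
  set z : ℂ := ⟨x.1 0, x.1 1⟩ with hz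
  have hs : 0 ≤ Real.sin (polarAngle x) :=
    Real.sin_nonneg_of_nonneg_of_le_pi (polarAngle_mem x).1 (polarAngle_mem x).2
  have hn : ‖z‖ = Real.sin (polarAngle x) := by
    have h1 : ‖z‖ ^ 2 = Real.sin (polarAngle x) ^ 2 := by
      rw [Complex.sq_norm, Complex.normSq_apply, Real.sin_sq, cos_polarAngle, hz]
      linear_combination coord_sq_sum x
    exact (pow_left_inj₀ (norm_nonneg _) hs two_ne_zero).1 h1
  refine ⟨Complex.arg z, Subtype.ext ?_⟩
  ext i
  fin_cases i
  · have := Complex.norm_mul_cos_arg z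
    rw [hn] at this
    simp only [sph]
    exact this.symm
  · have := Complex.norm_mul_sin_arg z
    rw [hn] at this
    simp only [sph]
    exact this.symm
  · simp [sph, cos_polarAngle]

lemma dist_sq_eq (x y : S2) : dist x y ^ 2 =
    2 * (1 - (x.1 0 * y.1 0 + x.1 1 * y.1 1 + x.1 2 * y.1 2)) := by
  have h1 := coord_sq_sum x
  have h2 := coord_sq_sum y
  rw [Subtype.dist_eq, EuclideanSpace.dist_eq, Real.sq_sqrt (by positivity)]
  simp only [Fin.sum_univ_three, Real.dist_eq, sq_abs]
  linear_combination h1 + h2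

lemma inv_edist_sph {θ θ' φ ξ : ℝ} (h : sph θ φ ≠ sph θ' ξ) :
    (edist (sph θ φ) (sph θ' ξ))⁻¹ = ENNReal.ofReal (1 / √(2 * ((1 - Real.cos φ) +
      (1 - Real.cos ξ) - (1 - Real.cos φ) * (1 - Real.cos ξ) -
        Real.sin φ * Real.sin ξ * Real.cos (θ - θ')))) := by
  have hd : 0 < dist (sph θ φ) (sph θ' ξ) := dist_pos.2 h
  rw [edist_dist, ← ENNReal.ofReal_inv_of_pos hd, one_div]
  congr 2
  rw [← Real.sqrt_sq hd.le, dist_sq_eq]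
  congr 1
  simp only [sph, Matrix.cons_val_zero, Matrix.cons_val_one, Matrix.cons_val, Real.cos_sub]
  ring

lemma continuous_sph : Continuous fun p : ℝ × ℝ => sph p.1 p.2 := by
  unfold sph
  refine Continuous.subtype_mk ?_ _
  refine (PiLp.continuous_toLp 2 _).comp ?_
  refine continuous_pi fun i => ?_
  fin_cases i <;> simp <;> fun_prop

lemma lintegral_angles {H : ℝ × ℝ → ℝ≥0∞} (hm : Measurable H) :
    ∫⁻ p, H p ∂(((volume : Measure (ℝ × ℝ)).restrict
      (Icc 0 (2 * Real.pi) ×ˢ Icc 0 Real.pi)).withDensity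
        (fun p => ENNReal.ofReal (Real.sin p.2))) =
      ∫⁻ φ in Ioo 0 Real.pi, ENNReal.ofReal (Real.sin φ) *
        ∫⁻ θ in Icc 0 (2 * Real.pi), H (θ, φ) := by
  have hs : Measurable fun p : ℝ × ℝ => ENNReal.ofReal (Real.sin p.2) := by fun_prop
  rw [lintegral_withDensity_eq_lintegral_mul _ hs hm, Measure.volume_eq_prod,
    ← Measure.prod_restrict, lintegral_prod_symm' _ (hs.mul hm),
    ← restrict_Ioo_eq_restrict_Icc (a := (0 : ℝ)) (b := Real.pi)]
  refine lintegral_congr fun φ => ?_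
  simp only [Pi.mul_apply]
  exact lintegral_const_mul (f := fun θ => H (θ, φ)) _ (hm.comp measurable_prodMk_right)

lemma lintegral_surfaceMeasure {G : S2 → ℝ≥0∞} (hG : Measurable G) :
    ∫⁻ x, G x ∂surfaceMeasure = ∫⁻ φ in Ioo 0 Real.pi, ENNReal.ofReal (Real.sin φ) *
      ∫⁻ θ in Icc 0 (2 * Real.pi), G (sph θ φ) := by
  rw [surfaceMeasure, lintegral_map hG continuous_sph.measurable,
    lintegral_angles (H := fun p => G (sph p.1 p.2)) (hG.comp continuous_sph.measurable)]

lemma lintegral_surfaceMeasure_height {p : ℝ → ℝ≥0∞} (hp : Measurable p) :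
    ∫⁻ x, p (height x) ∂surfaceMeasure =
      ENNReal.ofReal (2 * Real.pi) * ∫⁻ y in Ioo 0 2, p y := by
  have hpi := Real.pi_pos
  rw [lintegral_surfaceMeasure (G := fun x => p (height x)) (hp.comp measurable_height)]
  have h := lintegral_Ioo_subst Real.pi_pos.le (by fun_prop)
    (fun x _ => hasDerivAt_one_sub_cos x)
    (fun x hx => Real.sin_pos_of_mem_Ioo hx) p
  simp only [Real.cos_zero, sub_self, Real.cos_pi, sub_neg_eq_add, one_add_one_eq_two] at h
  rw [h, ← lintegral_const_mul' _ _ ENNReal.ofReal_ne_top]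
  refine lintegral_congr fun φ => ?_
  simp only [height_sph, lintegral_const, MeasurableSet.univ,
    Measure.restrict_apply, univ_inter, Real.volume_Icc, sub_zero]
  ring

instance : IsFiniteMeasure surfaceMeasure := by
  constructor
  have := lintegral_surfaceMeasure_height (p := fun _ => 1) measurable_const
  simp only [lintegral_const, one_mul] at this
  rw [this]
  simp [ENNReal.mul_lt_top_iff]

lemma ae_surfaceMeasure_of_sph {P : S2 → Prop} (hP : MeasurableSet {x | P x})
    (h : ∀ φ ∈ Ioo 0 Real.pi, ∀ θ, P (sph θ φ)) : ∀ᵐ x ∂surfaceMeasure, P x := by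
  rw [ae_iff, ← lintegral_indicator_one (s := {x | ¬ P x}) (by exact hP.compl),
    lintegral_surfaceMeasure (measurable_one.indicator (by exact hP.compl))]
  rw [setLIntegral_congr_fun (g := fun _ => 0) measurableSet_Ioo, lintegral_zero]
  intro φ hφ
  simp [h φ hφ]

/-- The integral of the kernel over a circle of latitude. -/
lemma lintegral_circle_kernel {θ φ ξ : ℝ} (hφ : φ ∈ Ioo 0 Real.pi) (hξ : ξ ∈ Ioo 0 Real.pi)
    (hne : φ ≠ ξ) :
    ∫⁻ θ' in Icc 0 (2 * Real.pi), (edist (sph θ φ) (sph θ' ξ))⁻¹ =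
      2 * ∫⁻ s, latWeight (1 - Real.cos φ) s * invSqrt (s - (1 - Real.cos ξ)) := by
  have hp := Real.pi_pos
  set x := 1 - Real.cos φ with hx
  set y := 1 - Real.cos ξ with hy
  set M := Real.sin φ * Real.sin ξ with hM
  have hsφ := Real.sin_pos_of_mem_Ioo hφ
  have hsξ := Real.sin_pos_of_mem_Ioo hξ
  have hM0 : 0 < M := mul_pos hsφ hsξ
  have hIoo : ∀ t ∈ Ioo 0 Real.pi, 1 - Real.cos t ∈ Ioo (0 : ℝ) 2 := fun t ht => by
    have h1 := Real.strictAntiOn_cos (left_mem_Icc.2 hp.le) (Ioo_subset_Icc_self ht) ht.1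
    have h2 := Real.strictAntiOn_cos (Ioo_subset_Icc_self ht) (right_mem_Icc.2 hp.le) ht.2
    simp at h1 h2
    constructor <;> linarith
  have hcos : Real.cos φ ≠ Real.cos ξ := fun h => hne
    (Real.injOn_cos (Ioo_subset_Icc_self hφ) (Ioo_subset_Icc_self hξ) h)
  have hxy : x ≠ y := fun h => hcos (by linarith)
  have hMM : M ^ 2 = x * (2 - x) * (y * (2 - y)) := by
    rw [hM, mul_pow, Real.sin_sq, Real.sin_sq, hx, hy]; ring
  rw [← lintegral_circle (hIoo φ hφ) (hIoo ξ hξ) hxy hM0.le hMM]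
  have hpos : ∀ t, 0 < 2 * (x + y - x * y - M * Real.cos t) := fun t => by
    have h1 : (x + y - x * y) ^ 2 - M ^ 2 = (y - x) ^ 2 := by rw [hMM]; ring
    have h2 : 0 < (y - x) ^ 2 := by
      have : y - x ≠ 0 := sub_ne_zero.2 hxy.symm
      positivity
    have h3 : 0 < x + y - x * y := by
      have a1 := (hIoo φ hφ).1
      have a2 := (hIoo ξ hξ).2
      have a3 := (hIoo φ hφ).2
      have a4 := (hIoo ξ hξ).1
      nlinarith [mul_pos a1 (sub_pos.2 a2), mul_pos a4 (sub_pos.2 a3)]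
    have h4 : M < x + y - x * y := by nlinarith
    have h5 := Real.cos_le_one t
    nlinarith
  set F : ℝ → ℝ := fun t => 1 / √(2 * (x + y - x * y - M * Real.cos t)) with hF
  have hFc : Continuous F := by
    rw [hF]
    refine continuous_const.div (by fun_prop) fun t => (Real.sqrt_pos.2 (hpos t)).ne'
  have hF0 : ∀ t, 0 ≤ F t := fun t => by rw [hF]; positivity
  have hsph : ∀ θ', (edist (sph θ φ) (sph θ' ξ))⁻¹ = ENNReal.ofReal (F (θ - θ')) := fun θ' => by
    refine inv_edist_sph fun h => hne ?_
    have := congrArg polarAngle h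
    rwa [polarAngle_sph (Ioo_subset_Icc_self hφ), polarAngle_sph (Ioo_subset_Icc_self hξ)] at this
  simp_rw [hsph]
  have conv : ∀ (f : ℝ → ℝ) (b : ℝ), Continuous f → (∀ t, 0 ≤ f t) → 0 ≤ b →
      ∫⁻ t in Ioc 0 b, ENNReal.ofReal (f t) = ENNReal.ofReal (∫ t in (0 : ℝ)..b, f t) :=
    fun f b hf hf0 hb => by
      rw [intervalIntegral.integral_of_le hb, ofReal_integral_eq_lintegral_ofReal
        ((hf.intervalIntegrable 0 b).1) (ae_of_all _ hf0)]
  rw [← restrict_Ioc_eq_restrict_Icc, restrict_Ioo_eq_restrict_Ioc,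
    conv (fun t => F (θ - t)) _ (by fun_prop) (fun t => hF0 _) (by positivity),
    conv F _ hFc hF0 hp.le, show (2 : ℝ≥0∞) = ENNReal.ofReal 2 by simp,
    ← ENNReal.ofReal_mul (by norm_num)]
  congr 1
  have hper : Function.Periodic F (2 * Real.pi) := fun t => by simp [hF]
  have h1 : ∫ t in (0 : ℝ)..(2 * Real.pi), F (θ - t) = ∫ t in (-Real.pi)..Real.pi, F t := by
    rw [intervalIntegral.integral_comp_sub_left F θ]
    have := hper.intervalIntegral_add_eq (θ - 2 * Real.pi) (-Real.pi)
    rw [show θ - 0 = θ - 2 * Real.pi + 2 * Real.pi by ring, this,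
      show -Real.pi + 2 * Real.pi = Real.pi by ring]
  have h2 : ∫ t in (-Real.pi)..0, F t = ∫ t in (0 : ℝ)..Real.pi, F t := by
    have := intervalIntegral.integral_comp_neg (a := 0) (b := Real.pi) F
    rw [neg_zero] at this
    rw [← this]
    simp [hF]
  rw [h1, ← intervalIntegral.integral_add_adjacent_intervals (b := 0)
    (hFc.intervalIntegrable _ _) (hFc.intervalIntegrable _ _), h2]
  ring

@[fun_prop]
lemma measurable_inv_edist : Measurable fun p : S2 × S2 => (edist p.1 p.2)⁻¹ :=
  measurable_edist.inv

lemma measurable_inv_edist_left (x : S2) : Measurable fun y : S2 => (edist x y)⁻¹ :=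
  (measurable_const.edist measurable_id).inv

lemma measurable_potential (μ : Measure S2) [SFinite μ] : Measurable (potential μ) := by
  unfold potential
  exact Measurable.lintegral_prod_right' (f := fun p : S2 × S2 => (edist p.1 p.2)⁻¹)
    measurable_inv_edist

/-- The potential of a rotationally symmetric density, as a composition of two Abel transforms. -/
lemma potential_withDensity_height {p : ℝ → ℝ≥0∞} (hp : Measurable p) {θ φ : ℝ}
    (hφ : φ ∈ Ioo 0 Real.pi) :
    potential (surfaceMeasure.withDensity fun x => p (height x)) (sph θ φ) =
      2 * ∫⁻ s, latWeight (1 - Real.cos φ) s * abelTransform 0 p s := by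
  have hm := measurable_inv_edist_left (sph θ φ)
  have hph : Measurable fun x => p (height x) := hp.comp measurable_height
  rw [potential, lintegral_withDensity_eq_lintegral_mul _ hph hm,
    lintegral_surfaceMeasure (hph.mul hm)]
  set x := 1 - Real.cos φ with hx
  have h1 : ∫⁻ ξ in Ioo 0 Real.pi, ENNReal.ofReal (Real.sin ξ) *
      ∫⁻ θ' in Icc 0 (2 * Real.pi),
        ((fun x => p (height x)) * fun y => (edist (sph θ φ) y)⁻¹) (sph θ' ξ) =
      ∫⁻ ξ in Ioo 0 Real.pi, ENNReal.ofReal (Real.sin ξ) * (p (1 - Real.cos ξ) *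
        (2 * ∫⁻ s, latWeight x s * invSqrt (s - (1 - Real.cos ξ)))) := by
    refine lintegral_congr_ae ?_
    have hne : ∀ᵐ ξ ∂(volume.restrict (Ioo 0 Real.pi)), ξ ≠ φ :=
      ae_restrict_of_ae (Measure.ae_ne volume φ)
    filter_upwards [hne, ae_restrict_mem measurableSet_Ioo] with ξ hξ hξ'
    simp only [Pi.mul_apply, height_sph]
    rw [lintegral_const_mul, lintegral_circle_kernel hφ hξ' hξ.symm]
    exact hm.comp ((continuous_sph.comp (by fun_prop : Continuous fun t : ℝ => (t, ξ))).measurable)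
  have h2 := lintegral_Ioo_subst Real.pi_pos.le (by fun_prop)
    (fun x _ => hasDerivAt_one_sub_cos x)
    (fun x hx => Real.sin_pos_of_mem_Ioo hx)
    (fun y => p y * (2 * ∫⁻ s, latWeight x s * invSqrt (s - y)))
  simp only [Real.cos_zero, sub_self, Real.cos_pi, sub_neg_eq_add, one_add_one_eq_two] at h2
  have hlm : Measurable (latWeight x) := by unfold latWeight; fun_prop
  rw [h1, ← h2]
  have h3 : ∀ y, p y * (2 * ∫⁻ s, latWeight x s * invSqrt (s - y)) =
      ∫⁻ s, 2 * (latWeight x s * (invSqrt (s - y) * p y)) := fun y => by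
    rw [lintegral_const_mul _ (by fun_prop)]
    simp_rw [← mul_assoc (latWeight x _)]
    rw [lintegral_mul_const _ (by fun_prop)]
    ring
  simp_rw [h3]
  rw [lintegral_lintegral_swap (by fun_prop),
    ← lintegral_const_mul (f := fun s => latWeight x s * abelTransform 0 p s) _
      (hlm.mul (measurable_abelTransform 0 hp))]
  refine lintegral_congr fun s => ?_
  rw [lintegral_const_mul _ (by fun_prop), lintegral_const_mul _ (by fun_prop)]
  by_cases hs : s < 2
  · congr 2
    rw [abelTransform]
    symm
    refine (lintegral_eq_Ioo_of_zero measurableSet_Ioi Ioo_subset_Ioi_self fun y hy hy' => ?_)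
    have : 2 ≤ y := by
      by_contra hlt
      exact hy' ⟨hy, not_le.1 hlt⟩
    rw [invSqrt_of_nonpos (by linarith), zero_mul]
  · rw [latWeight, invSqrt_of_nonpos (by linarith : 2 - s ≤ 0)]
    simp

lemma latWeight_eq_zero {x s : ℝ} (hs : s ∉ Ioo x 2) : latWeight x s = 0 := by
  by_cases h : x < s
  · have : 2 ≤ s := by
      by_contra hlt
      exact hs ⟨h, not_le.1 hlt⟩
    rw [latWeight, invSqrt_of_nonpos (by linarith : 2 - s ≤ 0)]
    simp
  · rw [latWeight, invSqrt_of_nonpos (by linarith : s - x ≤ 0), mul_zero]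

lemma lintegral_latWeight_mul (x : ℝ) (F : ℝ → ℝ≥0∞) :
    ∫⁻ s, latWeight x s * F s = ∫⁻ s in Ioo x 2, latWeight x s * F s := by
  rw [← setLIntegral_univ]
  refine lintegral_eq_Ioo_of_zero MeasurableSet.univ (subset_univ _) fun s _ hs => ?_
  rw [latWeight_eq_zero hs, zero_mul]

lemma lintegral_latWeight_mul_le {x : ℝ} (hx2 : x < 2) {F : ℝ → ℝ≥0∞} {K : ℝ≥0∞}
    (hF : ∀ s ∈ Ioo x 2, invSqrt s * F s ≤ K) :
    ∫⁻ s, latWeight x s * F s ≤ K * ENNReal.ofReal Real.pi := by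
  rw [lintegral_latWeight_mul, ← lintegral_beta hx2, ← lintegral_const_mul _ (by fun_prop)]
  refine setLIntegral_mono_ae' measurableSet_Ioo (ae_of_all _ fun s hs => ?_)
  calc latWeight x s * F s = (invSqrt s * F s) * (invSqrt (2 - s) * invSqrt (s - x)) := by
        unfold latWeight; ring
    _ ≤ K * (invSqrt (2 - s) * invSqrt (s - x)) := by gcongr; exact hF s hs

lemma invSqrt_mul_ofReal_sqrt {s : ℝ} (hs : 0 < s) : invSqrt s * ENNReal.ofReal √s = 1 := by
  have : √s ≠ 0 := (Real.sqrt_pos.2 hs).ne'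
  rw [invSqrt, ← ENNReal.ofReal_mul (by positivity)]
  field_simp
  simp

lemma abelTransform_one_le (s : ℝ) :
    abelTransform 0 (fun _ => 1) s ≤ ENNReal.ofReal √s * ENNReal.ofReal Real.pi := by
  by_cases hs : 0 < s
  · rw [abelTransform_eq_Ioo, ← lintegral_beta hs, ← lintegral_const_mul _ (by fun_prop)]
    refine setLIntegral_mono_ae' measurableSet_Ioo (ae_of_all _ fun y hy => ?_)
    rw [mul_left_comm]
    gcongr
    rw [sub_zero, ← invSqrt_mul_ofReal_sqrt hy.1, mul_comm]
    gcongr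
    exact hy.2.le
  · rw [abelTransform_eq_Ioo, Ioo_eq_empty hs]
    simp

lemma ae_surfaceMeasure_height : ∀ᵐ x ∂surfaceMeasure, height x ∈ Ioo (0 : ℝ) 2 := by
  refine ae_surfaceMeasure_of_sph (measurable_height measurableSet_Ioo) fun φ hφ θ => ?_
  have h1 := Real.strictAntiOn_cos (left_mem_Icc.2 Real.pi_pos.le) (Ioo_subset_Icc_self hφ) hφ.1
  have h2 := Real.strictAntiOn_cos (Ioo_subset_Icc_self hφ) (right_mem_Icc.2 Real.pi_pos.le) hφ.2
  simp at h1 h2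
  rw [height_sph]
  constructor <;> linarith

/-- The potential of surface measure is bounded almost everywhere, so surface measure restricted to
any set has finite energy. -/
lemma potential_surfaceMeasure_le :
    ∀ᵐ x ∂surfaceMeasure, potential surfaceMeasure x ≤
      2 * (ENNReal.ofReal Real.pi * ENNReal.ofReal Real.pi) := by
  refine ae_surfaceMeasure_of_sph
    (measurableSet_le (measurable_potential _) measurable_const) fun φ hφ θ => ?_
  have := potential_withDensity_height (p := fun _ => 1) measurable_const (θ := θ) hφ
  simp only [withDensity_const, one_smul] at this
  rw [this]
  gcongr
  have h1 := Real.strictAntiOn_cos (left_mem_Icc.2 Real.pi_pos.le) (Ioo_subset_Icc_self hφ) hφ.1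
  have h2 := Real.strictAntiOn_cos (Ioo_subset_Icc_self hφ) (right_mem_Icc.2 Real.pi_pos.le) hφ.2
  simp at h1 h2
  refine lintegral_latWeight_mul_le (by linarith) fun s hs => ?_
  have hs0 : 0 < s := by linarith [hs.1]
  calc invSqrt s * abelTransform 0 (fun _ => 1) s
      ≤ invSqrt s * (ENNReal.ofReal √s * ENNReal.ofReal Real.pi) := by
        gcongr; exact abelTransform_one_le s
    _ = ENNReal.ofReal Real.pi := by rw [← mul_assoc, invSqrt_mul_ofReal_sqrt hs0, one_mul]

/-! ### Positive definiteness of the Newtonian kernel -/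

/-- The Gaussian kernel `exp (-t² |x - y|²)` on the sphere. -/
noncomputable def gaussKernel (t : ℝ) (x y : S2) : ℝ := Real.exp (-(t ^ 2 * dist x y ^ 2))

lemma continuous_gaussKernel : Continuous fun p : ℝ × S2 × S2 => gaussKernel p.1 p.2.1 p.2.2 := by
  unfold gaussKernel
  fun_prop

/-- The Newtonian kernel is a superposition of Gaussians; on the diagonal both sides are `∞`. -/
lemma inv_edist_eq_lintegral_gauss (x y : S2) :
    (edist x y)⁻¹ = ENNReal.ofReal (2 / √Real.pi) *
      ∫⁻ t in Ioi 0, ENNReal.ofReal (gaussKernel t x y) := by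
  have hc : 0 < 2 / √Real.pi := by have := Real.pi_pos; positivity
  by_cases h : x = y
  · subst h
    simp only [edist_self, ENNReal.inv_zero, gaussKernel, dist_self]
    simp [ENNReal.mul_top, hc]
  · have hd : 0 < dist x y := dist_pos.2 h
    have hi : IntegrableOn (fun t : ℝ => Real.exp (-(dist x y ^ 2) * t ^ 2)) (Ioi 0) :=
      (integrable_exp_neg_mul_sq (by positivity)).integrableOn
    have h1 : ∀ t, gaussKernel t x y = Real.exp (-(dist x y ^ 2) * t ^ 2) := fun t => by
      rw [gaussKernel]; congr 1; ring
    simp_rw [h1]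
    rw [← ofReal_integral_eq_lintegral_ofReal hi (ae_of_all _ fun t => (Real.exp_pos _).le),
      integral_gaussian_Ioi, ← ENNReal.ofReal_mul hc.le, edist_dist,
      ← ENNReal.ofReal_inv_of_pos hd]
    congr 1
    rw [Real.sqrt_div Real.pi_pos.le, Real.sqrt_sq hd.le]
    have : √Real.pi ≠ 0 := (Real.sqrt_pos.2 Real.pi_pos).ne'
    field_simp

/-- The Euclidean inner product of two points of the sphere, in coordinates. -/
def dotS (x y : S2) : ℝ := ∑ j, x.1 j * y.1 j

lemma dotS_eq (x y : S2) :
    dotS x y = x.1 0 * y.1 0 + x.1 1 * y.1 1 + x.1 2 * y.1 2 := by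
  simp [dotS, Fin.sum_univ_three]

lemma gaussKernel_eq (t : ℝ) (x y : S2) :
    gaussKernel t x y = Real.exp (-(2 * t ^ 2)) * Real.exp (2 * t ^ 2 * dotS x y) := by
  rw [gaussKernel, dist_sq_eq, ← dotS_eq, ← Real.exp_add]
  congr 1; ring

lemma abs_dotS_le (x y : S2) : |dotS x y| ≤ 1 := by
  have h1 := coord_sq_sum x
  have h2 := coord_sq_sum y
  rw [dotS_eq, abs_le]
  constructor
  · nlinarith [sq_nonneg (x.1 0 + y.1 0), sq_nonneg (x.1 1 + y.1 1), sq_nonneg (x.1 2 + y.1 2)]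
  · nlinarith [sq_nonneg (x.1 0 - y.1 0), sq_nonneg (x.1 1 - y.1 1), sq_nonneg (x.1 2 - y.1 2)]

/-- Monomials in the Euclidean coordinates. -/
def coordMonomial {k : ℕ} (p : Fin k → Fin 3) (x : S2) : ℝ := ∏ i, x.1 (p i)

lemma continuous_coordMonomial {k : ℕ} (p : Fin k → Fin 3) : Continuous (coordMonomial p) := by
  unfold coordMonomial
  fun_prop

lemma integrable_of_continuous {X : Type*} [TopologicalSpace X] [CompactSpace X]
    [MeasurableSpace X] [OpensMeasurableSpace X] [SecondCountableTopology X]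
    {f : X → ℝ} (hf : Continuous f) (μ : Measure X)
    [IsFiniteMeasure μ] : Integrable f μ := by
  obtain ⟨C, hC⟩ := isCompact_univ.exists_bound_of_continuousOn hf.continuousOn
  exact Integrable.of_bound hf.measurable.aestronglyMeasurable C
    (ae_of_all _ fun x => hC x (mem_univ x))

lemma dotS_pow (k : ℕ) (x y : S2) :
    dotS x y ^ k = ∑ p : Fin k → Fin 3, coordMonomial p x * coordMonomial p y := by
  rw [dotS, Fintype.sum_pow]
  exact Finset.sum_congr rfl fun p _ => by
    rw [coordMonomial, coordMonomial, ← Finset.prod_mul_distrib]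

lemma continuous_dotS : Continuous fun p : S2 × S2 => dotS p.1 p.2 := by
  unfold dotS; fun_prop

lemma integral_dotS_pow (k : ℕ) (A B : Measure S2) [IsFiniteMeasure A] [IsFiniteMeasure B] :
    ∫ z, dotS z.1 z.2 ^ k ∂(A.prod B) =
      ∑ p : Fin k → Fin 3, (∫ x, coordMonomial p x ∂A) * ∫ y, coordMonomial p y ∂B := by
  simp_rw [dotS_pow]
  rw [integral_finsetSum]
  · exact Finset.sum_congr rfl fun p _ => integral_prod_mul _ _
  · intro p _
    exact integrable_of_continuous (((continuous_coordMonomial p).comp continuous_fst).mul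
      ((continuous_coordMonomial p).comp continuous_snd)) _

/-- The mutual Gaussian energy of two measures. -/
noncomputable def gaussEnergy (t : ℝ) (A B : Measure S2) : ℝ :=
  ∫ z, gaussKernel t z.1 z.2 ∂(A.prod B)

/-- The mutual Gaussian energy in terms of moments: on the sphere the Gaussian is, up to a constant
factor, the exponential series of the inner product. -/
lemma hasSum_gauss (t : ℝ) (A B : Measure S2) [IsFiniteMeasure A] [IsFiniteMeasure B] :
    HasSum (fun k : ℕ => Real.exp (-(2 * t ^ 2)) * ((2 * t ^ 2) ^ k / k.factorial *
      ∑ p : Fin k → Fin 3, (∫ x, coordMonomial p x ∂A) * ∫ y, coordMonomial p y ∂B))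
      (gaussEnergy t A B) := by
  set b := 2 * t ^ 2 with hb
  have hb0 : 0 ≤ b := by positivity
  have hterm : ∀ k : ℕ, Continuous fun z : S2 × S2 =>
      Real.exp (-b) * (b ^ k / k.factorial * dotS z.1 z.2 ^ k) := fun k =>
    continuous_const.mul (continuous_const.mul (continuous_dotS.pow k))
  have hsum : Summable fun k : ℕ => ∫ z, ‖Real.exp (-b) * (b ^ k / k.factorial *
      dotS z.1 z.2 ^ k)‖ ∂(A.prod B) := by
    refine Summable.of_nonneg_of_le (fun k => integral_nonneg fun z => norm_nonneg _) (fun k => ?_)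
      (((Real.summable_pow_div_factorial b).mul_left (Real.exp (-b))).mul_right
        ((A.prod B).real univ))
    calc ∫ z, ‖Real.exp (-b) * (b ^ k / k.factorial * dotS z.1 z.2 ^ k)‖ ∂(A.prod B)
        ≤ ∫ z, Real.exp (-b) * (b ^ k / k.factorial) ∂(A.prod B) := by
          refine integral_mono (integrable_of_continuous (hterm k) _).norm
            (integrable_const _) fun z => ?_
          simp only [norm_mul, norm_pow, Real.norm_eq_abs]
          rw [abs_of_pos (Real.exp_pos _), abs_of_nonneg (by positivity : 0 ≤ b ^ k / _)]
          refine mul_le_mul_of_nonneg_left ?_ (Real.exp_pos _).le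
          exact mul_le_of_le_one_right (by positivity)
            (pow_le_one₀ (abs_nonneg _) (abs_dotS_le _ _))
      _ = _ := by rw [integral_const, smul_eq_mul, mul_comm]
  have h := hasSum_integral_of_summable_integral_norm
    (fun k => integrable_of_continuous (hterm k) (A.prod B)) hsum
  have h2 : ∫ z, ∑' k : ℕ, Real.exp (-b) * (b ^ k / k.factorial * dotS z.1 z.2 ^ k) ∂(A.prod B) =
      gaussEnergy t A B := by
    refine integral_congr_ae (ae_of_all _ fun z => ?_)
    simp only
    rw [gaussKernel_eq, ← hb, tsum_mul_left, Real.exp_eq_exp_ℝ, NormedSpace.exp_eq_tsum_div]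
    congr 1
    refine tsum_congr fun k => ?_
    rw [mul_pow]; ring
  rw [h2] at h
  simp_rw [integral_const_mul, integral_dotS_pow] at h
  exact h

/-- Twice the mutual Gaussian energy is at most the sum of the self-energies, and in the case of
equality all moments agree. -/
lemma gauss_energy (t : ℝ) (A B : Measure S2) [IsFiniteMeasure A] [IsFiniteMeasure B] :
    2 * gaussEnergy t A B ≤
      gaussEnergy t A A + gaussEnergy t B B ∧
    (t ≠ 0 → 2 * gaussEnergy t A B =
      gaussEnergy t A A + gaussEnergy t B B →
      ∀ (k : ℕ) (p : Fin k → Fin 3), ∫ x, coordMonomial p x ∂A = ∫ x, coordMonomial p x ∂B) := by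
  have h := ((hasSum_gauss t A A).add (hasSum_gauss t B B)).sub
    ((hasSum_gauss t A B).mul_left 2)
  have hterm : ∀ k : ℕ, Real.exp (-(2 * t ^ 2)) * ((2 * t ^ 2) ^ k / k.factorial *
      ∑ p : Fin k → Fin 3, (∫ x, coordMonomial p x ∂A) * ∫ y, coordMonomial p y ∂A) +
      Real.exp (-(2 * t ^ 2)) * ((2 * t ^ 2) ^ k / k.factorial *
      ∑ p : Fin k → Fin 3, (∫ x, coordMonomial p x ∂B) * ∫ y, coordMonomial p y ∂B) -
      2 * (Real.exp (-(2 * t ^ 2)) * ((2 * t ^ 2) ^ k / k.factorial *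
      ∑ p : Fin k → Fin 3, (∫ x, coordMonomial p x ∂A) * ∫ y, coordMonomial p y ∂B)) =
      Real.exp (-(2 * t ^ 2)) * ((2 * t ^ 2) ^ k / k.factorial) *
      ∑ p : Fin k → Fin 3, (∫ x, coordMonomial p x ∂A - ∫ y, coordMonomial p y ∂B) ^ 2 :=
    fun k => by
      have : ∑ p : Fin k → Fin 3, (∫ x, coordMonomial p x ∂A - ∫ y, coordMonomial p y ∂B) ^ 2 =
          ∑ p : Fin k → Fin 3, (∫ x, coordMonomial p x ∂A) * (∫ y, coordMonomial p y ∂A) +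
          ∑ p : Fin k → Fin 3, (∫ x, coordMonomial p x ∂B) * (∫ y, coordMonomial p y ∂B) -
          2 * ∑ p : Fin k → Fin 3, (∫ x, coordMonomial p x ∂A) * (∫ y, coordMonomial p y ∂B) := by
        rw [Finset.mul_sum, ← Finset.sum_add_distrib, ← Finset.sum_sub_distrib]
        exact Finset.sum_congr rfl fun p _ => by ring
      rw [this]; ring
  -- the expansion of the energy of `A - B` is a sum of squares
  simp_rw [hterm] at h
  have hnn : ∀ k : ℕ, 0 ≤ Real.exp (-(2 * t ^ 2)) * ((2 * t ^ 2) ^ k / k.factorial) *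
      ∑ p : Fin k → Fin 3, (∫ x, coordMonomial p x ∂A - ∫ y, coordMonomial p y ∂B) ^ 2 :=
    fun k => mul_nonneg (by positivity) (Finset.sum_nonneg fun p _ => sq_nonneg _)
  refine ⟨by linarith [h.nonneg hnn], fun ht heq k p => ?_⟩
  rw [heq, sub_self, hasSum_zero_iff_of_nonneg hnn] at h
  have hk := congrFun h k
  simp only [Pi.zero_apply] at hk
  have ht2 : 0 < 2 * t ^ 2 := by positivity
  have hpos : 0 < Real.exp (-(2 * t ^ 2)) * ((2 * t ^ 2) ^ k / k.factorial) := by positivity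
  have hs := (mul_eq_zero.1 hk).resolve_left hpos.ne'
  rw [Finset.sum_eq_zero_iff_of_nonneg (fun p _ => sq_nonneg _)] at hs
  exact sub_eq_zero.1 (pow_eq_zero_iff two_ne_zero |>.1 (hs p (Finset.mem_univ p)))

/-- A finite measure on the sphere is determined by its moments. -/
lemma measure_eq_of_moments {A B : Measure S2} [IsFiniteMeasure A] [IsFiniteMeasure B]
    (h : ∀ (k : ℕ) (p : Fin k → Fin 3),
      ∫ x, coordMonomial p x ∂A = ∫ x, coordMonomial p x ∂B) : A = B := by
  let c : Fin 3 → BoundedContinuousFunction S2 ℝ := fun j =>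
    BoundedContinuousFunction.mkOfCompact ⟨fun x => x.1 j, by fun_prop⟩
  have hclos : ∀ g ∈ Submonoid.closure (range c),
      ∃ (k : ℕ) (p : Fin k → Fin 3), ∀ x, g x = coordMonomial p x := by
    intro g hg
    induction hg using Submonoid.closure_induction with
    | mem g hg =>
      obtain ⟨j, rfl⟩ := hg
      exact ⟨1, fun _ => j, fun x => by simp [coordMonomial, c]⟩
    | one => exact ⟨0, Fin.elim0, fun x => by simp [coordMonomial]⟩
    | mul f g _ _ hf hg =>
      obtain ⟨k, p, hp⟩ := hf
      obtain ⟨l, q, hq⟩ := hg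
      refine ⟨k + l, Fin.append p q, fun x => ?_⟩
      simp [coordMonomial, Fin.prod_univ_add, hp x, hq x]
  let 𝒜 : StarSubalgebra ℝ (BoundedContinuousFunction S2 ℝ) :=
    { Algebra.adjoin ℝ (range c) with
      star_mem' := fun {f} hf => by
        have : star f = f := by ext x; simp
        rw [this]; exact hf }
  refine ext_of_forall_mem_subalgebra_integral_eq_of_polish (A := 𝒜) ?_ ?_
  · intro x y hxy
    obtain ⟨j, hj⟩ : ∃ j, x.1 j ≠ y.1 j := by
      by_contra hcon
      push Not at hcon
      exact hxy (Subtype.ext (by ext j; exact hcon j))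
    refine ⟨fun z => z.1 j, ⟨(c j).toContinuousMap, ⟨c j, ?_, rfl⟩, rfl⟩, hj⟩
    exact Algebra.subset_adjoin (mem_range_self j)
  · intro g hg
    have hg' : g ∈ Submodule.span ℝ (Submonoid.closure (range c) :
        Set (BoundedContinuousFunction S2 ℝ)) := by
      rw [← Algebra.adjoin_eq_span]
      exact hg
    have hint : ∀ (f : BoundedContinuousFunction S2 ℝ) (μ : Measure S2) [IsFiniteMeasure μ],
        Integrable f μ := fun f μ _ => integrable_of_continuous f.continuous μ
    induction hg' using Submodule.span_induction with
    | mem g hg₀ =>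
      obtain ⟨k, p, hp⟩ := hclos g hg₀
      simp_rw [hp]
      exact h k p
    | zero => simp
    | add f g hf hg' ihf ihg =>
      simp only [BoundedContinuousFunction.coe_add, Pi.add_apply]
      rw [integral_add (hint f A) (hint g A), integral_add (hint f B) (hint g B),
        ihf, ihg]
      · rw [← Algebra.adjoin_eq_span] at hg'; exact hg'
      · rw [← Algebra.adjoin_eq_span] at hf; exact hf
    | smul r f hf ih =>
      simp only [BoundedContinuousFunction.coe_smul, smul_eq_mul]
      rw [integral_const_mul, integral_const_mul, ih]
      rw [← Algebra.adjoin_eq_span] at hf; exact hf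

/-- The mutual Newtonian energy of two measures. -/
noncomputable def mutualEnergy (A B : Measure S2) : ℝ≥0∞ := ∫⁻ x, potential B x ∂A

lemma const_mul_lintegral_swap {X : Type*} [MeasurableSpace X] {ν : Measure X} [SFinite ν]
    {f : ℝ → X → ℝ≥0∞} (hf : Measurable (Function.uncurry f)) {c : ℝ≥0∞} (hc : c ≠ ⊤) :
    c * ∫⁻ t in Ioi 0, ∫⁻ z, f t z ∂ν = ∫⁻ z, (c * ∫⁻ t in Ioi 0, f t z) ∂ν := by
  rw [lintegral_lintegral_swap hf.aemeasurable, ← lintegral_const_mul' _ _ hc]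

lemma mutualEnergy_eq_lintegral_prod (A B : Measure S2) [IsFiniteMeasure B] :
    mutualEnergy A B = ∫⁻ z, (edist z.1 z.2)⁻¹ ∂(A.prod B) := by
  rw [lintegral_prod (μ := A) (ν := B) (fun z : S2 × S2 => (edist z.1 z.2)⁻¹)
    measurable_inv_edist.aemeasurable]
  rfl

lemma ofReal_gaussEnergy (t : ℝ) (A B : Measure S2) [IsFiniteMeasure A] [IsFiniteMeasure B] :
    ENNReal.ofReal (gaussEnergy t A B) =
      ∫⁻ z, ENNReal.ofReal (gaussKernel t z.1 z.2) ∂(A.prod B) := by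
  have hk : Continuous fun z : S2 × S2 => gaussKernel t z.1 z.2 :=
    continuous_gaussKernel.comp (by fun_prop : Continuous fun z : S2 × S2 => (t, z))
  exact ofReal_integral_eq_lintegral_ofReal (integrable_of_continuous hk _)
      (ae_of_all _ fun z => (Real.exp_pos _).le)

lemma mutualEnergy_eq (A B : Measure S2) [IsFiniteMeasure A] [IsFiniteMeasure B] :
    mutualEnergy A B = ENNReal.ofReal (2 / √Real.pi) *
      ∫⁻ t in Ioi 0, ENNReal.ofReal (gaussEnergy t A B) := by
  have hm : Measurable (Function.uncurry fun (t : ℝ) (z : S2 × S2) =>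
      ENNReal.ofReal (gaussKernel t z.1 z.2)) :=
    continuous_gaussKernel.measurable.ennreal_ofReal
  simp_rw [ofReal_gaussEnergy]
  rw [const_mul_lintegral_swap hm ENNReal.ofReal_ne_top, mutualEnergy_eq_lintegral_prod]
  simp_rw [← inv_edist_eq_lintegral_gauss]

lemma mutualEnergy_comm (A B : Measure S2) [IsFiniteMeasure A] [IsFiniteMeasure B] :
    mutualEnergy A B = mutualEnergy B A := by
  unfold mutualEnergy potential
  rw [lintegral_lintegral_swap measurable_inv_edist.aemeasurable]
  simp_rw [edist_comm]

/-- Measures of finite energy whose potentials agree almost everywhere with respect to both are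
equal. -/
theorem measure_eq_of_potential_eq {A B : Measure S2} [IsFiniteMeasure A] [IsFiniteMeasure B]
    (hA : ∀ᵐ x ∂A, potential A x = potential B x) (hB : ∀ᵐ x ∂B, potential A x = potential B x)
    (hfin : mutualEnergy A A ≠ ⊤) : A = B := by
  have h1 : mutualEnergy A A = mutualEnergy A B := lintegral_congr_ae hA
  have h2 : mutualEnergy B A = mutualEnergy B B := lintegral_congr_ae hB
  have h3 := mutualEnergy_comm A B
  have hc : 0 < 2 / √Real.pi := by have := Real.pi_pos; positivity
  have hc0 : ENNReal.ofReal (2 / √Real.pi) ≠ 0 := by simpa using hc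
  have hc1 : ENNReal.ofReal (2 / √Real.pi) ≠ ⊤ := ENNReal.ofReal_ne_top
  have hk : Continuous fun p : ℝ × S2 × S2 => gaussKernel p.1 p.2.1 p.2.2 :=
    continuous_gaussKernel
  have hmeas : ∀ (A B : Measure S2) [IsFiniteMeasure A] [IsFiniteMeasure B],
      Measurable fun t => gaussEnergy t A B := fun A B _ _ =>
    (hk.measurable.stronglyMeasurable.integral_prod_right' (ν := A.prod B)).measurable
  have hnn : ∀ (A B : Measure S2) (t : ℝ), 0 ≤ gaussEnergy t A B :=
    fun A B t => integral_nonneg fun z => (Real.exp_pos _).le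
  have hAA := mutualEnergy_eq A A
  have hAB := mutualEnergy_eq A B
  have hBB := mutualEnergy_eq B B
  have hle : ∀ t : ℝ, 2 * ENNReal.ofReal (gaussEnergy t A B) ≤
      ENNReal.ofReal (gaussEnergy t A A) +
        ENNReal.ofReal (gaussEnergy t B B) := fun t => by
    rw [← ENNReal.ofReal_add (hnn _ _ _) (hnn _ _ _), show (2 : ℝ≥0∞) = ENNReal.ofReal 2 by simp,
      ← ENNReal.ofReal_mul (by norm_num)]
    exact ENNReal.ofReal_le_ofReal (gauss_energy t A B).1
  have e1 : ∀ (A' B' A'' B'' : Measure S2) [IsFiniteMeasure A'] [IsFiniteMeasure B']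
      [IsFiniteMeasure A''] [IsFiniteMeasure B''], mutualEnergy A' B' = mutualEnergy A'' B'' →
      ∫⁻ t in Ioi 0, ENNReal.ofReal (gaussEnergy t A' B') =
        ∫⁻ t in Ioi 0, ENNReal.ofReal (gaussEnergy t A'' B'') := by
    intro A' B' A'' B'' _ _ _ _ h
    rw [mutualEnergy_eq, mutualEnergy_eq] at h
    exact (ENNReal.mul_right_inj hc0 hc1).1 h
  have hfin' : ∫⁻ t in Ioi 0, ENNReal.ofReal (gaussEnergy t A B) ≠ ⊤ := by
    intro htop
    rw [h1, hAB, htop, ENNReal.mul_top hc0] at hfin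
    exact hfin rfl
  -- `A - B` has zero Newtonian energy, hence zero Gaussian energy for almost every `t`; a single
  -- such `t` suffices
  have hae := ae_eq_of_ae_le_of_lintegral_le (μ := volume.restrict (Ioi (0 : ℝ)))
    (ae_of_all _ hle) (by
      rw [lintegral_const_mul _ (hmeas A B).ennreal_ofReal]
      exact ENNReal.mul_ne_top (by simp) hfin')
    (((hmeas A A).ennreal_ofReal.add (hmeas B B).ennreal_ofReal).aemeasurable) (by
      rw [lintegral_add_left (hmeas A A).ennreal_ofReal,
        lintegral_const_mul _ (hmeas A B).ennreal_ofReal, e1 A A A B h1,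
        e1 B B A B (by rw [← h2, ← h3]), two_mul])
  have : ∃ t ∈ Ioi (0 : ℝ), 2 * ENNReal.ofReal (gaussEnergy t A B) =
      ENNReal.ofReal (gaussEnergy t A A) +
        ENNReal.ofReal (gaussEnergy t B B) := by
    have hne : (ae (volume.restrict (Ioi (0 : ℝ)))).NeBot := by
      rw [ae_neBot]; simp
    obtain ⟨t, ht, ht'⟩ := (hae.and (ae_restrict_mem measurableSet_Ioi)).exists
    exact ⟨t, ht', ht⟩
  obtain ⟨t, ht, heq⟩ := this
  refine measure_eq_of_moments ((gauss_energy t A B).2 (ne_of_gt ht) ?_)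
  rw [← ENNReal.ofReal_add (hnn _ _ _) (hnn _ _ _), show (2 : ℝ≥0∞) = ENNReal.ofReal 2 by simp,
    ← ENNReal.ofReal_mul (by norm_num)] at heq
  exact (ENNReal.ofReal_eq_ofReal_iff (mul_nonneg zero_le_two (hnn _ _ _))
    (add_nonneg (hnn _ _ _) (hnn _ _ _))).1 heq

/-! ### Variational characterization of the equilibrium measure -/

lemma energy_eq_mutualEnergy (μ : Measure S2) : energy μ = mutualEnergy μ μ := rfl

lemma lowerSemicontinuous_potential (μ : Measure S2) : LowerSemicontinuous (potential μ) := by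
  rw [lowerSemicontinuous_iff_le_liminf]
  intro x
  have hc : ∀ y : S2, Filter.liminf (fun x' => (edist x' y)⁻¹) (nhds x) = (edist x y)⁻¹ :=
    fun y => (((continuous_id.edist continuous_const).inv).tendsto x).liminf_eq
  unfold potential
  simp_rw [← hc]
  exact lintegral_liminf_le fun x' => measurable_inv_edist_left x'

lemma potential_add (A B : Measure S2) (x : S2) :
    potential (A + B) x = potential A x + potential B x := by
  unfold potential; rw [lintegral_add_measure]

lemma potential_smul (c : ℝ≥0∞) (A : Measure S2) (x : S2) :
    potential (c • A) x = c * potential A x := by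
  unfold potential; rw [lintegral_smul_measure, smul_eq_mul]

lemma potential_mono {A B : Measure S2} (h : A ≤ B) (x : S2) : potential A x ≤ potential B x :=
  lintegral_mono' h le_rfl

lemma mutualEnergy_mono {A B : Measure S2} (h : A ≤ B) : mutualEnergy A A ≤ mutualEnergy B B :=
  lintegral_mono' h fun x => potential_mono h x

lemma mutualEnergy_smul_self (c : ℝ≥0∞) (A : Measure S2) [SFinite A] :
    mutualEnergy (c • A) (c • A) = c * (c * mutualEnergy A A) := by
  unfold mutualEnergy
  simp_rw [potential_smul]
  rw [lintegral_smul_measure, smul_eq_mul, lintegral_const_mul _ (measurable_potential A)]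

lemma mutualEnergy_combination (s t : ℝ≥0∞) (A B : Measure S2) [IsFiniteMeasure A]
    [IsFiniteMeasure B] : mutualEnergy (s • A + t • B) (s • A + t • B) =
      s * s * mutualEnergy A A + 2 * (s * t * mutualEnergy B A) + t * t * mutualEnergy B B := by
  have hcomm := mutualEnergy_comm A B
  have mA := measurable_potential A
  have mB := measurable_potential B
  unfold mutualEnergy at hcomm ⊢
  simp_rw [potential_add, potential_smul]
  rw [lintegral_add_left (mA.const_mul s), lintegral_const_mul _ mA, lintegral_const_mul _ mB]
  simp only [lintegral_add_measure, lintegral_smul_measure, smul_eq_mul]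
  rw [hcomm]
  ring

/-- A measure of finite energy has no atoms. -/
lemma measure_singleton_eq_zero {μ : Measure S2} (h : mutualEnergy μ μ ≠ ⊤) (x : S2) :
    μ {x} = 0 := by
  by_contra hx
  apply h
  have h1 : potential μ x = ⊤ := by
    have : ∫⁻ y in {x}, (edist x y)⁻¹ ∂μ ≤ potential μ x := setLIntegral_le_lintegral _ _
    rw [lintegral_singleton] at this
    simpa [ENNReal.top_mul hx] using this
  have : ∫⁻ y in {x}, potential μ y ∂μ ≤ mutualEnergy μ μ := setLIntegral_le_lintegral _ _
  rw [lintegral_singleton, h1, ENNReal.top_mul hx] at this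
  exact top_le_iff.1 this

/-- If `2 t d + t² e ≥ 0` for all small `t > 0`, then `d ≥ 0`. -/
lemma nonneg_of_quadratic {d e : ℝ} (h : ∀ t ∈ Ioo (0 : ℝ) 1, 0 ≤ 2 * t * d + t ^ 2 * e) :
    0 ≤ d := by
  by_contra hd
  push Not at hd
  set t := min (1 / 2) (-d / (|e| + 1)) with ht
  have he : 0 < |e| + 1 := by positivity
  have ht0 : 0 < t := lt_min (by norm_num) (div_pos (by linarith) he)
  have ht1 : t < 1 := (min_le_left _ _).trans_lt (by norm_num)
  have h1 := h t ⟨ht0, ht1⟩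
  have h2 : t * (|e| + 1) ≤ -d := by
    have := min_le_right (1 / 2) (-d / (|e| + 1))
    rwa [← ht, le_div_iff₀ he] at this
  have h3 := le_abs_self e
  nlinarith

/-- The first variation of the weighted energy at a minimizer, in the direction of `ν`. Nothing is
assumed about the mutual energy; if it is infinite, there is nothing to prove. -/
lemma first_variation {E : Set S2} {R : S2 → ℝ≥0∞} {μ ν : Measure S2} (hμ : IsExtremal E R μ)
    (hV : minEnergy E R ≠ ⊤) (hν : ν ∈ unitMeasures E)
    (hνν : mutualEnergy ν ν ≠ ⊤) (hRν : ∫⁻ x, R x ∂ν ≠ ⊤) :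
    mutualEnergy μ μ + ∫⁻ x, R x ∂μ ≤ mutualEnergy ν μ + ∫⁻ x, R x ∂ν := by
  obtain ⟨⟨hμp, hμE⟩, hμV⟩ := hμ
  obtain ⟨hνp, hνE⟩ := hν
  by_cases hνμ : mutualEnergy ν μ = ⊤
  · simp [hνμ]
  rw [← hμV, weightedEnergy, energy_eq_mutualEnergy] at hV
  obtain ⟨hμμ, hRμ'⟩ := ENNReal.add_ne_top.1 hV
  have hRμ : ∫⁻ x, R x ∂μ ≠ ⊤ := fun h => hRμ' (by rw [h]; simp)
  set a := mutualEnergy μ μ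
  set b := mutualEnergy ν μ
  set c := mutualEnergy ν ν
  set q := ∫⁻ x, R x ∂μ
  set p := ∫⁻ x, R x ∂ν
  have key : ∀ t ∈ Ioo (0 : ℝ) 1,
      0 ≤ 2 * t * (b.toReal + p.toReal - a.toReal - q.toReal) +
        t ^ 2 * (a.toReal - 2 * b.toReal + c.toReal) := by
    intro t ht
    have hs : 0 < 1 - t := by linarith [ht.2]
    set τ := ENNReal.ofReal t with hτ
    set σ' := ENNReal.ofReal (1 - t) with hσ'
    have hsum : σ' + τ = 1 := by
      rw [hτ, hσ', ← ENNReal.ofReal_add hs.le ht.1.le]; simp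
    have hmem : σ' • μ + τ • ν ∈ unitMeasures E := by
      refine ⟨⟨?_⟩, ?_⟩
      · simp [hsum]
      · simp [hμE, hνE]
    have hle : weightedEnergy R μ ≤ weightedEnergy R (σ' • μ + τ • ν) := by
      rw [hμV]
      exact iInf₂_le _ hmem
    rw [weightedEnergy, weightedEnergy, energy_eq_mutualEnergy, energy_eq_mutualEnergy,
      mutualEnergy_combination, lintegral_add_measure, lintegral_smul_measure,
      lintegral_smul_measure, smul_eq_mul, smul_eq_mul] at hle
    have hτt : τ ≠ ⊤ := ENNReal.ofReal_ne_top
    have hσt : σ' ≠ ⊤ := ENNReal.ofReal_ne_top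
    have f1 : σ' * σ' * a ≠ ⊤ := ENNReal.mul_ne_top (ENNReal.mul_ne_top hσt hσt) hμμ
    have f2 : 2 * (σ' * τ * b) ≠ ⊤ :=
      ENNReal.mul_ne_top (by simp) (ENNReal.mul_ne_top (ENNReal.mul_ne_top hσt hτt) hνμ)
    have f3 : τ * τ * c ≠ ⊤ := ENNReal.mul_ne_top (ENNReal.mul_ne_top hτt hτt) hνν
    have f4 : σ' * q ≠ ⊤ := ENNReal.mul_ne_top hσt hRμ
    have f5 : τ * p ≠ ⊤ := ENNReal.mul_ne_top hτt hRν
    have f6 : 2 * (σ' * q + τ * p) ≠ ⊤ :=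
      ENNReal.mul_ne_top (by simp) (ENNReal.add_ne_top.2 ⟨f4, f5⟩)
    have f7 : σ' * σ' * a + 2 * (σ' * τ * b) ≠ ⊤ := ENNReal.add_ne_top.2 ⟨f1, f2⟩
    have f8 : σ' * σ' * a + 2 * (σ' * τ * b) + τ * τ * c ≠ ⊤ := ENNReal.add_ne_top.2 ⟨f7, f3⟩
    have hr := ENNReal.toReal_mono (ENNReal.add_ne_top.2 ⟨f8, f6⟩) hle
    rw [ENNReal.toReal_add hμμ hRμ', ENNReal.toReal_add f8 f6, ENNReal.toReal_add f7 f3,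
      ENNReal.toReal_add f1 f2] at hr
    simp only [ENNReal.toReal_mul, ENNReal.toReal_add f4 f5, ENNReal.toReal_ofNat] at hr
    rw [hτ, hσ', ENNReal.toReal_ofReal ht.1.le, ENNReal.toReal_ofReal hs.le] at hr
    nlinarith [hr]
  have hfinal := nonneg_of_quadratic key
  rw [← ENNReal.toReal_le_toReal (ENNReal.add_ne_top.2 ⟨hμμ, hRμ⟩)
    (ENNReal.add_ne_top.2 ⟨hνμ, hRν⟩), ENNReal.toReal_add hμμ hRμ, ENNReal.toReal_add hνμ hRν]
  linarith

lemma normalized_restrict_mem {E B : Set S2} {ρ : Measure S2} [IsFiniteMeasure ρ]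
    (hρE : ρ Eᶜ = 0) (hB : ρ B ≠ 0) : (ρ B)⁻¹ • ρ.restrict B ∈ unitMeasures E := by
  refine ⟨⟨?_⟩, ?_⟩
  · simp [ENNReal.inv_mul_cancel hB (measure_ne_top ρ B)]
  · have : ρ.restrict B Eᶜ = 0 := le_antisymm ((Measure.restrict_apply_le _ _).trans hρE.le) bot_le
    simp [this]

/-- The minimizer's potential plus the field is bounded below by the modified Robin constant,
almost everywhere with respect to any measure of finite energy. -/
lemma le_potential_add_field {E : Set S2} {R : S2 → ℝ≥0∞} (hR : Measurable R) {μ ρ : Measure S2}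
    [IsFiniteMeasure ρ] (hμ : IsExtremal E R μ) (hV : minEnergy E R ≠ ⊤) (hρE : ρ Eᶜ = 0)
    (hρρ : mutualEnergy ρ ρ ≠ ⊤) (hRρ : ∫⁻ x, R x ∂ρ ≠ ⊤) :
    ∀ᵐ x ∂ρ, mutualEnergy μ μ + ∫⁻ x, R x ∂μ ≤ potential μ x + R x := by
  have hμp : IsProbabilityMeasure μ := hμ.1.1
  set F := mutualEnergy μ μ + ∫⁻ x, R x ∂μ with hF
  have mU := measurable_potential μ
  set B : Set S2 := {x | potential μ x + R x < F} with hBdef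
  have hBm : MeasurableSet B := measurableSet_lt (mU.add hR) measurable_const
  suffices hB0 : ρ B = 0 by
    rw [ae_iff]
    simpa only [not_le] using hB0
  by_contra hB
  have hFtop : F ≠ ⊤ := by
    have h := hV
    rw [← hμ.2, weightedEnergy, energy_eq_mutualEnergy] at h
    obtain ⟨h1, h2⟩ := ENNReal.add_ne_top.1 h
    exact ENNReal.add_ne_top.2 ⟨h1, fun h => h2 (by rw [h]; simp)⟩
  have hinv : (ρ B)⁻¹ ≠ ⊤ := ENNReal.inv_ne_top.2 hB
  -- vary `μ` towards the normalized restriction of `ρ` to the exceptional set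
  have h1 := first_variation hμ hV (normalized_restrict_mem hρE hB) (by
      rw [mutualEnergy_smul_self]
      exact ENNReal.mul_ne_top hinv (ENNReal.mul_ne_top hinv
        (ne_top_of_le_ne_top hρρ (mutualEnergy_mono Measure.restrict_le_self)))) (by
      rw [lintegral_smul_measure, smul_eq_mul]
      exact ENNReal.mul_ne_top hinv (ne_top_of_le_ne_top hRρ (setLIntegral_le_lintegral _ _)))
  rw [← hF, mutualEnergy, lintegral_smul_measure, lintegral_smul_measure, smul_eq_mul,
    smul_eq_mul, ← mul_add, ← lintegral_add_left mU] at h1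
  have hle : ∫⁻ x in B, (potential μ x + R x) ∂ρ ≤ ∫⁻ _ in B, F ∂ρ :=
    setLIntegral_mono measurable_const fun x hx => le_of_lt hx
  have hfin : ∫⁻ x in B, (potential μ x + R x) ∂ρ ≠ ⊤ := by
    refine ne_top_of_le_ne_top ?_ hle
    rw [setLIntegral_const]
    exact ENNReal.mul_ne_top hFtop (measure_ne_top _ _)
  have h2 : ∫⁻ x in B, (potential μ x + R x) ∂ρ < ∫⁻ _ in B, F ∂ρ :=
    setLIntegral_strict_mono hBm hB measurable_const hfin (ae_of_all _ fun x hx => hx)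
  rw [setLIntegral_const] at h2
  have h3 : F * ρ B ≤ ∫⁻ x in B, (potential μ x + R x) ∂ρ := by
    calc F * ρ B ≤ ((ρ B)⁻¹ * ∫⁻ x in B, (potential μ x + R x) ∂ρ) * ρ B := by gcongr
      _ = _ := by
        rw [mul_comm (ρ B)⁻¹, mul_assoc, ENNReal.inv_mul_cancel hB (measure_ne_top ρ B), mul_one]
  exact absurd h2 (not_lt.2 h3)

lemma potential_add_field_ae_eq {E : Set S2} {R : S2 → ℝ≥0∞} (hR : Measurable R) {μ : Measure S2}
    (hμ : IsExtremal E R μ) (hV : minEnergy E R ≠ ⊤) :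
    ∀ᵐ x ∂μ, potential μ x + R x = mutualEnergy μ μ + ∫⁻ x, R x ∂μ := by
  have hμp : IsProbabilityMeasure μ := hμ.1.1
  have h := hV
  rw [← hμ.2, weightedEnergy, energy_eq_mutualEnergy] at h
  obtain ⟨h1, h2⟩ := ENNReal.add_ne_top.1 h
  have h3 : ∫⁻ x, R x ∂μ ≠ ⊤ := fun h => h2 (by rw [h]; simp)
  have hle := le_potential_add_field hR hμ hV hμ.1.2 h1 h3
  have := ae_eq_of_ae_le_of_lintegral_le hle (by simp [h1, h3])
    ((measurable_potential μ).add hR).aemeasurable (by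
      rw [lintegral_add_left (measurable_potential μ)]
      simp [mutualEnergy])
  filter_upwards [this] with x hx
  exact hx.symm

lemma mutualEnergy_surfaceMeasure_ne_top : mutualEnergy surfaceMeasure surfaceMeasure ≠ ⊤ := by
  have : mutualEnergy surfaceMeasure surfaceMeasure ≤
      ∫⁻ _, 2 * (ENNReal.ofReal Real.pi * ENNReal.ofReal Real.pi) ∂surfaceMeasure :=
    lintegral_mono_ae potential_surfaceMeasure_le
  refine ne_top_of_le_ne_top ?_ this
  rw [lintegral_const]
  exact ENNReal.mul_ne_top (ENNReal.mul_ne_top (by simp) (ENNReal.mul_ne_top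
    ENNReal.ofReal_ne_top ENNReal.ofReal_ne_top)) (measure_ne_top _ _)

/-- The field, set to `∞` off the conductor. It is lower semicontinuous, hence measurable, on the
whole sphere, whereas the values of `Q` off `E` are arbitrary. -/
noncomputable def extendField (E : Set S2) (Q : S2 → ℝ≥0∞) (x : S2) : ℝ≥0∞ :=
  open Classical in if x ∈ E then Q x else ⊤

lemma extendField_of_mem {E : Set S2} {Q : S2 → ℝ≥0∞} {x : S2} (hx : x ∈ E) :
    extendField E Q x = Q x := if_pos hx

lemma lowerSemicontinuous_extendField {E : Set S2} (hE : IsClosed E) {Q : S2 → ℝ≥0∞}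
    (hQ : LowerSemicontinuousOn Q E) : LowerSemicontinuous (extendField E Q) := by
  intro x y hy
  by_cases hx : x ∈ E
  · rw [extendField_of_mem hx] at hy
    have := hQ x hx y hy
    rw [eventually_nhdsWithin_iff] at this
    filter_upwards [this] with z hz
    by_cases hzE : z ∈ E
    · rw [extendField_of_mem hzE]; exact hz hzE
    · rw [extendField, if_neg hzE]; exact lt_of_lt_of_le hy le_top
  · filter_upwards [hE.isOpen_compl.mem_nhds hx] with z hz
    rw [extendField, if_neg hx] at hy
    rwa [extendField, if_neg hz]

lemma lintegral_extendField {E : Set S2} (Q : S2 → ℝ≥0∞) {μ : Measure S2} (hμ : μ Eᶜ = 0) :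
    ∫⁻ x, extendField E Q x ∂μ = ∫⁻ x, Q x ∂μ := by
  refine lintegral_congr_ae ?_
  have : ∀ᵐ x ∂μ, x ∈ E := by rw [ae_iff]; exact hμ
  filter_upwards [this] with x hx
  exact extendField_of_mem hx

lemma minEnergy_extendField (E : Set S2) (Q : S2 → ℝ≥0∞) :
    minEnergy E (extendField E Q) = minEnergy E Q := by
  unfold minEnergy
  refine iInf_congr fun μ => iInf_congr fun hμ => ?_
  rw [weightedEnergy, weightedEnergy, lintegral_extendField Q hμ.2]

lemma isExtremal_extendField {E : Set S2} {Q : S2 → ℝ≥0∞} {μ : Measure S2}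
    (hμ : IsExtremal E Q μ) : IsExtremal E (extendField E Q) μ :=
  ⟨hμ.1, by rw [minEnergy_extendField, ← hμ.2, weightedEnergy, weightedEnergy,
    lintegral_extendField Q hμ.1.2]⟩

/-- The minimal energy is finite: some normalized restriction of surface measure has finite
weighted energy. -/
lemma minEnergy_ne_top {E : Set S2} (hE : IsClosed E) {Q : S2 → ℝ≥0∞}
    (hQ : IsExternalField E Q) : minEnergy E Q ≠ ⊤ := by
  set R := extendField E Q with hR
  have hlsc := lowerSemicontinuous_extendField hE hQ.1
  have hn : ∃ n : ℕ, surfaceMeasure {x | R x ≤ n} ≠ 0 := by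
    by_contra hcon
    push Not at hcon
    have h0 : surfaceMeasure (⋃ n : ℕ, {x | R x ≤ n}) = 0 := measure_iUnion_null hcon
    have hsub : {x ∈ E | Q x < ⊤} ⊆ ⋃ n : ℕ, {x | R x ≤ n} := by
      rintro x ⟨hx, hx'⟩
      obtain ⟨n, hn⟩ := ENNReal.exists_nat_gt hx'.ne
      exact mem_iUnion.2 ⟨n, by simpa [hR, extendField_of_mem hx] using hn.le⟩
    exact hQ.2.ne' (measure_mono_null hsub h0)
  obtain ⟨n, hn⟩ := hn
  set B := {x | R x ≤ n} with hB
  have hBm : MeasurableSet B := (hlsc.isClosed_preimage n).measurableSet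
  have hBE : B ⊆ E := fun x hx => by
    by_contra hxE
    have : (⊤ : ℝ≥0∞) ≤ n := by simp [hB, hR, extendField, hxE] at hx
    exact absurd this (by simp)
  have hinv : (surfaceMeasure B)⁻¹ ≠ ⊤ := ENNReal.inv_ne_top.2 hn
  have hmem : (surfaceMeasure B)⁻¹ • surfaceMeasure.restrict B ∈ unitMeasures E := by
    have := normalized_restrict_mem (E := E) (B := B) (ρ := surfaceMeasure.restrict B)
      (by rw [Measure.restrict_apply hE.measurableSet.compl]
          rw [show Eᶜ ∩ B = ∅ from (disjoint_compl_left.mono_right hBE).inter_eq]; simp)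
      (by simpa using hn)
    simpa [Measure.restrict_restrict hBm] using this
  have hle : minEnergy E R ≤
      weightedEnergy R ((surfaceMeasure B)⁻¹ • surfaceMeasure.restrict B) := iInf₂_le _ hmem
  rw [← minEnergy_extendField]
  refine ne_top_of_le_ne_top ?_ hle
  rw [weightedEnergy, energy_eq_mutualEnergy, mutualEnergy_smul_self, lintegral_smul_measure,
    smul_eq_mul]
  refine ENNReal.add_ne_top.2 ⟨?_, ?_⟩
  · exact ENNReal.mul_ne_top hinv (ENNReal.mul_ne_top hinv (ne_top_of_le_ne_top
      mutualEnergy_surfaceMeasure_ne_top (mutualEnergy_mono Measure.restrict_le_self)))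
  · refine ENNReal.mul_ne_top (by simp) (ENNReal.mul_ne_top hinv ?_)
    have : ∫⁻ x in B, R x ∂surfaceMeasure ≤ ∫⁻ _ in B, (n : ℝ≥0∞) ∂surfaceMeasure :=
      setLIntegral_mono measurable_const fun x hx => hx
    refine ne_top_of_le_ne_top ?_ this
    rw [setLIntegral_const]
    exact ENNReal.mul_ne_top (by simp) (measure_ne_top _ _)

/-- The constant `V_Q - ∫ Q dμ_Q`, a difference of real numbers, is `I(μ_Q) + ∫ Q dμ_Q`. -/
lemma robinConst_eq {E : Set S2} {Q : S2 → ℝ≥0∞} {μ : Measure S2}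
    (hμ : IsExtremal E Q μ) (hV : minEnergy E Q ≠ ⊤) :
    mutualEnergy μ μ ≠ ⊤ ∧ mutualEnergy μ μ + ∫⁻ x, Q x ∂μ = ENNReal.ofReal (robinConst E Q μ) ∧
      0 ≤ robinConst E Q μ := by
  have h := hV
  rw [← hμ.2, weightedEnergy, energy_eq_mutualEnergy] at h
  obtain ⟨h1, h2⟩ := ENNReal.add_ne_top.1 h
  have h3 : ∫⁻ x, Q x ∂μ ≠ ⊤ := fun h => h2 (by rw [h]; simp)
  have h4 : robinConst E Q μ = (mutualEnergy μ μ + ∫⁻ x, Q x ∂μ).toReal := by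
    rw [robinConst, ← hμ.2, weightedEnergy, energy_eq_mutualEnergy, ENNReal.toReal_add h1 h2,
      ENNReal.toReal_add h1 h3, ENNReal.toReal_mul]
    simp; ring
  refine ⟨h1, ?_, ?_⟩
  · rw [h4, ENNReal.ofReal_toReal (ENNReal.add_ne_top.2 ⟨h1, h3⟩)]
  · rw [h4]; exact ENNReal.toReal_nonneg

/-- On the support of the minimizer the potential plus the field equals the modified Robin
constant, almost everywhere for the minimizer and for surface measure. -/
theorem potential_add_field_eq {E : Set S2} (hE : IsClosed E) {Q : S2 → ℝ≥0∞}
    (hQ : IsExternalField E Q) {μ : Measure S2} (hμ : IsExtremal E Q μ) {N : Set S2}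
    (hN : IsOpen N) (hSN : μ.support ⊆ N) (hfin : ∀ x ∈ N, Q x ≠ ⊤)
    (hc : ContinuousOn (fun x => (Q x).toReal) N) :
    (∀ᵐ x ∂μ, potential μ x + Q x = ENNReal.ofReal (robinConst E Q μ)) ∧
    ∀ᵐ x ∂(surfaceMeasure.restrict μ.support),
      potential μ x + Q x = ENNReal.ofReal (robinConst E Q μ) := by
  have hμp : IsProbabilityMeasure μ := hμ.1.1
  have hV := minEnergy_ne_top hE hQ
  have hV' : minEnergy E (extendField E Q) ≠ ⊤ := by rwa [minEnergy_extendField]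
  have hμ' := isExtremal_extendField hμ
  have hR := (lowerSemicontinuous_extendField hE hQ.1).measurable
  have hμE : ∀ᵐ x ∂μ, x ∈ E := by rw [ae_iff]; exact hμ.1.2
  have hSE : μ.support ⊆ E := Measure.support_subset_of_isClosed hE hμE
  obtain ⟨_, hF, _⟩ := robinConst_eq hμ hV
  have hF' : mutualEnergy μ μ + ∫⁻ x, extendField E Q x ∂μ =
      ENNReal.ofReal (robinConst E Q μ) := by rw [lintegral_extendField Q hμ.1.2, hF]
  have h1 : ∀ᵐ x ∂μ, potential μ x + Q x = ENNReal.ofReal (robinConst E Q μ) := by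
    filter_upwards [potential_add_field_ae_eq hR hμ' hV', hμE] with x hx hxE
    rw [← hF', ← hx, extendField_of_mem hxE]
  refine ⟨h1, ?_⟩
  -- the set where the sum exceeds the constant is open and null, so it misses the support
  have hQc : ContinuousOn Q N := by
    have : ContinuousOn (fun x => ENNReal.ofReal (Q x).toReal) N :=
      ENNReal.continuous_ofReal.comp_continuousOn hc
    exact this.congr fun x hx => (ENNReal.ofReal_toReal (hfin x hx)).symm
  have hupper : ∀ x ∈ μ.support, potential μ x + Q x ≤ ENNReal.ofReal (robinConst E Q μ) := by
    intro x hx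
    by_contra hcon
    push Not at hcon
    have hev : ∀ᶠ z in nhds x, ENNReal.ofReal (robinConst E Q μ) < potential μ z + Q z := by
      have hlscQ : LowerSemicontinuousAt Q x :=
        (hQc.continuousAt (hN.mem_nhds (hSN hx))).lowerSemicontinuousAt
      exact LowerSemicontinuousAt.add ((lowerSemicontinuous_potential μ).lowerSemicontinuousAt x)
        hlscQ _ hcon
    have hpos := (Measure.mem_support_iff_forall x).1 hx _ hev
    refine hpos.ne' (measure_mono_null (fun z hz => ?_) (ae_iff.1 h1))
    exact ne_of_gt hz
  have hcomp : IsCompact μ.support := Measure.isClosed_support.isCompact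
  have hlower := le_potential_add_field hR (ρ := surfaceMeasure.restrict μ.support) hμ' hV'
    (by
      rw [Measure.restrict_apply hE.measurableSet.compl,
        (disjoint_compl_left.mono_right hSE).inter_eq, measure_empty])
    (ne_top_of_le_ne_top mutualEnergy_surfaceMeasure_ne_top
      (mutualEnergy_mono Measure.restrict_le_self))
    (by
      obtain ⟨C, hC⟩ := hcomp.exists_bound_of_continuousOn (hc.mono hSN)
      have : ∫⁻ x in μ.support, extendField E Q x ∂surfaceMeasure ≤
          ∫⁻ _ in μ.support, ENNReal.ofReal C ∂surfaceMeasure := by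
        refine setLIntegral_mono measurable_const fun x hx => ?_
        rw [extendField_of_mem (hSE hx), ← ENNReal.ofReal_toReal (hfin x (hSN hx))]
        exact ENNReal.ofReal_le_ofReal ((le_abs_self _).trans (hC x hx))
      refine ne_top_of_le_ne_top ?_ this
      rw [setLIntegral_const]
      exact ENNReal.mul_ne_top ENNReal.ofReal_ne_top (measure_ne_top _ _))
  filter_upwards [hlower, ae_restrict_mem hcomp.measurableSet] with x hx hxS
  refine le_antisymm (hupper x hxS) ?_
  rw [hF', extendField_of_mem (hSE hxS)] at hx
  exact hx

/-! ### Differentiation of Abel integrals -/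

lemma hasDerivAt_integral_comp_sin {f w : ℝ → ℝ} (hf : ContDiff ℝ 1 f) (hw : Continuous w)
    (R : ℝ) :
    HasDerivAt (fun R => ∫ τ in (0 : ℝ)..(Real.pi / 2), f (R * Real.sin τ) * w τ)
      (∫ τ in (0 : ℝ)..(Real.pi / 2), deriv f (R * Real.sin τ) * Real.sin τ * w τ) R := by
  have hfc := hf.continuous
  have hdc : Continuous (deriv f) := hf.continuous_deriv le_rfl
  have hfd : Differentiable ℝ f := hf.differentiable one_ne_zero
  obtain ⟨C, hC⟩ := (isCompact_Icc (a := -(|R| + 1)) (b := |R| + 1)).exists_bound_of_continuousOn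
    hdc.continuousOn
  refine (intervalIntegral.hasDerivAt_integral_of_dominated_loc_of_deriv_le
    (F := fun R τ => f (R * Real.sin τ) * w τ)
    (F' := fun R τ => deriv f (R * Real.sin τ) * Real.sin τ * w τ)
    (s := Metric.ball R 1) (bound := fun τ => C * |Real.sin τ * w τ|)
    (Metric.ball_mem_nhds R one_pos) (Filter.Eventually.of_forall fun R' => ?_) ?_ ?_ ?_ ?_ ?_).2
  · exact Continuous.aestronglyMeasurable (by fun_prop)
  · exact Continuous.intervalIntegrable (by fun_prop) _ _
  · exact Continuous.aestronglyMeasurable (by fun_prop)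
  · refine ae_of_all _ fun τ _ R' hR' => ?_
    have h1 : |R' * Real.sin τ| ≤ |R| + 1 := by
      rw [abs_mul]
      have h2 : |R'| ≤ |R| + 1 := by
        rw [Metric.mem_ball, Real.dist_eq] at hR'
        have := abs_sub_abs_le_abs_sub R' R
        linarith
      calc |R'| * |Real.sin τ| ≤ |R'| * 1 := by gcongr; exact Real.abs_sin_le_one τ
        _ ≤ |R| + 1 := by linarith
    rw [mul_assoc, norm_mul, Real.norm_eq_abs (Real.sin τ * w τ)]
    gcongr
    exact hC _ (abs_le.1 h1)
  · exact Continuous.intervalIntegrable (by fun_prop) _ _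
  · refine ae_of_all _ fun τ _ R' _ => ?_
    have := (hfd (R' * Real.sin τ)).hasDerivAt.comp R' ((hasDerivAt_id R').mul_const (Real.sin τ))
    simp only [one_mul] at this
    exact this.mul_const (w τ)

lemma continuous_integral_comp_sin {f w : ℝ → ℝ} (hf : Continuous f) (hw : Continuous w) :
    Continuous fun R => ∫ τ in (0 : ℝ)..(Real.pi / 2), f (R * Real.sin τ) * w τ :=
  intervalIntegral.continuous_parametric_intervalIntegral_of_continuous' (by fun_prop) _ _

/-- The quarter-circle integral `∫_0^{π/2} h'(R sin τ) dτ`: the Abel transform of the derivative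
of `z ↦ h (√z)`, freed of its singularities. -/
noncomputable def quarterIntegral (h : ℝ → ℝ) (R : ℝ) : ℝ :=
  ∫ τ in (0 : ℝ)..(Real.pi / 2), deriv h (R * Real.sin τ)

lemma continuous_quarterIntegral {h : ℝ → ℝ} (hh : ContDiff ℝ 1 h) :
    Continuous (quarterIntegral h) := by
  have := continuous_integral_comp_sin (hh.continuous_deriv le_rfl)
    (continuous_const (y := (1 : ℝ)))
  simp only [mul_one] at this
  exact this

lemma contDiff_quarterIntegral {h : ℝ → ℝ} (hh : ContDiff ℝ 2 h) :
    ContDiff ℝ 1 (quarterIntegral h) := by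
  have h1 : ContDiff ℝ 1 (deriv h) := by
    have := (contDiff_succ_iff_deriv (n := 1) (f := h) (𝕜 := ℝ)).1 (by
      simpa [one_add_one_eq_two] using hh)
    exact this.2.2
  have hd : ∀ R, HasDerivAt (quarterIntegral h)
      (∫ τ in (0 : ℝ)..(Real.pi / 2), deriv (deriv h) (R * Real.sin τ) * Real.sin τ) R :=
      fun R => by
    have := hasDerivAt_integral_comp_sin h1 (continuous_const (y := (1 : ℝ))) R
    simp only [mul_one] at this
    exact this
  rw [contDiff_one_iff_deriv]
  refine ⟨fun R => (hd R).differentiableAt, ?_⟩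
  have : deriv (quarterIntegral h) = fun R =>
      ∫ τ in (0 : ℝ)..(Real.pi / 2), deriv (deriv h) (R * Real.sin τ) * Real.sin τ :=
    funext fun R => (hd R).deriv
  rw [this]
  exact continuous_integral_comp_sin (h1.continuous_deriv le_rfl) Real.continuous_sin

/-- The desingularized Abel integral `2R ∫_0^{π/2} h(R sin τ) sin τ dτ` has derivative
`2 (h(0) + R ∫_0^{π/2} h'(R sin τ) dτ)`. -/
lemma hasDerivAt_halfIntegral {h : ℝ → ℝ} (hh : ContDiff ℝ 1 h) (R : ℝ) :
    HasDerivAt (fun R => 2 * R * ∫ τ in (0 : ℝ)..(Real.pi / 2), h (R * Real.sin τ) * Real.sin τ)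
      (2 * (h 0 + R * quarterIntegral h R)) R := by
  have hc := hh.continuous
  have hdc : Continuous (deriv h) := hh.continuous_deriv le_rfl
  have hd : Differentiable ℝ h := hh.differentiable one_ne_zero
  have h1 := (((hasDerivAt_id R).const_mul 2).mul
    (hasDerivAt_integral_comp_sin hh Real.continuous_sin R))
  refine h1.congr_deriv ?_
  -- integrate `h(R sin τ) sin τ` by parts
  have hibp : ∫ τ in (0 : ℝ)..(Real.pi / 2), (h (R * Real.sin τ) * Real.sin τ -
      R * (deriv h (R * Real.sin τ) * Real.cos τ ^ 2)) = h 0 := by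
    have := intervalIntegral.integral_eq_sub_of_hasDerivAt (a := 0) (b := Real.pi / 2)
      (f := fun τ => -(Real.cos τ) * h (R * Real.sin τ))
      (f' := fun τ => h (R * Real.sin τ) * Real.sin τ -
        R * (deriv h (R * Real.sin τ) * Real.cos τ ^ 2)) (fun τ _ => by
        have e1 := (hd (R * Real.sin τ)).hasDerivAt.comp τ ((Real.hasDerivAt_sin τ).const_mul R)
        refine ((Real.hasDerivAt_cos τ).neg.mul e1).congr_deriv ?_
        simp only [Function.comp, Pi.neg_apply]
        ring) (Continuous.intervalIntegrable (by fun_prop) _ _)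
    rw [this]
    simp
  have hi1 : IntervalIntegrable (fun τ => h (R * Real.sin τ) * Real.sin τ) volume 0
      (Real.pi / 2) := Continuous.intervalIntegrable (by fun_prop) _ _
  have hi2 : IntervalIntegrable (fun τ => R * (deriv h (R * Real.sin τ) * Real.cos τ ^ 2)) volume 0
      (Real.pi / 2) := Continuous.intervalIntegrable (by fun_prop) _ _
  have hi3 : IntervalIntegrable (fun τ => deriv h (R * Real.sin τ) * Real.cos τ ^ 2) volume 0
      (Real.pi / 2) := Continuous.intervalIntegrable (by fun_prop) _ _
  have hi4 : IntervalIntegrable (fun τ => deriv h (R * Real.sin τ) * Real.sin τ * Real.sin τ)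
      volume 0 (Real.pi / 2) := Continuous.intervalIntegrable (by fun_prop) _ _
  rw [intervalIntegral.integral_sub hi1 hi2, intervalIntegral.integral_const_mul] at hibp
  have hq : quarterIntegral h R = (∫ τ in (0 : ℝ)..(Real.pi / 2),
      deriv h (R * Real.sin τ) * Real.cos τ ^ 2) + ∫ τ in (0 : ℝ)..(Real.pi / 2),
      deriv h (R * Real.sin τ) * Real.sin τ * Real.sin τ := by
    rw [← intervalIntegral.integral_add hi3 hi4, quarterIntegral]
    refine intervalIntegral.integral_congr fun τ _ => ?_
    linear_combination (-deriv h (R * Real.sin τ)) * Real.sin_sq_add_cos_sq τ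
  rw [hq]
  simp only [id]
  linear_combination 2 * hibp

/-- A function of class `C^n` near a compact interval agrees there with one of class `C^n` on the
whole line. -/
lemma exists_contDiff_extension {n : ℕ∞} {f : ℝ → ℝ} {O : Set ℝ} (hO : IsOpen O) {a b : ℝ}
    (hab : a ≤ b) (hsub : Icc a b ⊆ O) (hf : ContDiffOn ℝ n f O) :
    ∃ g : ℝ → ℝ, ContDiff ℝ n g ∧ EqOn g f (Icc a b) := by
  obtain ⟨δ, hδ, hδO⟩ := isCompact_Icc.exists_cthickening_subset_open hO hsub
  let χ : ContDiffBump ((a + b) / 2) :=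
    ⟨(b - a) / 2 + δ / 2, (b - a) / 2 + δ, by linarith, by linarith⟩
  have hball : Metric.closedBall ((a + b) / 2) ((b - a) / 2 + δ) ⊆ O := by
    intro x hx
    rw [Real.closedBall_eq_Icc] at hx
    apply hδO
    have hx1 : a - δ ≤ x := by linarith [hx.1]
    have hx2 : x ≤ b + δ := by linarith [hx.2]
    refine Metric.mem_cthickening_of_dist_le x (max a (min b x)) δ _
      ⟨le_max_left _ _, max_le hab (min_le_left _ _)⟩ ?_
    rw [Real.dist_eq, abs_le]
    rcases le_total b x with h | h
    · rw [min_eq_left h, max_eq_right hab]; constructor <;> linarith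
    · rw [min_eq_right h]
      rcases le_total a x with h' | h'
      · rw [max_eq_right h']; constructor <;> linarith
      · rw [max_eq_left h']; constructor <;> linarith
  refine ⟨fun x => χ x * f x, ?_, fun x hx => ?_⟩
  · rw [contDiff_iff_contDiffAt]
    intro x
    by_cases hx : x ∈ O
    · exact χ.contDiff.contDiffAt.mul (hf.contDiffAt (hO.mem_nhds hx))
    · have hx' : x ∉ tsupport χ := fun h => hx (hball (by rwa [χ.tsupport_eq] at h))
      have : (fun x => χ x * f x) =ᶠ[nhds x] fun _ => 0 := by
        filter_upwards [notMem_tsupport_iff_eventuallyEq.1 hx'] with y hy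
        rw [hy]; simp
      exact contDiffAt_const.congr_of_eventuallyEq this
  · have : χ x = 1 := by
      apply χ.one_of_mem_closedBall
      rw [Real.closedBall_eq_Icc]
      change x ∈ Icc ((a + b) / 2 - ((b - a) / 2 + δ / 2)) ((a + b) / 2 + ((b - a) / 2 + δ / 2))
      exact ⟨by linarith [hx.1], by linarith [hx.2]⟩
    simp [this]

/-- The derivative of the Abel integral `∫_a^x k(s) ds / √(x - s)`. -/
noncomputable def halfDeriv (a : ℝ) (k : ℝ → ℝ) (x : ℝ) : ℝ :=
  k a / √(x - a) + ∫ s in a..x, deriv k s / √(x - s)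

lemma abel_eq_halfIntegral {a x : ℝ} (hx : a < x) (k : ℝ → ℝ) :
    ∫ s in a..x, k s / √(x - s) = 2 * √(x - a) * ∫ τ in (0 : ℝ)..(Real.pi / 2),
      k (a + (√(x - a) * Real.sin τ) ^ 2) * Real.sin τ := by
  have h := abel_sin_sq (a := a) (sub_pos.2 hx) k
  rw [add_sub_cancel] at h
  rw [h]
  simp_rw [mul_pow, Real.sq_sqrt (sub_pos.2 hx).le]

lemma abel_deriv_eq {a x : ℝ} (hx : a < x) {k : ℝ → ℝ} (hk : Differentiable ℝ k) :
    ∫ s in a..x, deriv k s / √(x - s) =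
      quarterIntegral (fun ρ => k (a + ρ ^ 2)) √(x - a) := by
  rw [abel_eq_halfIntegral hx, quarterIntegral, ← intervalIntegral.integral_const_mul]
  refine intervalIntegral.integral_congr fun τ _ => ?_
  have : HasDerivAt (fun ρ : ℝ => k (a + ρ ^ 2)) (deriv k (a + (√(x - a) * Real.sin τ) ^ 2) *
      (2 * (√(x - a) * Real.sin τ))) (√(x - a) * Real.sin τ) := by
    have e : HasDerivAt (fun ρ : ℝ => a + ρ ^ 2) (2 * (√(x - a) * Real.sin τ))
        (√(x - a) * Real.sin τ) := by
      simpa using (hasDerivAt_pow 2 (√(x - a) * Real.sin τ)).const_add a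
    exact (hk _).hasDerivAt.comp _ e
  rw [this.deriv]
  ring

/-- With `k (a + ρ²)` as a function of `ρ`, the Abel integral becomes a desingularized integral at
`√(x - a)`. -/
lemma hasDerivAt_abel_of_contDiff {a x : ℝ} (hx : a < x) {k : ℝ → ℝ} (hk : ContDiff ℝ 1 k) :
    HasDerivAt (fun x => ∫ s in a..x, k s / √(x - s)) (halfDeriv a k x) x ∧
      ContinuousAt (halfDeriv a k) x := by
  set h : ℝ → ℝ := fun ρ => k (a + ρ ^ 2) with hh
  have hhc : ContDiff ℝ 1 h := hk.comp (by fun_prop)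
  have hkd : Differentiable ℝ k := hk.differentiable one_ne_zero
  have hev : ∀ᶠ y in nhds x, a < y := Ioi_mem_nhds hx
  have hxa : 0 < x - a := sub_pos.2 hx
  have hsx : 0 < √(x - a) := Real.sqrt_pos.2 hxa
  have hD : ∀ y, a < y → halfDeriv a k y = (h 0 + √(y - a) * quarterIntegral h √(y - a)) /
      √(y - a) := fun y hy => by
    have hsy : 0 < √(y - a) := Real.sqrt_pos.2 (sub_pos.2 hy)
    rw [halfDeriv, abel_deriv_eq hy hkd, ← hh]
    simp only [hh]
    field_simp
    simp
  constructor
  · have hsq : HasDerivAt (fun x => √(x - a)) (1 / (2 * √(x - a))) x :=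
      ((hasDerivAt_id x).sub_const a).sqrt hxa.ne'
    have h1 := (hasDerivAt_halfIntegral hhc √(x - a)).comp x hsq
    refine (h1.congr_deriv ?_).congr_of_eventuallyEq ?_
    · rw [hD x hx]; field_simp
    · filter_upwards [hev] with y hy
      exact abel_eq_halfIntegral hy k
  · have hcq := continuous_quarterIntegral hhc
    have : ContinuousAt (fun y => (h 0 + √(y - a) * quarterIntegral h √(y - a)) / √(y - a)) x :=
      ContinuousAt.div (by fun_prop) (by fun_prop) hsx.ne'
    refine this.congr ?_
    filter_upwards [hev] with y hy
    exact (hD y hy).symm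

/-- The Abel integral from an interior point of the interval on which `k` is `C¹`. -/
lemma hasDerivAt_abel {l u a x : ℝ} (hla : l < a) (hax : a < x) (hxu : x < u) {k : ℝ → ℝ}
    (hk : ContDiffOn ℝ 1 k (Ioo l u)) :
    HasDerivAt (fun x => ∫ s in a..x, k s / √(x - s)) (halfDeriv a k x) x ∧
      ContinuousAt (halfDeriv a k) x := by
  obtain ⟨b, hxb, hbu⟩ := exists_between hxu
  have hab : a ≤ b := hax.le.trans hxb.le
  obtain ⟨g, hg, hgk⟩ := exists_contDiff_extension (n := 1) isOpen_Ioo hab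
    (fun y hy => ⟨hla.trans_le hy.1, hy.2.trans_lt hbu⟩) hk
  obtain ⟨h1, h2⟩ := hasDerivAt_abel_of_contDiff hax hg
  have hev : ∀ᶠ y in nhds x, y ∈ Ioo a b := Ioo_mem_nhds hax hxb
  have hder : ∀ y ∈ Ioo a b, halfDeriv a g y = halfDeriv a k y := fun y hy => by
    rw [halfDeriv, halfDeriv, hgk (left_mem_Icc.2 hab)]
    congr 1
    rw [intervalIntegral.integral_of_le hy.1.le, intervalIntegral.integral_of_le hy.1.le,
      integral_Ioc_eq_integral_Ioo, integral_Ioc_eq_integral_Ioo]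
    refine setIntegral_congr_fun measurableSet_Ioo fun s hs => ?_
    have : g =ᶠ[nhds s] k := by
      filter_upwards [Ioo_mem_nhds hs.1 (hs.2.trans hy.2)] with z hz
      exact hgk (Ioo_subset_Icc_self hz)
    simp only [this.deriv_eq]
  constructor
  · rw [hder x ⟨hax, hxb⟩] at h1
    refine h1.congr_of_eventuallyEq ?_
    filter_upwards [hev] with y hy
    refine intervalIntegral.integral_congr fun s hs => ?_
    rw [uIcc_of_le hy.1.le] at hs
    simp only [hgk ⟨hs.1, hs.2.trans hy.2.le⟩]
  · refine h2.congr ?_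
    filter_upwards [hev] with y hy
    exact hder y hy

/-! ### The transforms `g` and `F` of the field -/

/-- Half the derivative of the inner Abel integral with respect to `r = √(1 + cos t)`, for the
field `h(r)`. -/
noncomputable def innerSlope (h : ℝ → ℝ) (r : ℝ) : ℝ := h 0 + r * quarterIntegral h r

/-- The function `g` in terms of the height `s = 1 - cos t`. -/
noncomputable def heightG (h : ℝ → ℝ) (s : ℝ) : ℝ :=
  -(1 / (4 * Real.pi)) * (√s * innerSlope h √(2 - s))

lemma one_sub_cos_mem {t : ℝ} (ht : t ∈ Ioo 0 Real.pi) : 1 - Real.cos t ∈ Ioo (0 : ℝ) 2 := by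
  have h1 := Real.strictAntiOn_cos (left_mem_Icc.2 Real.pi_pos.le) (Ioo_subset_Icc_self ht) ht.1
  have h2 := Real.strictAntiOn_cos (Ioo_subset_Icc_self ht) (right_mem_Icc.2 Real.pi_pos.le) ht.2
  simp at h1 h2
  constructor <;> linarith

lemma one_sub_cos_lt {t φ : ℝ} (ht : 0 ≤ t) (htφ : t < φ) (hφ : φ ≤ Real.pi) :
    1 - Real.cos t < 1 - Real.cos φ := by
  have := Real.strictAntiOn_cos ⟨ht, htφ.le.trans hφ⟩ ⟨ht.trans htφ.le, hφ⟩ htφ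
  linarith

lemma sin_pos_Ioo {t φ : ℝ} (ht : 0 ≤ t) (hφ : φ ≤ Real.pi) :
    ∀ x ∈ Ioo t φ, 0 < Real.sin x := fun _ hx =>
  Real.sin_pos_of_pos_of_lt_pi (ht.trans_lt hx.1) (hx.2.trans_le hφ)

section

variable {h q : ℝ → ℝ} {α : ℝ}

/-- The inner Abel integral converges and is the desingularized integral at `√(1 + cos t)`. -/
lemma innerAbel_eq (hh : Continuous h) (hα : 0 ≤ α)
    (hq : ∀ ξ ∈ Icc α Real.pi, q ξ = h √(1 + Real.cos ξ)) {t : ℝ} (ht : t ∈ Ico α Real.pi) :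
    IntervalIntegrable (innerIntegrand q t) volume t Real.pi ∧
    innerAbel q t = 2 * √(1 + Real.cos t) * ∫ τ in (0 : ℝ)..(Real.pi / 2),
      h (√(1 + Real.cos t) * Real.sin τ) * Real.sin τ := by
  have ht0 : 0 ≤ t := hα.trans ht.1
  set s := 1 - Real.cos t with hs
  have hs2 : s < 2 := by
    have := one_sub_cos_lt ht0 ht.2 le_rfl
    rw [Real.cos_pi] at this; linarith
  have hc : 0 < 2 - s := by linarith
  set G : ℝ → ℝ := fun y => h √(2 - y) / √(y - s) with hG
  have hcongr : ∀ ξ ∈ Ioo t Real.pi,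
      innerIntegrand q t ξ = Real.sin ξ * G (1 - Real.cos ξ) := fun ξ hξ => by
    rw [innerIntegrand, hq ξ ⟨ht.1.trans hξ.1.le, hξ.2.le⟩, hG]
    simp only
    rw [show 2 - (1 - Real.cos ξ) = 1 + Real.cos ξ by ring,
      show 1 - Real.cos ξ - s = Real.cos t - Real.cos ξ by rw [hs]; ring]
    ring
  have hpi : 1 - Real.cos Real.pi = 2 := by rw [Real.cos_pi]; norm_num
  have hends : 1 - Real.cos t ≤ 1 - Real.cos Real.pi := by rw [hpi]; exact hs2.le
  have hderiv : ∀ x ∈ Ioo t Real.pi,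
      HasDerivAt (fun φ => 1 - Real.cos φ) (Real.sin x) x := fun x _ => hasDerivAt_one_sub_cos x
  have hcont : ContinuousOn (fun φ => 1 - Real.cos φ) (Icc t Real.pi) := by fun_prop
  -- reflect `y = 2 - z`
  have hGz : ∀ z, G (2 - z) = h √z / √(0 + (2 - s) - z) := fun z => by
    rw [hG]
    simp only
    congr 2
    · ring_nf
    · ring_nf
  have hrefl : ∀ τ ∈ uIcc 0 (Real.pi / 2), h √(0 + (2 - s) * Real.sin τ ^ 2) * Real.sin τ =
      h (√(1 + Real.cos t) * Real.sin τ) * Real.sin τ := fun τ hτ => by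
    rw [uIcc_of_le (by positivity)] at hτ
    have hsin : 0 ≤ Real.sin τ :=
      Real.sin_nonneg_of_nonneg_of_le_pi hτ.1 (by linarith [hτ.2, Real.pi_pos])
    rw [zero_add, Real.sqrt_mul hc.le, Real.sqrt_sq hsin,
      show 2 - s = 1 + Real.cos t by rw [hs]; ring]
  have hint : IntervalIntegrable (fun z => G (2 - z)) volume 0 (2 - s) := by
    simp_rw [hGz, zero_add]
    have := intervalIntegrable_abel_sin_sq (a := 0) hc (fun z => h √z)
      (Continuous.intervalIntegrable (by fun_prop) _ _)
    rwa [zero_add] at this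
  constructor
  · have h1 : IntervalIntegrable G volume (1 - Real.cos t) (1 - Real.cos Real.pi) := by
      rw [hpi, ← hs]
      have := (hint.comp_sub_left 2).symm
      simpa using this
    rw [intervalIntegrable_subst ht.2.le hcont hderiv (sin_pos_Ioo ht0 le_rfl) hends,
      intervalIntegrable_iff_integrableOn_Ioo_of_le ht.2.le] at h1
    rw [intervalIntegrable_iff_integrableOn_Ioo_of_le ht.2.le]
    exact h1.congr_fun (fun ξ hξ => (hcongr ξ hξ).symm) measurableSet_Ioo
  · have h1 := intervalIntegral_subst ht.2.le hcont hderiv (sin_pos_Ioo ht0 le_rfl) hends G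
    rw [hpi, ← hs] at h1
    have h2 : innerAbel q t = ∫ y in s..2, G y := by
      rw [h1, innerAbel, intervalIntegral.integral_of_le ht.2.le,
        intervalIntegral.integral_of_le ht.2.le, integral_Ioc_eq_integral_Ioo,
        integral_Ioc_eq_integral_Ioo]
      exact setIntegral_congr_fun measurableSet_Ioo hcongr
    have h3 : ∫ y in s..2, G y = ∫ z in (0 : ℝ)..(2 - s), G (2 - z) := by
      rw [intervalIntegral.integral_comp_sub_left]; simp
    have h4 := abel_sin_sq (a := 0) hc (fun z => h √z)
    rw [zero_add] at h4
    simp_rw [hGz, zero_add] at h3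
    rw [h2, h3, h4]
    rw [intervalIntegral.integral_congr hrefl, show 2 - s = 1 + Real.cos t by rw [hs]; ring]

lemma one_add_cos_pos {t : ℝ} (ht : t ∈ Ico 0 Real.pi) : 0 < 1 + Real.cos t := by
  have := one_sub_cos_lt ht.1 ht.2 le_rfl
  rw [Real.cos_pi] at this
  linarith

lemma hasDerivAt_innerAbel (hh : ContDiff ℝ 1 h) (hα : 0 ≤ α)
    (hq : ∀ ξ ∈ Icc α Real.pi, q ξ = h √(1 + Real.cos ξ)) {t : ℝ} (ht : t ∈ Ioo α Real.pi) :
    HasDerivAt (innerAbel q) (4 * Real.pi * heightG h (1 - Real.cos t)) t := by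
  have ht' : t ∈ Ioo 0 Real.pi := ⟨hα.trans_lt ht.1, ht.2⟩
  have hpos : 0 < 1 + Real.cos t := one_add_cos_pos ⟨ht'.1.le, ht'.2⟩
  have hpos' : 0 < 1 - Real.cos t := (one_sub_cos_mem ht').1
  have hr : HasDerivAt (fun t => √(1 + Real.cos t)) (-Real.sin t / (2 * √(1 + Real.cos t))) t :=
    ((Real.hasDerivAt_cos t).const_add 1).sqrt hpos.ne'
  have h1 := (hasDerivAt_halfIntegral hh √(1 + Real.cos t)).comp t hr
  refine (h1.congr_deriv ?_).congr_of_eventuallyEq ?_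
  · have hsin : Real.sin t = √(1 - Real.cos t) * √(1 + Real.cos t) := by
      rw [← Real.sqrt_mul hpos'.le, ← Real.sqrt_sq (Real.sin_pos_of_mem_Ioo ht').le, Real.sin_sq]
      congr 1; ring
    have hne : √(1 + Real.cos t) ≠ 0 := (Real.sqrt_pos.2 hpos).ne'
    have hpi := Real.pi_ne_zero
    rw [heightG, innerSlope, hsin, show 2 - (1 - Real.cos t) = 1 + Real.cos t by ring]
    field_simp
  · filter_upwards [Ioo_mem_nhds ht.1 ht.2] with y hy
    exact (innerAbel_eq hh.continuous hα hq ⟨hy.1.le, hy.2⟩).2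

lemma auxG_eq (hh : ContDiff ℝ 1 h) (hα : 0 ≤ α)
    (hq : ∀ ξ ∈ Icc α Real.pi, q ξ = h √(1 + Real.cos ξ)) {t : ℝ} (ht : t ∈ Ioo α Real.pi) :
    auxG q t = heightG h (1 - Real.cos t) := by
  have hpi := Real.pi_ne_zero
  rw [auxG, (hasDerivAt_innerAbel hh hα hq ht).deriv]
  field_simp

lemma continuous_innerSlope (hh : ContDiff ℝ 1 h) : Continuous (innerSlope h) := by
  have := continuous_quarterIntegral hh
  unfold innerSlope
  fun_prop

lemma contDiff_innerSlope (hh : ContDiff ℝ 2 h) : ContDiff ℝ 1 (innerSlope h) := by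
  have := contDiff_quarterIntegral hh
  unfold innerSlope
  fun_prop

lemma continuous_heightG (hh : ContDiff ℝ 1 h) : Continuous (heightG h) := by
  have := continuous_innerSlope hh
  unfold heightG
  fun_prop

lemma contDiffOn_sqrt_mul_comp {m : ℝ → ℝ} (hm : ContDiff ℝ 1 m) :
    ContDiffOn ℝ 1 (fun s => √s * m √(2 - s)) (Ioo 0 2) := by
  refine ContDiffOn.mul ?_ ?_
  · exact contDiffOn_id.sqrt fun s hs => (hs.1 : (0 : ℝ) < s).ne'
  · refine hm.comp_contDiffOn ?_
    exact (contDiffOn_const.sub contDiffOn_id).sqrt fun s hs => by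
      have := hs.2
      simp only [id]; linarith

lemma contDiffOn_heightG (hh : ContDiff ℝ 2 h) : ContDiffOn ℝ 1 (heightG h) (Ioo 0 2) :=
  contDiffOn_const.mul (contDiffOn_sqrt_mul_comp (contDiff_innerSlope hh))

/-- The outer Abel integral converges and is an Abel integral in the height. -/
lemma outerAbel_eq (hh : ContDiff ℝ 1 h) (hα : 0 ≤ α)
    (hq : ∀ ξ ∈ Icc α Real.pi, q ξ = h √(1 + Real.cos ξ)) {φ : ℝ} (hφ : φ ∈ Ioo α Real.pi) :
    IntervalIntegrable (outerIntegrand q φ) volume α φ ∧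
    outerAbel q α φ = ∫ s in (1 - Real.cos α)..(1 - Real.cos φ),
      heightG h s / √(1 - Real.cos φ - s) := by
  have hlt := one_sub_cos_lt hα hφ.1 hφ.2.le
  set G : ℝ → ℝ := fun s => heightG h s / √(1 - Real.cos φ - s) with hG
  have hcongr : ∀ t ∈ Ioo α φ, outerIntegrand q φ t = Real.sin t * G (1 - Real.cos t) :=
    fun t ht => by
      rw [outerIntegrand, auxG_eq hh hα hq ⟨ht.1, ht.2.trans hφ.2⟩, hG]
      simp only
      rw [show 1 - Real.cos φ - (1 - Real.cos t) = Real.cos t - Real.cos φ by ring]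
      ring
  have hderiv : ∀ x ∈ Ioo α φ,
      HasDerivAt (fun φ => 1 - Real.cos φ) (Real.sin x) x := fun x _ => hasDerivAt_one_sub_cos x
  have hcont : ContinuousOn (fun φ => 1 - Real.cos φ) (Icc α φ) := by fun_prop
  have hgc := continuous_heightG hh
  have hint : IntervalIntegrable G volume (1 - Real.cos α) (1 - Real.cos φ) := by
    have := intervalIntegrable_abel_sin_sq (a := 1 - Real.cos α) (sub_pos.2 hlt) (heightG h)
      (Continuous.intervalIntegrable (by fun_prop) _ _)
    rwa [add_sub_cancel] at this
  constructor
  · rw [intervalIntegrable_subst hφ.1.le hcont hderiv (sin_pos_Ioo hα hφ.2.le) hlt.le,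
      intervalIntegrable_iff_integrableOn_Ioo_of_le hφ.1.le] at hint
    rw [intervalIntegrable_iff_integrableOn_Ioo_of_le hφ.1.le]
    exact hint.congr_fun (fun ξ hξ => (hcongr ξ hξ).symm) measurableSet_Ioo
  · rw [intervalIntegral_subst hφ.1.le hcont hderiv (sin_pos_Ioo hα hφ.2.le) hlt.le, outerAbel,
      intervalIntegral.integral_of_le hφ.1.le,
      intervalIntegral.integral_of_le hφ.1.le, integral_Ioc_eq_integral_Ioo,
      integral_Ioc_eq_integral_Ioo]
    exact setIntegral_congr_fun measurableSet_Ioo hcongr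

lemma hasDerivAt_outerAbel (hh : ContDiff ℝ 2 h) (hα : 0 < α)
    (hq : ∀ ξ ∈ Icc α Real.pi, q ξ = h √(1 + Real.cos ξ)) {φ : ℝ} (hφ : φ ∈ Ioo α Real.pi) :
    HasDerivAt (outerAbel q α)
      (halfDeriv (1 - Real.cos α) (heightG h) (1 - Real.cos φ) * Real.sin φ) φ := by
  have hh1 : ContDiff ℝ 1 h := hh.of_le one_le_two
  have hαm := one_sub_cos_mem ⟨hα, hφ.1.trans hφ.2⟩
  have hφm := one_sub_cos_mem ⟨hα.trans hφ.1, hφ.2⟩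
  have h1 := (hasDerivAt_abel hαm.1 (one_sub_cos_lt hα.le hφ.1 hφ.2.le) hφm.2
    (contDiffOn_heightG hh)).1
  refine (h1.comp φ (hasDerivAt_one_sub_cos φ)).congr_of_eventuallyEq ?_
  filter_upwards [Ioo_mem_nhds hφ.1 hφ.2] with y hy
  exact (outerAbel_eq hh1 hα.le hq hy).2

lemma auxF_eq (hh : ContDiff ℝ 2 h) (hα : 0 < α)
    (hq : ∀ ξ ∈ Icc α Real.pi, q ξ = h √(1 + Real.cos ξ)) {φ : ℝ} (hφ : φ ∈ Ioo α Real.pi) :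
    auxF q α φ =
      2 / Real.pi * halfDeriv (1 - Real.cos α) (heightG h) (1 - Real.cos φ) := by
  have hsin : Real.sin φ ≠ 0 := (sin_pos_Ioo hα.le le_rfl φ hφ).ne'
  rw [auxF, (hasDerivAt_outerAbel hh hα hq hφ).deriv]
  field_simp

end

/-- Integrability of the derivative of `√s m(√(2 - s))` up to the South Pole, `s = 2`. -/
lemma intervalIntegrable_deriv_sqrt_mul_comp {m : ℝ → ℝ} (hm : ContDiff ℝ 1 m) {a : ℝ}
    (ha : 0 < a) (ha2 : a < 2) :
    IntervalIntegrable (deriv fun s => √s * m √(2 - s)) volume a 2 := by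
  have hmc := hm.continuous
  have hdc : Continuous (deriv m) := hm.continuous_deriv le_rfl
  have hd : ∀ s ∈ Ioo a 2, deriv (fun s => √s * m √(2 - s)) s =
      1 / (2 * √s) * m √(2 - s) + (-(√s * deriv m √(2 - s) / 2)) / √(a + (2 - a) - s) :=
    fun s hs => by
      have hs0 : 0 < s := ha.trans hs.1
      have hs2 : 0 < 2 - s := by linarith [hs.2]
      have e1 := Real.hasDerivAt_sqrt hs0.ne'
      have e2 : HasDerivAt (fun s => √(2 - s)) (-1 / (2 * √(2 - s))) s :=
        ((hasDerivAt_id s).const_sub 2).sqrt hs2.ne'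
      have e3 := ((hm.differentiable one_ne_zero) √(2 - s)).hasDerivAt.comp s e2
      have e4 : HasDerivAt (fun s => √s * m √(2 - s)) _ s := e1.mul e3
      rw [e4.deriv, add_sub_cancel]
      have := (Real.sqrt_pos.2 hs2).ne'
      field_simp
  rw [intervalIntegrable_iff_integrableOn_Ioo_of_le ha2.le]
  have h1 : IntervalIntegrable (fun s => 1 / (2 * √s) * m √(2 - s)) volume a 2 := by
    refine ContinuousOn.intervalIntegrable fun s hs => ?_
    rw [uIcc_of_le ha2.le] at hs
    have : 2 * √s ≠ 0 := mul_ne_zero two_ne_zero (Real.sqrt_pos.2 (ha.trans_le hs.1)).ne'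
    exact ContinuousAt.continuousWithinAt
      (ContinuousAt.mul (ContinuousAt.div (by fun_prop) (by fun_prop) this) (by fun_prop))
  have h2 := intervalIntegrable_abel_sin_sq (a := a) (sub_pos.2 ha2)
    (fun s => -(√s * deriv m √(2 - s) / 2)) (Continuous.intervalIntegrable (by fun_prop) _ _)
  -- the first term of the derivative is continuous, the second an Abel integrand at `x = 2`
  have e : a + (2 - a) = 2 := by ring
  simp only [e] at h2 hd
  have h3 := h1.add h2
  rw [intervalIntegrable_iff_integrableOn_Ioo_of_le ha2.le] at h3
  exact h3.congr_fun (fun s hs => (hd s hs).symm) measurableSet_Ioo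

/-! ### Densities obtained by half-order differentiation -/

/-- `1/π` times the half-order derivative of the function with value `κ` at `a` and derivative `J`,
extended by `0` to `x ≤ a`. -/
noncomputable def halfDensity (a : ℝ) (κ : ℝ≥0∞) (J : ℝ → ℝ≥0∞) : ℝ → ℝ≥0∞ :=
  (Ioi a).indicator fun x =>
    ENNReal.ofReal (1 / Real.pi) * (κ * invSqrt (x - a) + abelTransform a J x)

lemma inv_pi_mul_pi : ENNReal.ofReal (1 / Real.pi) * ENNReal.ofReal Real.pi = 1 := by
  have := Real.pi_pos
  rw [← ENNReal.ofReal_mul (by positivity), one_div_mul_cancel this.ne', ENNReal.ofReal_one]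

section HalfDensity

variable {a : ℝ} {κ : ℝ≥0∞} {J : ℝ → ℝ≥0∞}

lemma measurable_halfDensity (hJ : Measurable J) : Measurable (halfDensity a κ J) := by
  have := measurable_abelTransform a hJ
  exact Measurable.indicator (by fun_prop) measurableSet_Ioi

/-- The Abel transform inverts half-order differentiation. -/
lemma abelTransform_halfDensity (ha : 0 ≤ a) (hJ : Measurable J) {s : ℝ} (hs : a < s) :
    abelTransform 0 (halfDensity a κ J) s = κ + ∫⁻ y in Ioo a s, J y := by
  have hm := measurable_abelTransform a hJ
  have h1 : abelTransform 0 (halfDensity a κ J) s = abelTransform a (fun x =>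
      ENNReal.ofReal (1 / Real.pi) * (κ * invSqrt (x - a) + abelTransform a J x)) s := by
    rw [abelTransform, abelTransform]
    have : ∀ y, invSqrt (s - y) * halfDensity a κ J y = (Ioi a).indicator (fun y =>
        invSqrt (s - y) * (ENNReal.ofReal (1 / Real.pi) *
          (κ * invSqrt (y - a) + abelTransform a J y))) y := fun y => by
      by_cases hy : y ∈ Ioi a
      · rw [halfDensity, indicator_of_mem hy, indicator_of_mem hy]
      · rw [halfDensity, indicator_of_notMem hy, indicator_of_notMem hy, mul_zero]
    simp_rw [this]
    rw [setLIntegral_indicator measurableSet_Ioi, inter_eq_left.2 (Ioi_subset_Ioi ha)]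
  have h2 : ∀ y, invSqrt (s - y) * (ENNReal.ofReal (1 / Real.pi) *
      (κ * invSqrt (y - a) + abelTransform a J y)) = ENNReal.ofReal (1 / Real.pi) *
      (κ * (invSqrt (s - y) * invSqrt (y - a)) + invSqrt (s - y) * abelTransform a J y) :=
    fun y => by ring
  rw [h1, abelTransform]
  simp_rw [h2]
  rw [lintegral_const_mul _ (by fun_prop), lintegral_add_left (by fun_prop),
    lintegral_const_mul _ (by fun_prop)]
  have h3 := abelTransform_invSqrt hs
  have h4 := abelTransform_abelTransform a hJ s
  rw [abelTransform] at h3 h4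
  rw [h3, h4, mul_comm κ, ← mul_add, ← mul_assoc, inv_pi_mul_pi, one_mul]

lemma lintegral_halfDensity_le (ha : 0 ≤ a) (ha2 : a < 2) (hJ : Measurable J) :
    ∫⁻ y in Ioo 0 2, halfDensity a κ J y ≤
      ENNReal.ofReal √2 * (κ + ∫⁻ y in Ioo a 2, J y) := by
  have hm := measurable_halfDensity (a := a) (κ := κ) hJ
  rw [← abelTransform_halfDensity ha hJ ha2, abelTransform_eq_Ioo,
    ← lintegral_const_mul _ (by fun_prop)]
  refine setLIntegral_mono_ae' measurableSet_Ioo (ae_of_all _ fun y hy => ?_)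
  have : (1 : ℝ≥0∞) ≤ ENNReal.ofReal √2 * invSqrt (2 - y) := by
    have h2y : 0 < 2 - y := by linarith [hy.2]
    rw [← invSqrt_mul_ofReal_sqrt h2y, mul_comm]
    gcongr
    linarith [hy.1]
  calc halfDensity a κ J y = 1 * halfDensity a κ J y := (one_mul _).symm
    _ ≤ _ := by rw [← mul_assoc]; gcongr

/-- The potential of a half-order derivative is a single Abel integral. -/
lemma potential_halfDensity (ha : 0 ≤ a) (hJ : Measurable J) {θ φ : ℝ} (hφ : φ ∈ Ioo 0 Real.pi)
    (hx : a ≤ 1 - Real.cos φ) :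
    potential (surfaceMeasure.withDensity fun x => halfDensity a κ J (height x)) (sph θ φ) =
      2 * ∫⁻ s in Ioo (1 - Real.cos φ) 2,
        latWeight (1 - Real.cos φ) s * (κ + ∫⁻ y in Ioo a s, J y) := by
  rw [potential_withDensity_height (measurable_halfDensity hJ) hφ, lintegral_latWeight_mul]
  congr 1
  refine setLIntegral_congr_fun measurableSet_Ioo fun s hs => ?_
  rw [abelTransform_halfDensity ha hJ (hx.trans_lt hs.1)]

lemma invSqrt_anti {u v : ℝ} (hu : 0 < u) (huv : u ≤ v) : invSqrt v ≤ invSqrt u := by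
  unfold invSqrt
  have := Real.sqrt_pos.2 hu
  gcongr

lemma potential_halfDensity_le (ha : 0 < a) (hJ : Measurable J) {θ φ : ℝ}
    (hφ : φ ∈ Ioo 0 Real.pi) (hx : a ≤ 1 - Real.cos φ) :
    potential (surfaceMeasure.withDensity fun x => halfDensity a κ J (height x)) (sph θ φ) ≤
      2 * ((invSqrt a * (κ + ∫⁻ y in Ioo a 2, J y)) * ENNReal.ofReal Real.pi) := by
  rw [potential_halfDensity ha.le hJ hφ hx, ← lintegral_latWeight_mul]
  gcongr
  refine lintegral_latWeight_mul_le (one_sub_cos_mem hφ).2 fun s hs => ?_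
  have := hx.trans_lt hs.1
  refine mul_le_mul' (invSqrt_anti ha this.le) ?_
  gcongr
  exact hs.2.le

end HalfDensity

/-- `1/π` times the half-order derivative of `k`, with the value at `a` and the derivative of `k`
replaced by their positive parts. -/
noncomputable def posDensity (a : ℝ) (k : ℝ → ℝ) : ℝ → ℝ≥0∞ :=
  halfDensity a (ENNReal.ofReal (k a)) fun s => ENNReal.ofReal (deriv k s)

/-- The sum of the positive part of `k a` and the integral of the positive part of `k'` over
`(a, s)`; its half-order derivative is `π` times `posDensity`. -/
noncomputable def posPart (a : ℝ) (k : ℝ → ℝ) (s : ℝ) : ℝ≥0∞ :=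
  ENNReal.ofReal (k a) + ∫⁻ y in Ioo a s, ENNReal.ofReal (deriv k y)

lemma measurable_posDensity (a : ℝ) (k : ℝ → ℝ) : Measurable (posDensity a k) :=
  measurable_halfDensity (by fun_prop)

lemma measurable_posPart (a : ℝ) (k : ℝ → ℝ) : Measurable (posPart a k) := by
  refine Monotone.measurable fun s t hst => ?_
  unfold posPart
  gcongr

lemma posPart_ne_top {a b : ℝ} {k : ℝ → ℝ} (hab : a ≤ b)
    (hk : IntervalIntegrable (deriv k) volume a b) {s : ℝ} (hs : s ≤ b) :
    posPart a k s ≠ ⊤ := by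
  refine ENNReal.add_ne_top.2 ⟨ENNReal.ofReal_ne_top, ?_⟩
  rw [intervalIntegrable_iff_integrableOn_Ioo_of_le hab] at hk
  have : ∫⁻ y in Ioo a s, ENNReal.ofReal (deriv k y) ≤ ∫⁻ y in Ioo a b, ‖deriv k y‖ₑ := by
    refine (lintegral_mono_set (Ioo_subset_Ioo_right hs)).trans (lintegral_mono fun y => ?_)
    exact Real.ofReal_le_enorm _
  exact ne_top_of_le_ne_top hk.2.ne this

lemma toReal_ofReal_sub (r : ℝ) : (ENNReal.ofReal r).toReal - (ENNReal.ofReal (-r)).toReal = r := by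
  rw [ENNReal.toReal_ofReal', ENNReal.toReal_ofReal']
  rcases le_total r 0 with h | h
  · rw [max_eq_right h, max_eq_left (by linarith)]; ring
  · rw [max_eq_left h, max_eq_right (by linarith)]; ring

lemma deriv_fun_neg (k : ℝ → ℝ) (s : ℝ) : deriv (fun s => -k s) s = -deriv k s := deriv.fun_neg

/-- The functions belonging to `k` and `-k` differ by `k`. -/
lemma posPart_sub {a b : ℝ} {k : ℝ → ℝ} (hc : ContinuousOn k (Icc a b))
    (hd : ∀ s ∈ Ioo a b, DifferentiableAt ℝ k s)
    (hk : IntervalIntegrable (deriv k) volume a b) {s : ℝ} (hs : s ∈ Icc a b) :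
    (posPart a k s).toReal - (posPart a (fun s => -k s) s).toReal = k s := by
  have hab := hs.1.trans hs.2
  have hk' : IntervalIntegrable (deriv fun s => -k s) volume a b := by
    have : (deriv fun s => -k s) = fun s => -deriv k s := funext (deriv_fun_neg k)
    rw [this]; exact hk.neg
  have f1 := ENNReal.add_ne_top.1 (posPart_ne_top hab hk hs.2)
  have f2 := ENNReal.add_ne_top.1 (posPart_ne_top hab hk' hs.2)
  have hks : IntervalIntegrable (deriv k) volume a s :=
    hk.mono_set (by rw [uIcc_of_le hs.1, uIcc_of_le hab]; exact Icc_subset_Icc_right hs.2)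
  have hftc : ∫ y in a..s, deriv k y = k s - k a :=
    intervalIntegral.integral_eq_sub_of_hasDerivAt_of_le hs.1
      (hc.mono (Icc_subset_Icc_right hs.2))
      (fun y hy => (hd y ⟨hy.1, hy.2.trans_le hs.2⟩).hasDerivAt) hks
  have hks' := hks
  rw [intervalIntegrable_iff_integrableOn_Ioo_of_le hs.1] at hks'
  rw [intervalIntegral.integral_of_le hs.1, integral_Ioc_eq_integral_Ioo,
    integral_eq_lintegral_pos_part_sub_lintegral_neg_part hks'] at hftc
  rw [posPart, posPart, ENNReal.toReal_add f1.1 f1.2, ENNReal.toReal_add f2.1 f2.2]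
  simp_rw [deriv_fun_neg]
  linarith [toReal_ofReal_sub (k a)]

/-- The difference of the densities belonging to `k` and `-k` is `1/π` times the half-order
derivative. -/
lemma posDensity_sub {a x : ℝ} (hax : a < x) {k : ℝ → ℝ}
    (hk : IntervalIntegrable (fun s => deriv k s / √(x - s)) volume a x) :
    posDensity a k x ≠ ⊤ ∧
    (posDensity a k x).toReal - (posDensity a (fun s => -k s) x).toReal =
      1 / Real.pi * halfDeriv a k x := by
  have hpi := Real.pi_pos
  rw [intervalIntegrable_iff_integrableOn_Ioo_of_le hax.le] at hk
  have habel : ∀ k : ℝ → ℝ, abelTransform a (fun s => ENNReal.ofReal (deriv k s)) x =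
      ∫⁻ s in Ioo a x, ENNReal.ofReal (deriv k s / √(x - s)) := fun k => by
    rw [abelTransform_eq_Ioo]
    refine lintegral_congr fun s => ?_
    rw [invSqrt, ← ENNReal.ofReal_mul (by positivity)]
    congr 1; ring
  have hfin : ∀ k : ℝ → ℝ, IntegrableOn (fun s => deriv k s / √(x - s)) (Ioo a x) →
      abelTransform a (fun s => ENNReal.ofReal (deriv k s)) x ≠ ⊤ := fun k hk => by
    rw [habel]
    exact ne_top_of_le_ne_top hk.2.ne (lintegral_mono fun y => Real.ofReal_le_enorm _)
  have hk' : IntegrableOn (fun s => deriv (fun s => -k s) s / √(x - s)) (Ioo a x) := by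
    simp_rw [deriv_fun_neg, neg_div]
    exact hk.neg
  have hval : ∀ k : ℝ → ℝ, posDensity a k x = ENNReal.ofReal (1 / Real.pi) *
      (ENNReal.ofReal (k a) * invSqrt (x - a) +
        abelTransform a (fun s => ENNReal.ofReal (deriv k s)) x) := fun k => by
    rw [posDensity, halfDensity, indicator_of_mem (mem_Ioi.2 hax)]
  have hfin1 : ∀ k : ℝ → ℝ, ENNReal.ofReal (k a) * invSqrt (x - a) ≠ ⊤ := fun k =>
    ENNReal.mul_ne_top ENNReal.ofReal_ne_top (invSqrt_ne_top _)
  have hint := integral_eq_lintegral_pos_part_sub_lintegral_neg_part hk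
  constructor
  · rw [hval]
    exact ENNReal.mul_ne_top ENNReal.ofReal_ne_top (ENNReal.add_ne_top.2 ⟨hfin1 k, hfin k hk⟩)
  · rw [hval, hval, ENNReal.toReal_mul, ENNReal.toReal_mul,
      ENNReal.toReal_add (hfin1 k) (hfin k hk),
      ENNReal.toReal_add (hfin1 fun s => -k s) (hfin _ hk'), habel, habel,
      ENNReal.toReal_mul, ENNReal.toReal_mul, ENNReal.toReal_ofReal (by positivity), halfDeriv,
      intervalIntegral.integral_of_le hax.le, integral_Ioc_eq_integral_Ioo, hint]
    have h1 : (invSqrt (x - a)).toReal = 1 / √(x - a) := ENNReal.toReal_ofReal (by positivity)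
    simp_rw [deriv_fun_neg, neg_div]
    rw [h1]
    have h2 := toReal_ofReal_sub (k a)
    linear_combination 1 / Real.pi * (1 / √(x - a)) * h2

/-- The integral in `halfDeriv` converges. -/
lemma intervalIntegrable_deriv_div_sqrt {a x u : ℝ} (hl : 0 < a) (hax : a < x) (hxu : x < u)
    {k : ℝ → ℝ} (hk : ContDiffOn ℝ 1 k (Ioo 0 u)) :
    IntervalIntegrable (fun s => deriv k s / √(x - s)) volume a x := by
  have hdc : ContinuousOn (deriv k) (Ioo 0 u) := hk.continuousOn_deriv_of_isOpen isOpen_Ioo le_rfl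
  have hmap : ∀ τ, a + (x - a) * Real.sin τ ^ 2 ∈ Ioo 0 u := fun τ => by
    have h1 := Real.sin_sq_le_one τ
    have h2 := sq_nonneg (Real.sin τ)
    have h3 : 0 < x - a := sub_pos.2 hax
    constructor <;> nlinarith
  have hc : Continuous fun τ => deriv k (a + (x - a) * Real.sin τ ^ 2) :=
    hdc.comp_continuous (by fun_prop) hmap
  have := intervalIntegrable_abel_sin_sq (a := a) (sub_pos.2 hax) (deriv k)
    (Continuous.intervalIntegrable (by fun_prop) _ _)
  rwa [add_sub_cancel] at this

/-- The difference of the potentials of the densities belonging to `k` and `-k`, as an integral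
against `k`. -/
lemma potential_posDensity_sub {a : ℝ} (ha : 0 < a) (ha2 : a < 2) {k : ℝ → ℝ}
    (hc : ContinuousOn k (Icc a 2)) (hd : ∀ s ∈ Ioo a 2, DifferentiableAt ℝ k s)
    (hk : IntervalIntegrable (deriv k) volume a 2) {θ φ : ℝ} (hφ : φ ∈ Ioo 0 Real.pi)
    (hx : a ≤ 1 - Real.cos φ) :
    potential (surfaceMeasure.withDensity fun x => posDensity a k (height x)) (sph θ φ) ≠ ⊤ ∧
    (potential (surfaceMeasure.withDensity fun x => posDensity a k (height x))
        (sph θ φ)).toReal -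
      (potential (surfaceMeasure.withDensity fun x => posDensity a (fun s => -k s) (height x))
        (sph θ φ)).toReal =
      2 * ∫ s in (1 - Real.cos φ)..2,
        1 / √s * (1 / √(2 - s)) * (1 / √(s - (1 - Real.cos φ))) * k s := by
  set x := 1 - Real.cos φ with hxdef
  have hx2 : x < 2 := (one_sub_cos_mem hφ).2
  have hk' : IntervalIntegrable (deriv fun s => -k s) volume a 2 := by
    have : (deriv fun s => -k s) = fun s => -deriv k s := funext (deriv_fun_neg k)
    rw [this]; exact hk.neg
  have hU : ∀ k : ℝ → ℝ, potential (surfaceMeasure.withDensity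
      fun x => posDensity a k (height x)) (sph θ φ) =
      2 * ∫⁻ s in Ioo x 2, latWeight x s * posPart a k s := fun k =>
    potential_halfDensity ha.le (by fun_prop) hφ hx
  have hfin : ∀ k : ℝ → ℝ, IntervalIntegrable (deriv k) volume a 2 → potential
      (surfaceMeasure.withDensity fun x => posDensity a k (height x)) (sph θ φ) ≠ ⊤ :=
    fun k hk => by
      refine ne_top_of_le_ne_top ?_ (potential_halfDensity_le ha (by fun_prop) hφ hx)
      exact ENNReal.mul_ne_top (by simp) (ENNReal.mul_ne_top (ENNReal.mul_ne_top
        (invSqrt_ne_top a) (posPart_ne_top ha2.le hk le_rfl)) ENNReal.ofReal_ne_top)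
  have hmeas : ∀ k : ℝ → ℝ, Measurable fun s => latWeight x s * posPart a k s := fun k => by
    have := measurable_posPart a k
    have hlm : Measurable (latWeight x) := by unfold latWeight; fun_prop
    exact hlm.mul this
  have hfin' : ∀ k : ℝ → ℝ, IntervalIntegrable (deriv k) volume a 2 →
      ∫⁻ s in Ioo x 2, latWeight x s * posPart a k s ≠ ⊤ := fun k hk h => by
    apply hfin k hk
    rw [hU, h]; simp
  have hlw : ∀ s, (latWeight x s).toReal = 1 / √s * (1 / √(2 - s)) * (1 / √(s - x)) := fun s => by
    rw [latWeight, ENNReal.toReal_mul, ENNReal.toReal_mul, invSqrt, invSqrt, invSqrt,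
      ENNReal.toReal_ofReal (by positivity), ENNReal.toReal_ofReal (by positivity),
      ENNReal.toReal_ofReal (by positivity)]
  have hreal : ∀ k : ℝ → ℝ, IntervalIntegrable (deriv k) volume a 2 →
      IntegrableOn (fun s => (latWeight x s * posPart a k s).toReal) (Ioo x 2) ∧
      ∫ s in Ioo x 2, (latWeight x s * posPart a k s).toReal =
        (∫⁻ s in Ioo x 2, latWeight x s * posPart a k s).toReal := fun k hk =>
    ⟨integrable_toReal_of_lintegral_ne_top (hmeas k).aemeasurable (hfin' k hk),
      integral_toReal (hmeas k).aemeasurable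
        (ae_lt_top (hmeas k) (hfin' k hk))⟩
  refine ⟨hfin k hk, ?_⟩
  rw [hU, hU, ENNReal.toReal_mul, ENNReal.toReal_mul, ← (hreal k hk).2, ← (hreal _ hk').2,
    ← mul_sub, ← integral_sub (hreal k hk).1 (hreal _ hk').1,
    intervalIntegral.integral_of_le hx2.le, integral_Ioc_eq_integral_Ioo]
  congr 1
  refine setIntegral_congr_fun measurableSet_Ioo fun s hs => ?_
  rw [ENNReal.toReal_mul, ENNReal.toReal_mul, ← mul_sub,
    posPart_sub hc hd hk ⟨hx.trans hs.1.le, hs.2.le⟩, hlw]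

/-- `halfDeriv` is integrable up to the South Pole, because the two densities are. -/
lemma integrableOn_halfDeriv {a : ℝ} (ha : 0 < a) (ha2 : a < 2) {k : ℝ → ℝ}
    (hkc : ContDiffOn ℝ 1 k (Ioo 0 2)) (hk : IntervalIntegrable (deriv k) volume a 2) :
    IntegrableOn (halfDeriv a k) (Ioo a 2) := by
  have hk' : IntervalIntegrable (deriv fun s => -k s) volume a 2 := by
    have : (deriv fun s => -k s) = fun s => -deriv k s := funext (deriv_fun_neg k)
    rw [this]; exact hk.neg
  have hi : ∀ k : ℝ → ℝ, IntervalIntegrable (deriv k) volume a 2 →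
      IntegrableOn (fun x => (posDensity a k x).toReal) (Ioo a 2) := fun k hk => by
    refine integrable_toReal_of_lintegral_ne_top (measurable_posDensity a k).aemeasurable ?_
    have h1 : ∫⁻ y in Ioo a 2, posDensity a k y ≤ ∫⁻ y in Ioo 0 2, posDensity a k y :=
      lintegral_mono_set (Ioo_subset_Ioo_left ha.le)
    refine ne_top_of_le_ne_top ?_ (h1.trans (lintegral_halfDensity_le ha.le ha2 (by fun_prop)))
    exact ENNReal.mul_ne_top ENNReal.ofReal_ne_top (posPart_ne_top ha2.le hk le_rfl)
  refine IntegrableOn.congr_fun (f := fun x => Real.pi * ((posDensity a k x).toReal -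
    (posDensity a (fun s => -k s) x).toReal)) (((hi k hk).sub (hi _ hk')).const_mul Real.pi)
    (fun x hx => ?_) measurableSet_Ioo
  have := (posDensity_sub hx.1 (intervalIntegrable_deriv_div_sqrt ha hx.1 hx.2 hkc)).2
  have hpi := Real.pi_ne_zero
  simp only
  rw [this]
  field_simp

/-! ### Solution of the integral equation on the cap -/

/-- The function whose half-order derivative, divided by `π`, is the density with potential
`c - h(√(2 - x))` at height `x`. -/
noncomputable def capSource (h : ℝ → ℝ) (c s : ℝ) : ℝ :=
  √s / (2 * Real.pi) * (c - innerSlope h √(2 - s))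

lemma integral_deriv_sqrt {h : ℝ → ℝ} (hh : ContDiff ℝ 1 h) {Z : ℝ} (hZ : 0 < Z) :
    IntervalIntegrable (fun z => deriv h √z / (2 * √z)) volume 0 Z ∧
    ∫ z in (0 : ℝ)..Z, deriv h √z / (2 * √z) = h √Z - h 0 := by
  have hdc : Continuous (deriv h) := hh.continuous_deriv le_rfl
  have h1 : IntervalIntegrable (fun z : ℝ => 1 / (2 * √z)) volume 0 Z := by
    rw [intervalIntegrable_iff_integrableOn_Ioc_of_le hZ.le]
    exact intervalIntegral.integrableOn_deriv_of_nonneg (g := Real.sqrt)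
      Real.continuous_sqrt.continuousOn
      (fun x hx => Real.hasDerivAt_sqrt hx.1.ne') (fun x _ => by positivity)
  have h2 : IntervalIntegrable (fun z => deriv h √z / (2 * √z)) volume 0 Z := by
    have := h1.continuousOn_mul (g := fun z => deriv h √z) (by fun_prop)
    refine this.congr ?_
    exact fun z _ => by ring
  refine ⟨h2, ?_⟩
  have := intervalIntegral.integral_eq_sub_of_hasDerivAt_of_le hZ.le
    (f := fun z => h √z) (f' := fun z => deriv h √z / (2 * √z))
    (hh.continuous.comp Real.continuous_sqrt).continuousOn (fun x hx => by
      have := ((hh.differentiable one_ne_zero) √x).hasDerivAt.comp x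
        (Real.hasDerivAt_sqrt hx.1.ne')
      refine this.congr_deriv ?_
      ring) h2
  rw [this]; simp

lemma quarterIntegral_eq_abel (h : ℝ → ℝ) {y : ℝ} (hy : 0 < y) :
    quarterIntegral h √y = ∫ s in (0 : ℝ)..y, deriv h √s / (2 * √s) / √(y - s) := by
  have h1 := abel_sin_sq (a := 0) hy (fun s => deriv h √s / (2 * √s))
  have hpi := Real.pi_pos
  simp only [zero_add] at h1
  rw [h1, quarterIntegral, ← intervalIntegral.integral_const_mul,
    intervalIntegral.integral_of_le (by positivity),
    intervalIntegral.integral_of_le (by positivity),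
    integral_Ioc_eq_integral_Ioo, integral_Ioc_eq_integral_Ioo]
  refine setIntegral_congr_fun measurableSet_Ioo fun τ hτ => ?_
  have hs := (sin_pos_cos_pos hτ).1
  have hsy := Real.sqrt_pos.2 hy
  rw [Real.sqrt_mul hy.le, Real.sqrt_sq hs.le]
  field_simp

/-- The Abel transform of `quarterIntegral h √z`, itself an Abel transform, recovers `h`. -/
lemma integral_quarterIntegral {h : ℝ → ℝ} (hh : ContDiff ℝ 1 h) {Z : ℝ} (hZ : 0 < Z) :
    ∫ z in (0 : ℝ)..Z, quarterIntegral h √z / √(Z - z) = Real.pi * (h √Z - h 0) := by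
  obtain ⟨h1, h2⟩ := integral_deriv_sqrt hh hZ
  rw [← h2, ← abel_abel hZ.le h1, intervalIntegral.integral_of_le hZ.le,
    intervalIntegral.integral_of_le hZ.le, integral_Ioc_eq_integral_Ioo,
    integral_Ioc_eq_integral_Ioo]
  refine setIntegral_congr_fun measurableSet_Ioo fun y hy => ?_
  rw [quarterIntegral_eq_abel h hy.1]

/-- `capSource` solves the Abel equation that remains once the transform of the density is known:
integrated against the weight of the latitudes it gives the potential `c - h(√(2 - x))`. -/
lemma integral_latWeight_capSource {h : ℝ → ℝ} (hh : ContDiff ℝ 1 h) (c : ℝ) {x : ℝ} (hx : 0 < x)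
    (hx2 : x < 2) :
    2 * ∫ s in x..2, 1 / √s * (1 / √(2 - s)) * (1 / √(s - x)) * capSource h c s =
      c - h √(2 - x) := by
  have hZ : 0 < 2 - x := by linarith
  have hpi := Real.pi_pos
  set Z := 2 - x with hZdef
  have h1 : ∫ s in x..2, 1 / √s * (1 / √(2 - s)) * (1 / √(s - x)) * capSource h c s =
      ∫ z in (0 : ℝ)..Z, ((c - h 0) / (2 * Real.pi) * (1 / √(Z - z) * (1 / √(z - 0))) -
        1 / (2 * Real.pi) * (quarterIntegral h √z / √(Z - z))) := by
    have := intervalIntegral.integral_comp_sub_left (a := 0) (b := Z)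
      (fun s => 1 / √s * (1 / √(2 - s)) * (1 / √(s - x)) * capSource h c s) 2
    rw [hZdef, sub_zero, sub_sub_cancel] at this
    rw [← this, intervalIntegral.integral_of_le hZ.le, intervalIntegral.integral_of_le hZ.le,
      integral_Ioc_eq_integral_Ioo, integral_Ioc_eq_integral_Ioo]
    refine setIntegral_congr_fun measurableSet_Ioo fun z hz => ?_
    have hz0 : 0 < z := hz.1
    have hz2 : 0 < 2 - z := by linarith [hz.2]
    have e1 := (Real.sqrt_pos.2 hz0).ne'
    have e2 := (Real.sqrt_pos.2 hz2).ne'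
    have e3 : √(Z - z) ≠ 0 := (Real.sqrt_pos.2 (by linarith [hz.2])).ne'
    simp only [capSource, innerSlope]
    rw [sub_sub_cancel, show 2 - z - x = Z - z by rw [hZdef]; ring, sub_zero]
    field_simp
    ring
  have hb := integral_beta (a := 0) (s := 0) le_rfl hZ
  have i1 : IntervalIntegrable (fun z => 1 / √(Z - z) * (1 / √(z - 0))) volume 0 Z := by
    rw [intervalIntegrable_iff_integrableOn_Ioo_of_le hZ.le]; exact hb.1
  have i2 : IntervalIntegrable (fun z => quarterIntegral h √z / √(Z - z)) volume 0 Z := by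
    have hq := continuous_quarterIntegral hh
    have := intervalIntegrable_abel_sin_sq (a := 0) hZ (fun z => quarterIntegral h √z)
      (Continuous.intervalIntegrable (by fun_prop) _ _)
    simpa only [zero_add] using this
  rw [h1, intervalIntegral.integral_sub (i1.const_mul _) (i2.const_mul _),
    intervalIntegral.integral_const_mul, intervalIntegral.integral_const_mul,
    integral_quarterIntegral hh hZ, intervalIntegral.integral_of_le hZ.le,
    integral_Ioc_eq_integral_Ioo, hb.2]
  field_simp
  ring

/-! ### The external field as a function of the height -/

/-- The meridian of azimuth `0` is smooth as a map into the sphere. -/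
lemma contMDiff_meridian : ContMDiff 𝓘(ℝ, ℝ) (𝓡 2) 2 (fun φ : ℝ => sph 0 φ) := by
  have h : ContDiff ℝ 2 (fun φ : ℝ =>
      (!₂[Real.sin φ * Real.cos 0, Real.sin φ * Real.sin 0, Real.cos φ] :
        EuclideanSpace ℝ (Fin 3))) := by
    rw [contDiff_euclidean]
    intro i
    fin_cases i <;> simp <;> fun_prop
  exact ContMDiff.codRestrict_sphere h.contMDiff _

lemma sph_mem_capS {α θ φ : ℝ} (hα : 0 ≤ α) (hφ : φ ∈ Icc α Real.pi) : sph θ φ ∈ capS α := by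
  rw [capS, mem_ofPred_eq, polarAngle_sph ⟨hα.trans hφ.1, hφ.2⟩]
  exact hφ

lemma contDiffOn_profile {Q : S2 → ℝ≥0∞} {N : Set S2}
    (hC2 : ContMDiffOn (𝓡 2) 𝓘(ℝ, ℝ) 2 (fun x : S2 => (Q x).toReal) N) :
    ContDiffOn ℝ 2 (profile Q) ((fun φ : ℝ => sph 0 φ) ⁻¹' N) := by
  rw [← contMDiffOn_iff_contDiffOn]
  exact hC2.comp contMDiff_meridian.contMDiffOn fun φ hφ => hφ

lemma contDiffOn_two_mul_arccos :
    ContDiffOn ℝ 2 (fun ρ => 2 * Real.arccos (ρ / √2)) (Ioo (-√2) √2) := by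
  have h2 : (0 : ℝ) < √2 := by positivity
  intro ρ hρ
  have h1 : ρ / √2 ≠ -1 := by
    have := hρ.1
    rw [Ne, div_eq_iff h2.ne']
    linarith
  have h3 : ρ / √2 ≠ 1 := by
    have := hρ.2
    rw [Ne, div_eq_iff h2.ne']
    linarith
  have h4 : ContDiffAt ℝ 2 (fun ρ => Real.arccos (ρ / √2)) ρ :=
    ContDiffAt.comp (g := Real.arccos) ρ (Real.contDiffAt_arccos h1 h3)
      (contDiff_id.div_const _).contDiffAt
  exact (contDiffAt_const.mul h4).contDiffWithinAt

/-- On the cap, a `C²` field is a `C²` function of `√(1 + cos φ)`, which is the distance to the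
South Pole divided by `√2`. This function may be taken to be `C²` on the whole line. -/
lemma exists_profile_extension {Q : S2 → ℝ≥0∞} {N : Set S2} (hN : IsOpen N) {α : ℝ} (hα : 0 < α)
    (hαπ : α ≤ Real.pi) (hcap : capS α ⊆ N)
    (hC2 : ContMDiffOn (𝓡 2) 𝓘(ℝ, ℝ) 2 (fun x : S2 => (Q x).toReal) N) :
    ∃ h : ℝ → ℝ, ContDiff ℝ 2 h ∧
      ∀ ξ ∈ Icc α Real.pi, profile Q ξ = h √(1 + Real.cos ξ) := by
  have hp := Real.pi_pos
  have h2 : (0 : ℝ) < √2 := by positivity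
  have hO₁o : IsOpen ((fun φ : ℝ => sph 0 φ) ⁻¹' N) := hN.preimage
    (continuous_sph.comp (by fun_prop : Continuous fun φ : ℝ => ((0 : ℝ), φ)))
  have hprof := contDiffOn_profile hC2
  generalize hO₁ : (fun φ : ℝ => sph 0 φ) ⁻¹' N = O₁ at hO₁o hprof
  -- `w` inverts `ξ ↦ √(1 + cos ξ) = √2 cos (ξ / 2)`
  set w : ℝ → ℝ := fun ρ => 2 * Real.arccos (ρ / √2) with hw
  have hwc : Continuous w := by
    have := Real.continuous_arccos
    fun_prop
  set O : Set ℝ := Ioo (-√2) √2 ∩ w ⁻¹' O₁ with hO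
  have hOo : IsOpen O := isOpen_Ioo.inter (hO₁o.preimage hwc)
  have hcos : ∀ ξ ∈ Icc α Real.pi, √(1 + Real.cos ξ) = √2 * Real.cos (ξ / 2) := by
    intro ξ hξ
    rw [Real.cos_half (by linarith [hξ.1]) hξ.2, ← Real.sqrt_mul (by norm_num)]
    congr 1
    ring
  have hwcos : ∀ ξ ∈ Icc α Real.pi, w √(1 + Real.cos ξ) = ξ := by
    intro ξ hξ
    simp only [hw]
    rw [hcos ξ hξ, mul_div_cancel_left₀ _ h2.ne', Real.arccos_cos (by linarith [hξ.1])
      (by linarith [hξ.2])]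
    ring
  have hsub : Icc 0 √(1 + Real.cos α) ⊆ O := by
    intro ρ hρ
    have hlt : √(1 + Real.cos α) < √2 := by
      apply Real.sqrt_lt_sqrt
      · linarith [Real.neg_one_le_cos α]
      · have := one_sub_cos_lt le_rfl hα hαπ
        rw [Real.cos_zero] at this
        linarith
    refine ⟨⟨by linarith [hρ.1], by linarith [hρ.2]⟩, ?_⟩
    have hle : α ≤ w ρ := by
      rw [← hwcos α ⟨le_rfl, hαπ⟩]
      simp only [hw]
      gcongr
      exact hρ.2
    have hle2 : w ρ ≤ Real.pi := by
      have : Real.arccos (ρ / √2) ≤ Real.arccos 0 :=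
        Real.antitone_arccos (div_nonneg hρ.1 h2.le)
      rw [Real.arccos_zero] at this
      simp only [hw]
      linarith
    rw [mem_preimage, ← hO₁]
    exact hcap (sph_mem_capS hα.le ⟨hle, hle2⟩)
  have hcomp : ContDiffOn ℝ 2 (profile Q ∘ w) O :=
    hprof.comp (contDiffOn_two_mul_arccos.mono inter_subset_left) fun ρ hρ => hρ.2
  obtain ⟨h, hh, heq⟩ := exists_contDiff_extension (n := 2) hOo (Real.sqrt_nonneg _) hsub hcomp
  refine ⟨h, hh, fun ξ hξ => ?_⟩
  rw [heq ⟨Real.sqrt_nonneg _, ?_⟩, Function.comp_apply, hwcos ξ hξ]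
  apply Real.sqrt_le_sqrt
  have := Real.strictAntiOn_cos.antitoneOn ⟨hα.le, hαπ⟩ ⟨hα.le.trans hξ.1, hξ.2⟩ hξ.1
  linarith

/-! ### The density in closed form -/

lemma hasDerivAt_arctan_sqrt {u : ℝ → ℝ} {u' s : ℝ} (hu : HasDerivAt u u' s) (h0 : 0 < u s) :
    HasDerivAt (fun s => Real.arctan √(u s)) (u' / (2 * √(u s) * (1 + u s))) s := by
  have h := (hu.sqrt h0.ne').arctan
  rw [Real.sq_sqrt h0.le] at h
  convert h using 1
  have : √(u s) ≠ 0 := (Real.sqrt_pos.2 h0).ne'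
  field_simp

/-- The half-order derivative of `√s`, without its boundary term. -/
lemma integral_inv_sqrt_div_sqrt {a x : ℝ} (ha : 0 < a) (hax : a < x) :
    IntervalIntegrable (fun s => 1 / (2 * √s) / √(x - s)) volume a x ∧
    ∫ s in a..x, 1 / (2 * √s) / √(x - s) = Real.arctan √((x - a) / a) := by
  have hd : ∀ s ∈ Ioo a x, HasDerivAt (fun s => -Real.arctan √((x - s) / s))
      (1 / (2 * √s) / √(x - s)) s := by
    intro s hs
    have hs0 : 0 < s := ha.trans hs.1
    have hxs : 0 < x - s := by linarith [hs.2]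
    have hu : HasDerivAt (fun s => (x - s) / s) ((-1 * s - (x - s) * 1) / s ^ 2) s := by
      refine HasDerivAt.div ?_ (hasDerivAt_id s) hs0.ne'
      simpa using (hasDerivAt_id s).const_sub x
    have h := (hasDerivAt_arctan_sqrt hu (div_pos hxs hs0)).neg
    refine h.congr_deriv ?_
    have h1 : √s ≠ 0 := (Real.sqrt_pos.2 hs0).ne'
    have h2 : √(x - s) ≠ 0 := (Real.sqrt_pos.2 hxs).ne'
    have h3 : x ≠ 0 := by linarith
    rw [Real.sqrt_div hxs.le]
    have h4 : s = √s ^ 2 := (Real.sq_sqrt hs0.le).symm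
    have h5 : 1 + (x - s) / s = x / s := by field_simp; ring
    rw [h5]
    field_simp
    rw [← h4]
    ring
  have hcont : ContinuousOn (fun s => -Real.arctan √((x - s) / s)) (Icc a x) := by
    refine (Real.continuous_arctan.comp_continuousOn (Real.continuous_sqrt.comp_continuousOn
      (ContinuousOn.div (by fun_prop) continuousOn_id ?_))).neg
    intro s hs
    exact (ha.trans_le hs.1).ne'
  have hint := intervalIntegral.intervalIntegrable_deriv_of_nonneg
    (by rwa [uIcc_of_le hax.le]) (by rwa [min_eq_left hax.le, max_eq_right hax.le])
    (by intro s _; positivity)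
  refine ⟨hint, ?_⟩
  rw [intervalIntegral.integral_eq_sub_of_hasDerivAt_of_le hax.le hcont hd hint]
  simp

lemma capSource_eq (h : ℝ → ℝ) (c s : ℝ) :
    capSource h c s = c / (2 * Real.pi) * √s + 2 * heightG h s := by
  have := Real.pi_pos
  unfold capSource heightG
  field_simp
  ring

/-- The half-order derivative of the source of the cap: the constant field contributes elementary
functions, the external field contributes the transform `F`. -/
lemma halfDeriv_capSource {h : ℝ → ℝ} (hh : ContDiff ℝ 2 h) (c : ℝ) {a x : ℝ} (ha : 0 < a)
    (hax : a < x) (hx2 : x < 2) :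
    1 / Real.pi * halfDeriv a (capSource h c) x =
      c / (2 * Real.pi ^ 2) * (√(a / (x - a)) + Real.arctan √((x - a) / a)) +
        2 / Real.pi * halfDeriv a (heightG h) x := by
  have hp := Real.pi_pos
  have hg := contDiffOn_heightG hh
  have hi := intervalIntegrable_deriv_div_sqrt ha hax hx2 hg
  obtain ⟨h1, h2⟩ := integral_inv_sqrt_div_sqrt ha hax
  have hder : ∀ s ∈ Ioo a x, deriv (capSource h c) s / √(x - s) =
      c / (2 * Real.pi) * (1 / (2 * √s) / √(x - s)) + 2 * (deriv (heightG h) s / √(x - s)) := by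
    intro s hs
    have hs0 : 0 < s := ha.trans hs.1
    have hd : DifferentiableAt ℝ (heightG h) s :=
      (hg.differentiableOn one_ne_zero).differentiableAt
        (Ioo_mem_nhds hs0 (hs.2.trans hx2))
    have h3 : HasDerivAt (capSource h c)
        (c / (2 * Real.pi) * (1 / (2 * √s)) + 2 * deriv (heightG h) s) s := by
      rw [funext (capSource_eq h c)]
      exact ((Real.hasDerivAt_sqrt hs0.ne').const_mul _).add (hd.hasDerivAt.const_mul _)
    rw [h3.deriv]
    ring
  have hint : ∫ s in a..x, deriv (capSource h c) s / √(x - s) =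
      c / (2 * Real.pi) * Real.arctan √((x - a) / a) +
        2 * ∫ s in a..x, deriv (heightG h) s / √(x - s) := by
    rw [← h2, ← intervalIntegral.integral_const_mul, ← intervalIntegral.integral_const_mul,
      ← intervalIntegral.integral_add (h1.const_mul _) (hi.const_mul _)]
    rw [intervalIntegral.integral_of_le hax.le, intervalIntegral.integral_of_le hax.le,
      integral_Ioc_eq_integral_Ioo, integral_Ioc_eq_integral_Ioo]
    exact setIntegral_congr_fun measurableSet_Ioo hder
  unfold halfDeriv
  rw [hint, capSource_eq, Real.sqrt_div ha.le]
  have : √(x - a) ≠ 0 := (Real.sqrt_pos.2 (by linarith)).ne'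
  field_simp
  ring

lemma densityFormula_eq {h q : ℝ → ℝ} {α : ℝ} (hh : ContDiff ℝ 2 h) (hα : 0 < α)
    (hq : ∀ ξ ∈ Icc α Real.pi, q ξ = h √(1 + Real.cos ξ)) (c : ℝ) {φ : ℝ}
    (hφ : φ ∈ Ioo α Real.pi) :
    densityFormula q α c φ =
      1 / Real.pi * halfDeriv (1 - Real.cos α) (capSource h c) (1 - Real.cos φ) := by
  have hp := Real.pi_pos
  have ha : 0 < 1 - Real.cos α := (one_sub_cos_mem ⟨hα, hφ.1.trans hφ.2⟩).1
  have hax := one_sub_cos_lt hα.le hφ.1 hφ.2.le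
  rw [halfDeriv_capSource hh c ha hax (one_sub_cos_mem ⟨hα.trans hφ.1, hφ.2⟩).2,
    densityFormula, auxF_eq hh hα hq hφ]
  have hx : Real.cos α - Real.cos φ = 1 - Real.cos φ - (1 - Real.cos α) := by ring
  rw [hx]
  set a := 1 - Real.cos α
  set x := 1 - Real.cos φ
  have hpos : 0 < √(a / (x - a)) := Real.sqrt_pos.2 (div_pos ha (by linarith))
  have hinv : √((x - a) / a) = (√(a / (x - a)))⁻¹ := by
    rw [← Real.sqrt_inv, inv_div]
  rw [hinv, Real.arctan_inv_of_pos hpos]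
  field_simp
  ring

/-- Integral over the cap of the density belonging to the zero field. -/
lemma integral_cap_density {a : ℝ} (ha : 0 < a) (ha2 : a < 2) :
    IntervalIntegrable (fun x => √(a / (x - a)) + Real.arctan √((x - a) / a)) volume a 2 ∧
    ∫ x in a..2, (√(a / (x - a)) + Real.arctan √((x - a) / a)) =
      √(a * (2 - a)) + 2 * Real.arctan √((2 - a) / a) := by
  have hd : ∀ x ∈ Ioo a 2, HasDerivAt (fun x => √(a * (x - a)) + x * Real.arctan √((x - a) / a))
      (√(a / (x - a)) + Real.arctan √((x - a) / a)) x := by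
    intro x hx
    have hxa : 0 < x - a := by linarith [hx.1]
    have h1 : HasDerivAt (fun x => a * (x - a)) (a * 1) x :=
      ((hasDerivAt_id x).sub_const a).const_mul a
    have h2 : HasDerivAt (fun x => (x - a) / a) (1 / a) x :=
      ((hasDerivAt_id x).sub_const a).div_const a
    have h := (h1.sqrt (by positivity)).add
      ((hasDerivAt_id x).mul (hasDerivAt_arctan_sqrt h2 (div_pos hxa ha)))
    refine h.congr_deriv ?_
    rw [Real.sqrt_mul ha.le, Real.sqrt_div ha.le, Real.sqrt_div hxa.le]
    have e1 : √(x - a) ≠ 0 := (Real.sqrt_pos.2 hxa).ne'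
    have e2 : √a ≠ 0 := (Real.sqrt_pos.2 ha).ne'
    have e3 : a = √a ^ 2 := (Real.sq_sqrt ha.le).symm
    have e4 : 1 + (x - a) / a = x / a := by field_simp; ring
    have e5 : x ≠ 0 := by linarith
    rw [e4, id]
    field_simp
    linear_combination e3
  have hcont : ContinuousOn (fun x => √(a * (x - a)) + x * Real.arctan √((x - a) / a))
      (Icc a 2) := by
    have := Real.continuous_arctan
    fun_prop
  have hint := intervalIntegral.intervalIntegrable_deriv_of_nonneg
    (by rwa [uIcc_of_le ha2.le]) (by rwa [min_eq_left ha2.le, max_eq_right ha2.le])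
    (by
      intro s _
      have := Real.arctan_nonneg.2 (Real.sqrt_nonneg ((s - a) / a))
      positivity)
  refine ⟨hint, ?_⟩
  rw [intervalIntegral.integral_eq_sub_of_hasDerivAt_of_le ha2.le hcont hd hint]
  simp

lemma cap_constant {α : ℝ} (hα : 0 < α) (hαπ : α < Real.pi) :
    √((1 - Real.cos α) * (2 - (1 - Real.cos α))) +
      2 * Real.arctan √((2 - (1 - Real.cos α)) / (1 - Real.cos α)) =
        Real.sin α + Real.pi - α := by
  have hs : 0 < Real.sin (α / 2) := Real.sin_pos_of_pos_of_lt_pi (by linarith) (by linarith)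
  have hc : 0 < Real.cos (α / 2) := Real.cos_pos_of_mem_Ioo ⟨by linarith, by linarith⟩
  have h2 : Real.cos α = 2 * Real.cos (α / 2) ^ 2 - 1 := by
    rw [← Real.cos_two_mul]; congr 1; ring
  have h1 : (1 - Real.cos α) * (2 - (1 - Real.cos α)) = Real.sin α ^ 2 := by
    rw [Real.sin_sq]; ring
  have h3 : (2 - (1 - Real.cos α)) / (1 - Real.cos α) =
      (Real.cos (α / 2) / Real.sin (α / 2)) ^ 2 := by
    have h4 : 1 - Real.cos α = 2 * Real.sin (α / 2) ^ 2 := by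
      rw [h2, Real.sin_sq]; ring
    rw [h4, div_pow]
    have h5 := Real.sin_sq_add_cos_sq (α / 2)
    field_simp
    linear_combination -h5
  rw [h1, Real.sqrt_sq (Real.sin_pos_of_pos_of_lt_pi hα hαπ).le, h3,
    Real.sqrt_sq (by positivity), ← Real.sin_pi_div_two_sub (α / 2),
    ← Real.cos_pi_div_two_sub (α / 2), ← Real.tan_eq_sin_div_cos,
    Real.arctan_tan (by linarith) (by linarith)]
  ring

/-! ### Representing the equilibrium measure -/

lemma polarAngle_mem_Ioo {x : S2} (hx : height x ∈ Ioo (0 : ℝ) 2) :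
    polarAngle x ∈ Ioo 0 Real.pi := by
  have h := polarAngle_mem x
  rw [height_eq] at hx
  refine ⟨h.1.lt_of_ne fun h0 => ?_, h.2.lt_of_ne fun h0 => ?_⟩
  · rw [← h0, Real.cos_zero] at hx
    linarith [hx.1]
  · rw [h0, Real.cos_pi] at hx
    linarith [hx.2]

lemma ae_surfaceMeasure_height_iff {P : ℝ → Prop} (hP : MeasurableSet {y | P y}) :
    (∀ᵐ x ∂surfaceMeasure, P (height x)) ↔ ∀ᵐ y ∂volume.restrict (Ioo (0 : ℝ) 2), P y := by
  have hp := Real.pi_pos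
  have h := lintegral_surfaceMeasure_height (p := {y | ¬ P y}.indicator 1)
    (measurable_one.indicator hP.compl)
  have h1 : ∀ x, {y | ¬ P y}.indicator (1 : ℝ → ℝ≥0∞) (height x) =
      {x | ¬ P (height x)}.indicator 1 x := fun x => rfl
  simp_rw [h1] at h
  rw [lintegral_indicator_one (s := {x | ¬ P (height x)}) (measurable_height hP.compl),
    lintegral_indicator_one (s := {y | ¬ P y}) hP.compl] at h
  rw [ae_iff, ae_iff, h, mul_eq_zero]
  simp [hp]

/-- The rotationally symmetric measure with density `posDensity a k` in the height. -/
noncomputable def posMeasure (a : ℝ) (k : ℝ → ℝ) : Measure S2 :=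
  surfaceMeasure.withDensity fun x => posDensity a k (height x)

lemma posDensity_of_le {a x : ℝ} (hx : x ≤ a) (k : ℝ → ℝ) : posDensity a k x = 0 := by
  rw [posDensity, halfDensity, indicator_of_notMem (by simpa using hx)]

lemma measurable_posDensity_height (a : ℝ) (k : ℝ → ℝ) :
    Measurable fun x : S2 => posDensity a k (height x) :=
  (measurable_posDensity a k).comp measurable_height

lemma isFiniteMeasure_posMeasure {a : ℝ} (ha : 0 ≤ a) (ha2 : a < 2) {k : ℝ → ℝ}
    (hk : IntervalIntegrable (deriv k) volume a 2) : IsFiniteMeasure (posMeasure a k) := by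
  refine isFiniteMeasure_withDensity ?_
  rw [lintegral_surfaceMeasure_height (measurable_posDensity a k)]
  refine ENNReal.mul_ne_top ENNReal.ofReal_ne_top (ne_top_of_le_ne_top ?_
    (lintegral_halfDensity_le ha ha2 (by fun_prop)))
  exact ENNReal.mul_ne_top ENNReal.ofReal_ne_top (posPart_ne_top ha2.le hk le_rfl)

lemma ae_posMeasure (a : ℝ) (k : ℝ → ℝ) : ∀ᵐ x ∂posMeasure a k, height x ∈ Ioo a 2 := by
  rw [posMeasure, ae_withDensity_iff (measurable_posDensity_height a k)]
  filter_upwards [ae_surfaceMeasure_height] with x hx hne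
  refine ⟨?_, hx.2⟩
  by_contra h
  exact hne (posDensity_of_le (not_lt.1 h) k)

section CapSource

variable {h : ℝ → ℝ} {c a : ℝ}

lemma capSource_eq_sqrt_mul (h : ℝ → ℝ) (c : ℝ) :
    capSource h c = fun s => √s * ((c - innerSlope h √(2 - s)) / (2 * Real.pi)) := by
  ext s
  unfold capSource
  ring

lemma contDiff_capSource_factor (hh : ContDiff ℝ 2 h) (c : ℝ) :
    ContDiff ℝ 1 fun r => (c - innerSlope h r) / (2 * Real.pi) :=
  (contDiff_const.sub (contDiff_innerSlope hh)).div_const _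

lemma continuous_capSource (hh : ContDiff ℝ 2 h) (c : ℝ) : Continuous (capSource h c) := by
  have := (contDiff_capSource_factor hh c).continuous
  rw [capSource_eq_sqrt_mul]
  exact Real.continuous_sqrt.mul (this.comp (by fun_prop : Continuous fun s => √(2 - s)))

lemma contDiffOn_capSource (hh : ContDiff ℝ 2 h) (c : ℝ) :
    ContDiffOn ℝ 1 (capSource h c) (Ioo 0 2) := by
  rw [capSource_eq_sqrt_mul]
  exact contDiffOn_sqrt_mul_comp (contDiff_capSource_factor hh c)

lemma differentiableAt_capSource (hh : ContDiff ℝ 2 h) (c : ℝ) {s : ℝ} (hs : s ∈ Ioo (0 : ℝ) 2) :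
    DifferentiableAt ℝ (capSource h c) s :=
  ((contDiffOn_capSource hh c).differentiableOn one_ne_zero).differentiableAt
    (Ioo_mem_nhds hs.1 hs.2)

lemma intervalIntegrable_deriv_capSource (hh : ContDiff ℝ 2 h) (c : ℝ) (ha : 0 < a)
    (ha2 : a < 2) : IntervalIntegrable (deriv (capSource h c)) volume a 2 := by
  rw [capSource_eq_sqrt_mul]
  exact intervalIntegrable_deriv_sqrt_mul_comp (contDiff_capSource_factor hh c) ha ha2

lemma intervalIntegrable_deriv_neg {k : ℝ → ℝ} {b : ℝ}
    (hk : IntervalIntegrable (deriv k) volume a b) :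
    IntervalIntegrable (deriv fun s => -k s) volume a b := by
  rw [funext (deriv_fun_neg k)]
  exact hk.neg

/-- On the cap, a measure whose potential balances the external field has the same potential as
the signed measure built from the half-order derivative of the source. -/
lemma potential_add_posMeasure (hh : ContDiff ℝ 2 h) (ha : 0 < a) (ha2 : a < 2)
    {μ : Measure S2} {x : S2} (hx : height x ∈ Ico a 2) (hc : 0 ≤ c)
    (h0 : 0 ≤ h √(2 - height x))
    (hpot : potential μ x + ENNReal.ofReal (h √(2 - height x)) = ENNReal.ofReal c) :
    potential (μ + posMeasure a fun s => -capSource h c s) x =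
      potential (posMeasure a (capSource h c)) x := by
  have hk := intervalIntegrable_deriv_capSource hh c ha ha2
  have hx0 : height x ∈ Ioo (0 : ℝ) 2 := ⟨ha.trans_le hx.1, hx.2⟩
  have hφ := polarAngle_mem_Ioo hx0
  obtain ⟨θ, hθ⟩ := exists_eq_sph x
  have hle : a ≤ 1 - Real.cos (polarAngle x) := by rw [← height_eq]; exact hx.1
  have hcont := continuous_capSource hh c
  obtain ⟨h1, h2⟩ := potential_posDensity_sub ha ha2 hcont.continuousOn
    (fun s hs => differentiableAt_capSource hh c ⟨ha.trans hs.1, hs.2⟩) hk (θ := θ) hφ hle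
  obtain ⟨h3, -⟩ := potential_posDensity_sub ha ha2
    (k := fun s => -capSource h c s) hcont.neg.continuousOn
    (fun s hs => (differentiableAt_capSource hh c ⟨ha.trans hs.1, hs.2⟩).neg)
    (intervalIntegrable_deriv_neg hk) (θ := θ) hφ hle
  rw [← hθ] at h1 h2 h3
  rw [← height_eq, integral_latWeight_capSource (hh.of_le one_le_two) c hx0.1 hx0.2] at h2
  have hμ : potential μ x ≠ ⊤ := by
    intro htop
    rw [htop, top_add] at hpot
    exact ENNReal.ofReal_ne_top hpot.symm
  have hr := congrArg ENNReal.toReal hpot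
  rw [ENNReal.toReal_add hμ ENNReal.ofReal_ne_top, ENNReal.toReal_ofReal h0,
    ENNReal.toReal_ofReal hc] at hr
  rw [potential_add]
  refine (ENNReal.toReal_eq_toReal_iff' (ENNReal.add_ne_top.2 ⟨hμ, h3⟩) h1).1 ?_
  rw [ENNReal.toReal_add hμ h3]
  linarith

/-- A measure on the cap whose potential balances the external field is the difference of the two
measures built from the half-order derivative of the source. -/
theorem add_posMeasure_eq (hh : ContDiff ℝ 2 h) (ha : 0 < a) (ha2 : a < 2) (hc : 0 ≤ c)
    (h0 : ∀ y ∈ Icc a 2, 0 ≤ h √(2 - y)) {μ : Measure S2} [IsFiniteMeasure μ]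
    (hμcap : ∀ᵐ x ∂μ, height x ∈ Ico a 2)
    (hμ : ∀ᵐ x ∂μ, potential μ x + ENNReal.ofReal (h √(2 - height x)) = ENNReal.ofReal c)
    (hσ : ∀ᵐ x ∂surfaceMeasure, a ≤ height x →
      potential μ x + ENNReal.ofReal (h √(2 - height x)) = ENNReal.ofReal c) :
    μ + posMeasure a (fun s => -capSource h c s) = posMeasure a (capSource h c) := by
  have hk := intervalIntegrable_deriv_capSource hh c ha ha2
  have hν₁ := isFiniteMeasure_posMeasure ha.le ha2 hk
  have hν₂ := isFiniteMeasure_posMeasure ha.le ha2 (intervalIntegrable_deriv_neg hk)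
  have key : ∀ x, height x ∈ Ico a 2 →
      potential μ x + ENNReal.ofReal (h √(2 - height x)) = ENNReal.ofReal c →
      potential (μ + posMeasure a fun s => -capSource h c s) x =
        potential (posMeasure a (capSource h c)) x := fun x hx hp =>
    potential_add_posMeasure hh ha ha2 hx hc (h0 _ ⟨hx.1, hx.2.le⟩) hp
  have hν : ∀ k : ℝ → ℝ, ∀ᵐ x ∂posMeasure a k, height x ∈ Ico a 2 ∧
      potential μ x + ENNReal.ofReal (h √(2 - height x)) = ENNReal.ofReal c := by
    intro k
    have hac : ∀ᵐ x ∂posMeasure a k, a ≤ height x →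
        potential μ x + ENNReal.ofReal (h √(2 - height x)) = ENNReal.ofReal c :=
      withDensity_absolutelyContinuous _ _ hσ
    filter_upwards [ae_posMeasure a k, hac] with x hx hx'
    exact ⟨Ioo_subset_Ico_self hx, hx' hx.1.le⟩
  have hA : ∀ᵐ x ∂(μ + posMeasure a fun s => -capSource h c s), height x ∈ Ico a 2 ∧
      potential (μ + posMeasure a fun s => -capSource h c s) x =
        potential (posMeasure a (capSource h c)) x := by
    rw [ae_add_measure_iff]
    constructor
    · filter_upwards [hμcap, hμ] with x hx hx'
      exact ⟨hx, key x hx hx'⟩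
    · filter_upwards [hν fun s => -capSource h c s] with x hx
      exact ⟨hx.1, key x hx.1 hx.2⟩
  refine measure_eq_of_potential_eq (hA.mono fun x hx => hx.2)
    ((hν _).mono fun x hx => key x hx.1 hx.2) ?_
  -- The potential of the representing measure is bounded on the cap, so all energies are finite.
  set K : ℝ≥0∞ := 2 * ((invSqrt a * (ENNReal.ofReal (capSource h c a) +
    ∫⁻ y in Ioo a 2, ENNReal.ofReal (deriv (capSource h c) y))) * ENNReal.ofReal Real.pi) with hK
  have hKtop : K ≠ ⊤ := by
    have h1 : ENNReal.ofReal (capSource h c a) +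
      ∫⁻ y in Ioo a 2, ENNReal.ofReal (deriv (capSource h c) y) ≠ ⊤ :=
      posPart_ne_top ha2.le hk le_rfl
    exact ENNReal.mul_ne_top ENNReal.ofNat_ne_top (ENNReal.mul_ne_top
      (ENNReal.mul_ne_top (invSqrt_ne_top _) h1) ENNReal.ofReal_ne_top)
  have hbound : ∀ᵐ x ∂(μ + posMeasure a fun s => -capSource h c s),
      potential (μ + posMeasure a fun s => -capSource h c s) x ≤ K := by
    filter_upwards [hA] with x hx
    rw [hx.2]
    obtain ⟨θ, hθ⟩ := exists_eq_sph x
    have hφ := polarAngle_mem_Ioo (x := x) ⟨ha.trans_le hx.1.1, hx.1.2⟩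
    rw [hθ]
    exact potential_halfDensity_le ha (by fun_prop) hφ (by rw [← height_eq]; exact hx.1.1)
  refine ne_top_of_le_ne_top ?_ (lintegral_mono_ae hbound)
  rw [lintegral_const]
  exact ENNReal.mul_ne_top hKtop (measure_ne_top _ _)

end CapSource

/-- `1/π` times the half-order derivative of `k`, on the heights of the open cap, as a density. -/
noncomputable def capDensity (a : ℝ) (k : ℝ → ℝ) : ℝ → ℝ≥0∞ :=
  (Ioo a 2).indicator fun x => ENNReal.ofReal (1 / Real.pi * halfDeriv a k x)

section Density

variable {a : ℝ} {k : ℝ → ℝ}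

lemma posDensity_tsub (ha : 0 < a) (hk : ContDiffOn ℝ 1 k (Ioo 0 2)) {x : ℝ}
    (hx : x ∈ Ioo a 2) :
    posDensity a k x ≠ ⊤ ∧ posDensity a (fun s => -k s) x ≠ ⊤ ∧
    (posDensity a k x).toReal - (posDensity a (fun s => -k s) x).toReal =
      1 / Real.pi * halfDeriv a k x ∧
    posDensity a k x - posDensity a (fun s => -k s) x = capDensity a k x := by
  obtain ⟨h1, h2⟩ := posDensity_sub hx.1 (intervalIntegrable_deriv_div_sqrt ha hx.1 hx.2 hk)
  obtain ⟨h3, -⟩ := posDensity_sub hx.1 (intervalIntegrable_deriv_div_sqrt ha hx.1 hx.2 hk.neg)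
  refine ⟨h1, h3, h2, ?_⟩
  rw [capDensity, indicator_of_mem hx, ← h2, ENNReal.ofReal_sub _ ENNReal.toReal_nonneg,
    ENNReal.ofReal_toReal h1, ENNReal.ofReal_toReal h3]

lemma continuousOn_halfDeriv (ha : 0 < a) (hk : ContDiffOn ℝ 1 k (Ioo 0 2)) :
    ContinuousOn (halfDeriv a k) (Ioo a 2) := fun _ hx =>
  (hasDerivAt_abel ha hx.1 hx.2 hk).2.continuousWithinAt

/-- The density of a positive measure is nonnegative at every point at which it is continuous, and
the measure is recovered from it. -/
theorem eq_withDensity_capDensity (ha : 0 < a) (ha2 : a < 2) (hk : ContDiffOn ℝ 1 k (Ioo 0 2))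
    (hki : IntervalIntegrable (deriv k) volume a 2) {μ : Measure S2}
    (hμ : μ + posMeasure a (fun s => -k s) = posMeasure a k) :
    (∀ x ∈ Ioo a 2, 0 ≤ halfDeriv a k x) ∧
    μ = surfaceMeasure.withDensity fun x => capDensity a k (height x) := by
  have hp := Real.pi_pos
  have hfin := isFiniteMeasure_posMeasure ha.le ha2 (intervalIntegrable_deriv_neg hki)
  have m1 := measurable_posDensity_height a k
  have m2 := measurable_posDensity_height a fun s => -k s
  have hle : ∀ᵐ x ∂surfaceMeasure,
      posDensity a (fun s => -k s) (height x) ≤ posDensity a k (height x) := by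
    refine ae_le_of_forall_setLIntegral_le_of_sigmaFinite m2 fun s hs _ => ?_
    rw [← withDensity_apply _ hs, ← withDensity_apply _ hs]
    change posMeasure a (fun s => -k s) s ≤ posMeasure a k s
    rw [← hμ, Measure.add_apply]
    exact le_add_self
  constructor
  · rw [ae_surfaceMeasure_height_iff (P := fun y => posDensity a (fun s => -k s) y ≤
      posDensity a k y) (measurableSet_le (measurable_posDensity _ _) (measurable_posDensity _ _)),
      ae_restrict_iff' measurableSet_Ioo] at hle
    have hae : halfDeriv a k =ᵐ[volume.restrict (Ioo a 2)] fun x => |halfDeriv a k x| := by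
      rw [Filter.EventuallyEq, ae_restrict_iff' measurableSet_Ioo]
      filter_upwards [hle] with x hx hxa
      obtain ⟨h1, h2, h3, -⟩ := posDensity_tsub ha hk hxa
      have h4 := ENNReal.toReal_mono h1 (hx ⟨ha.trans hxa.1, hxa.2⟩)
      have h5 : 0 ≤ 1 / Real.pi * halfDeriv a k x := by linarith
      exact (abs_of_nonneg (nonneg_of_mul_nonneg_right h5 (by positivity))).symm
    have hc := continuousOn_halfDeriv ha hk
    intro x hx
    rw [Measure.eqOn_open_of_ae_eq hae isOpen_Ioo hc hc.abs hx]
    exact abs_nonneg _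
  · have hsum : surfaceMeasure.withDensity (fun x => capDensity a k (height x)) +
        posMeasure a (fun s => -k s) = posMeasure a k := by
      rw [posMeasure, posMeasure, ← withDensity_add_right _ m2]
      refine withDensity_congr_ae ?_
      filter_upwards [hle, ae_surfaceMeasure_height] with x hx hx2
      rw [Pi.add_apply]
      by_cases hxa : a < height x
      · rw [← (posDensity_tsub ha hk ⟨hxa, hx2.2⟩).2.2.2, tsub_add_cancel_of_le hx]
      · rw [posDensity_of_le (not_lt.1 hxa), posDensity_of_le (not_lt.1 hxa), capDensity,
          indicator_of_notMem fun h => hxa h.1, add_zero]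
    exact (Measure.add_left_inj _ _ _).1 (hμ.trans hsum.symm)

lemma measurable_capDensity (ha : 0 < a) (hk : ContDiffOn ℝ 1 k (Ioo 0 2)) :
    Measurable (capDensity a k) := by
  have h : capDensity a k = (Ioo a 2).indicator
      (posDensity a k - posDensity a fun s => -k s) := by
    ext x
    by_cases hx : x ∈ Ioo a 2
    · rw [indicator_of_mem hx, Pi.sub_apply, (posDensity_tsub ha hk hx).2.2.2]
    · rw [indicator_of_notMem hx, capDensity, indicator_of_notMem hx]
  rw [h]
  exact ((measurable_posDensity _ _).sub (measurable_posDensity _ _)).indicator measurableSet_Ioo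

lemma lintegral_capDensity (ha : 0 < a) (ha2 : a < 2) (hk : ContDiffOn ℝ 1 k (Ioo 0 2))
    (hki : IntervalIntegrable (deriv k) volume a 2)
    (hnn : ∀ x ∈ Ioo a 2, 0 ≤ halfDeriv a k x) :
    ∫⁻ x, capDensity a k (height x) ∂surfaceMeasure =
      ENNReal.ofReal (2 * Real.pi * ∫ x in a..2, 1 / Real.pi * halfDeriv a k x) := by
  have hp := Real.pi_pos
  rw [lintegral_surfaceMeasure_height (measurable_capDensity ha hk),
    lintegral_eq_Ioo_of_zero (b := a) (c := 2) measurableSet_Ioo (Ioo_subset_Ioo_left ha.le)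
      fun s _ hs => by rw [capDensity, indicator_of_notMem hs],
    setLIntegral_congr_fun measurableSet_Ioo
      (fun x hx => by rw [capDensity, indicator_of_mem hx]),
    ← ofReal_integral_eq_lintegral_ofReal ((integrableOn_halfDeriv ha ha2 hk hki).const_mul _),
    ← ENNReal.ofReal_mul (by positivity), intervalIntegral.integral_of_le ha2.le,
    integral_Ioc_eq_integral_Ioo]
  rw [Filter.EventuallyLE, ae_restrict_iff' measurableSet_Ioo]
  exact ae_of_all _ fun x hx => mul_nonneg (by positivity) (hnn x hx)

end Density

/-! ### The total mass and the constant `F_Q` -/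

section

variable {h q : ℝ → ℝ} {α : ℝ}

/-- The substitution `x = 1 - cos φ` in the integral of `F`. -/
lemma integral_auxF (hh : ContDiff ℝ 2 h) (hα : 0 < α) (hαπ : α < Real.pi)
    (hq : ∀ ξ ∈ Icc α Real.pi, q ξ = h √(1 + Real.cos ξ)) :
    IntervalIntegrable (fun φ => auxF q α φ * Real.sin φ) volume α Real.pi ∧
    IntervalIntegrable (halfDeriv (1 - Real.cos α) (heightG h)) volume (1 - Real.cos α) 2 ∧
    ∫ φ in α..Real.pi, auxF q α φ * Real.sin φ =
      ∫ x in (1 - Real.cos α)..2, 2 / Real.pi * halfDeriv (1 - Real.cos α) (heightG h) x := by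
  have ha := one_sub_cos_mem ⟨hα, hαπ⟩
  set a := 1 - Real.cos α with hadef
  have hg : heightG h = fun s => √s * (-(1 / (4 * Real.pi)) * innerSlope h √(2 - s)) := by
    ext s
    unfold heightG
    ring
  have hgi : IntervalIntegrable (deriv (heightG h)) volume a 2 := by
    rw [hg]
    exact intervalIntegrable_deriv_sqrt_mul_comp
      (m := fun r => -(1 / (4 * Real.pi)) * innerSlope h r)
      (contDiff_const.mul (contDiff_innerSlope hh)) ha.1 ha.2
  have hint : IntervalIntegrable (halfDeriv a (heightG h)) volume a 2 :=
    (intervalIntegrable_iff_integrableOn_Ioo_of_le ha.2.le).2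
      (integrableOn_halfDeriv ha.1 ha.2 (contDiffOn_heightG hh) hgi)
  have hcont : ContinuousOn (fun φ => 1 - Real.cos φ) (Icc α Real.pi) := by fun_prop
  have hd : ∀ x ∈ Ioo α Real.pi, HasDerivAt (fun φ => 1 - Real.cos φ) (Real.sin x) x :=
    fun x _ => hasDerivAt_one_sub_cos x
  have hpos := sin_pos_Ioo hα.le le_rfl
  have h2 : 1 - Real.cos Real.pi = 2 := by rw [Real.cos_pi]; norm_num
  have hle : 1 - Real.cos α ≤ 1 - Real.cos Real.pi := by rw [h2]; exact ha.2.le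
  have e1 := intervalIntegrable_subst hαπ.le hcont hd hpos hle
    fun x => 2 / Real.pi * halfDeriv a (heightG h) x
  have e2 := intervalIntegral_subst hαπ.le hcont hd hpos hle
    fun x => 2 / Real.pi * halfDeriv a (heightG h) x
  rw [h2] at e1 e2
  have hF : ∀ φ ∈ Ioo α Real.pi, Real.sin φ *
      (2 / Real.pi * halfDeriv a (heightG h) (1 - Real.cos φ)) = auxF q α φ * Real.sin φ := by
    intro φ hφ
    rw [auxF_eq hh hα hq hφ, mul_comm]
  refine ⟨?_, hint, ?_⟩
  · have := e1.1 (hint.const_mul _)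
    rw [intervalIntegrable_iff_integrableOn_Ioo_of_le hαπ.le] at this ⊢
    exact this.congr_fun hF measurableSet_Ioo
  · rw [e2, intervalIntegral.integral_of_le hαπ.le, intervalIntegral.integral_of_le hαπ.le,
      integral_Ioc_eq_integral_Ioo, integral_Ioc_eq_integral_Ioo]
    exact (setIntegral_congr_fun measurableSet_Ioo hF).symm

/-- The total mass of the cap density, as a function of the constant `c`. -/
lemma integral_halfDeriv_capSource (hh : ContDiff ℝ 2 h) (hα : 0 < α) (hαπ : α < Real.pi)
    (hq : ∀ ξ ∈ Icc α Real.pi, q ξ = h √(1 + Real.cos ξ)) (c : ℝ) :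
    ∫ x in (1 - Real.cos α)..2, 1 / Real.pi * halfDeriv (1 - Real.cos α) (capSource h c) x =
      c / (2 * Real.pi ^ 2) * (Real.sin α + Real.pi - α) +
        ∫ φ in α..Real.pi, auxF q α φ * Real.sin φ := by
  have ha := one_sub_cos_mem ⟨hα, hαπ⟩
  obtain ⟨-, h1, h2⟩ := integral_auxF hh hα hαπ hq
  obtain ⟨h3, h4⟩ := integral_cap_density ha.1 ha.2
  rw [h2, ← cap_constant hα hαπ, ← h4, ← intervalIntegral.integral_const_mul,
    ← intervalIntegral.integral_add (h3.const_mul _) (h1.const_mul _),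
    intervalIntegral.integral_of_le ha.2.le, intervalIntegral.integral_of_le ha.2.le,
    integral_Ioc_eq_integral_Ioo, integral_Ioc_eq_integral_Ioo]
  exact setIntegral_congr_fun measurableSet_Ioo fun x hx =>
    halfDeriv_capSource hh c ha.1 hx.1 hx.2

lemma mem_capS_iff {x : S2} (hα : 0 ≤ α) (hαπ : α ≤ Real.pi) :
    x ∈ capS α ↔ 1 - Real.cos α ≤ height x := by
  have hp := polarAngle_mem x
  rw [capS, mem_ofPred_eq, height_eq, sub_le_sub_iff_left,
    Real.strictAntiOn_cos.le_iff_ge hp ⟨hα, hαπ⟩]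
  exact and_iff_left hp.2

/-- The density in heights is the density in polar angles. -/
lemma withDensity_capDensity (hh : ContDiff ℝ 2 h) (hα : 0 < α) (hαπ : α < Real.pi)
    (hq : ∀ ξ ∈ Icc α Real.pi, q ξ = h √(1 + Real.cos ξ)) (c : ℝ) :
    surfaceMeasure.withDensity
        (fun x => capDensity (1 - Real.cos α) (capSource h c) (height x)) =
      (surfaceMeasure.restrict (capS α)).withDensity
        fun x => ENNReal.ofReal (densityFormula q α c (polarAngle x)) := by
  have hcap : capS α = height ⁻¹' Ici (1 - Real.cos α) :=
    Set.ext fun x => mem_capS_iff hα.le hαπ.le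
  have hm : MeasurableSet (capS α) := by
    rw [hcap]
    exact measurable_height measurableSet_Ici
  rw [← withDensity_indicator hm]
  refine withDensity_congr_ae ?_
  have hne : ∀ᵐ x ∂surfaceMeasure, height x ≠ 1 - Real.cos α :=
    (ae_surfaceMeasure_height_iff (P := fun y => y ≠ 1 - Real.cos α)
      (measurableSet_singleton _).compl).2 (ae_restrict_of_ae (Measure.ae_ne _ _))
  filter_upwards [ae_surfaceMeasure_height, hne] with x hx hxa
  by_cases hxc : x ∈ capS α
  · have hlt := ((mem_capS_iff hα.le hαπ.le).1 hxc).lt_of_ne' hxa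
    have hφ : polarAngle x ∈ Ioo α Real.pi := by
      refine ⟨hxc.1.lt_of_ne fun he => hxa ?_, (polarAngle_mem_Ioo hx).2⟩
      rw [height_eq, ← he]
    rw [indicator_of_mem hxc, capDensity, indicator_of_mem (mem_Ioo.2 ⟨hlt, hx.2⟩),
      densityFormula_eq hh hα hq c hφ, ← height_eq]
  · rw [indicator_of_notMem hxc, capDensity, indicator_of_notMem]
    exact fun hmem => hxc ((mem_capS_iff hα.le hαπ.le).2 hmem.1.le)

end

lemma capS_pi : capS Real.pi = {sph 0 Real.pi} := by
  ext x
  constructor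
  · intro hx
    obtain ⟨θ, hθ⟩ := exists_eq_sph x
    rw [le_antisymm hx.2 hx.1] at hθ
    rw [hθ, mem_singleton_iff]
    simp [sph]
  · rintro rfl
    exact sph_mem_capS Real.pi_pos.le ⟨le_rfl, le_rfl⟩

end SphereEnergy

open SphereEnergy in
theorem theorem3
    (E : Set SphereEnergy.S2) (hE : IsCompact E)
    (Q : SphereEnergy.S2 → ℝ≥0∞) (hQ : SphereEnergy.IsExternalField E Q)
    (hsymm : ∀ x ∈ E, ∀ y ∈ E,
      SphereEnergy.polarAngle x = SphereEnergy.polarAngle y → Q x = Q y)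
    (μ : Measure SphereEnergy.S2) (hμ : SphereEnergy.IsExtremal E Q μ)
    (α : ℝ) (hα : 0 < α) (hαpi : α ≤ Real.pi)
    (hsupp : μ.support = SphereEnergy.capS α)
    (N : Set SphereEnergy.S2) (hN : IsOpen N) (hSN : μ.support ⊆ N)
    (hfin : ∀ x ∈ N, Q x ≠ ⊤)
    (hC2 : ContMDiffOn (𝓡 2) 𝓘(ℝ, ℝ) 2 (fun x : SphereEnergy.S2 => (Q x).toReal) N) :
    -- the transforms defining `g` and `F` make sense
    (∀ t ∈ Ioo α Real.pi,
      IntervalIntegrable (SphereEnergy.innerIntegrand (SphereEnergy.profile Q) t)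
        volume t Real.pi ∧
      DifferentiableAt ℝ (SphereEnergy.innerAbel (SphereEnergy.profile Q)) t) ∧
    (∀ φ ∈ Ioo α Real.pi,
      IntervalIntegrable (SphereEnergy.outerIntegrand (SphereEnergy.profile Q) φ)
        volume α φ ∧
      DifferentiableAt ℝ (SphereEnergy.outerAbel (SphereEnergy.profile Q) α) φ) ∧
    IntervalIntegrable
      (fun φ => SphereEnergy.auxF (SphereEnergy.profile Q) α φ * Real.sin φ)
      volume α Real.pi ∧
    -- the constant `F_Q`
    SphereEnergy.minEnergy E Q ≠ ⊤ ∧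
    SphereEnergy.robinConst E Q μ =
      Real.pi / (Real.sin α + Real.pi - α) *
        (1 - 2 * Real.pi *
          ∫ φ in α..Real.pi,
            SphereEnergy.auxF (SphereEnergy.profile Q) α φ * Real.sin φ) ∧
    -- the density of `μ` with respect to surface measure on the cap
    (∀ φ ∈ Ioo α Real.pi,
      0 ≤ SphereEnergy.densityFormula (SphereEnergy.profile Q) α
        (SphereEnergy.robinConst E Q μ) φ) ∧
    μ = (SphereEnergy.surfaceMeasure.restrict (SphereEnergy.capS α)).withDensity
      (fun x => ENNReal.ofReal
        (SphereEnergy.densityFormula (SphereEnergy.profile Q) α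
          (SphereEnergy.robinConst E Q μ) (SphereEnergy.polarAngle x))) := by
  have hp := Real.pi_pos
  have hV := minEnergy_ne_top hE.isClosed hQ
  obtain ⟨henergy, -, hc0⟩ := robinConst_eq hμ hV
  obtain ⟨⟨hprob, hμE⟩, -⟩ := id hμ
  have hμcap : ∀ᵐ x ∂μ, x ∈ capS α := by
    rw [ae_iff]
    have := Measure.measure_compl_support (μ := μ)
    rwa [hsupp] at this
  have hcapN : capS α ⊆ N := hsupp ▸ hSN
  have hcapE : capS α ⊆ E := hsupp ▸ Measure.support_subset_of_isClosed hE.isClosed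
    (mem_ae_iff.2 hμE)
  -- A cap degenerated to the South Pole would carry an atom, hence infinite energy.
  have hαπ : α < Real.pi := by
    refine hαpi.lt_of_ne fun h => ?_
    rw [h, capS_pi] at hμcap
    have h1 : μ ({sph 0 Real.pi}ᶜ) = 0 := hμcap
    rw [prob_compl_eq_zero_iff (measurableSet_singleton _),
      measure_singleton_eq_zero henergy] at h1
    exact zero_ne_one h1
  obtain ⟨h, hh, hq⟩ := exists_profile_extension hN hα hαpi hcapN hC2
  obtain ⟨hpotμ, hpotσ⟩ := potential_add_field_eq hE.isClosed hQ hμ hN hSN hfin hC2.continuousOn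
  have ha := one_sub_cos_mem ⟨hα, hαπ⟩
  have hh1 : ContDiff ℝ 1 h := hh.of_le one_le_two
  set c := robinConst E Q μ with hc
  have hheight : ∀ x : S2, √(2 - height x) = √(1 + Real.cos (polarAngle x)) := by
    intro x
    rw [height_eq]
    congr 1
    ring
  have hQh : ∀ x ∈ capS α, Q x = ENNReal.ofReal (h √(2 - height x)) := by
    intro x hx
    have hs : sph 0 (polarAngle x) ∈ capS α := sph_mem_capS hα.le hx
    rw [hheight, ← hq _ hx, profile, ENNReal.ofReal_toReal (hfin _ (hcapN hs))]
    exact hsymm x (hcapE hx) _ (hcapE hs) (polarAngle_sph (polarAngle_mem x)).symm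
  have hh0 : ∀ y ∈ Icc (1 - Real.cos α) 2, 0 ≤ h √(2 - y) := by
    intro y hy
    have hcos : Real.cos (Real.arccos (1 - y)) = 1 - y :=
      Real.cos_arccos (by linarith [hy.2]) (by linarith [hy.1, ha.1])
    have hmem : Real.arccos (1 - y) ∈ Icc α Real.pi := by
      refine ⟨?_, Real.arccos_le_pi _⟩
      rw [← Real.arccos_cos hα.le hαpi]
      exact Real.antitone_arccos (by linarith [hy.1])
    have := hq _ hmem
    rw [hcos, show 1 + (1 - y) = 2 - y by ring] at this
    rw [← this]
    exact ENNReal.toReal_nonneg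
  have hpole : ∀ᵐ x ∂μ, x ≠ sph 0 Real.pi := by
    rw [ae_iff]
    simpa using measure_singleton_eq_zero henergy (sph 0 Real.pi)
  have hrep := add_posMeasure_eq hh ha.1 ha.2 hc0 hh0 (μ := μ)
    (by
      filter_upwards [hμcap, hpole] with x hx hne
      refine ⟨(mem_capS_iff hα.le hαpi).1 hx, (height_mem x).2.lt_of_ne fun h2 => hne ?_⟩
      rw [← mem_singleton_iff, ← capS_pi, mem_capS_iff hp.le le_rfl, h2, Real.cos_pi]
      norm_num)
    (by
      filter_upwards [hμcap, hpotμ] with x hx hpx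
      rwa [← hQh x hx])
    (by
      rw [ae_restrict_iff' Measure.isClosed_support.measurableSet] at hpotσ
      filter_upwards [hpotσ] with x hpx hx
      have hxc := (mem_capS_iff hα.le hαpi).2 hx
      rw [← hQh x hxc]
      exact hpx (hsupp ▸ hxc))
  have hk := contDiffOn_capSource hh c
  have hki := intervalIntegrable_deriv_capSource hh c ha.1 ha.2
  obtain ⟨hnn, hμeq⟩ := eq_withDensity_capDensity ha.1 ha.2 hk hki hrep
  obtain ⟨hFint, -, -⟩ := integral_auxF hh hα hαπ hq
  refine ⟨fun t ht => ⟨(innerAbel_eq hh1.continuous hα.le hq (Ioo_subset_Ico_self ht)).1,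
      (hasDerivAt_innerAbel hh1 hα.le hq ht).differentiableAt⟩,
    fun φ hφ => ⟨(outerAbel_eq hh1 hα.le hq hφ).1,
      (hasDerivAt_outerAbel hh hα hq hφ).differentiableAt⟩, hFint, hV, ?_, fun φ hφ => ?_, ?_⟩
  · have hmass : μ univ = 1 := measure_univ
    rw [hμeq, withDensity_apply _ MeasurableSet.univ, setLIntegral_univ,
      lintegral_capDensity ha.1 ha.2 hk hki hnn, ENNReal.ofReal_eq_one,
      integral_halfDeriv_capSource hh hα hαπ hq] at hmass
    have hs : 0 < Real.sin α := Real.sin_pos_of_pos_of_lt_pi hα hαπ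
    have hs' : Real.sin α + Real.pi - α ≠ 0 := by linarith
    rw [← hmass]
    field_simp
    ring
  · rw [densityFormula_eq hh hα hq c hφ]
    exact mul_nonneg (by positivity) (hnn _ ⟨one_sub_cos_lt hα.le hφ.1 hφ.2.le,
      (one_sub_cos_mem ⟨hα.trans hφ.1, hφ.2⟩).2⟩)
  · rw [← withDensity_capDensity hh hα hαπ hq c]
    exact hμeq
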